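/- Let $n\ge 1$, $N=n+2$, let $X\subset\mathbb{R}^{n}$ be a non-empty bounded open set, let $\delta>0$, and let $\mathbb{M}=(0,\delta)\times(0,\delta)\times X$ be the stretched corner with coordinates $(x_1,x_2,x')$. Write $\nabla_{\mathbb M}=(x_1\partial_{x_1},\,x_1x_2\partial_{x_2},\,\partial_{x'_1},\dots,\partial_{x'_n})$, $\mathrm{div}_{\mathbb M}=\nabla_{\mathbb M}\cdot$ and $d\sigma=\frac{dx_1}{x_1}\frac{dx_2}{x_1x_2}dx'$. For $\gamma_1,\gamma_2\in\mathbb R$ and $p\ge1$ let $L_p^{\gamma_1,\gamma_2}(\mathbb M)$ be the space with norm $\big(\int_{\mathbb M}|x_1^{N/p-\gamma_1}x_2^{N/p-\gamma_2}u|^p\,d\sigma\big)^{1/p}$, let $\mathcal H^{1,(\gamma_1,\gamma_2)}_{p}(\mathbb M)$ be the space of all $u\in W^{1,p}_{\mathrm{loc}}(\mathbb M)$ such that $u$ and the components of the weak gradient $\nabla_{\mathbb M}u$ lie in $L_p^{\gamma_1,\gamma_2}(\mathbb M)$, normed accordingly, and let $\mathcal H^{1,(\gamma_1,\gamma_2)}_{p,0}(\mathbb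 M)$ be the closure of $C_0^\infty(\mathbb M)$ in it. Let $2<p<N$, $p<q<p^*=\frac{Np}{N-p}$, $q<p(p+1)$ and $\lambda>0$. (The condition $q<p(p+1)$ follows from $q<p^*$ if $p\le N-1$.) Then the Dirichlet problem $$-(x_1x_2)^{-p}\,\mathrm{div}_{\mathbb M}\big(|\nabla_{\mathbb M}u|^{p-2}\nabla_{\mathbb M}u\big)=\lambda|u|^{q-2}u\ \text{ in }\mathbb M,\qquad u=0\ \text{ on }\partial\mathbb M,$$ has infinitely many non-trivial weak solutions, that is, there are infinitely many (almost everywhere different) non-zero $u\in\mathcal H^{1,(\frac{N-1}{p},\frac Np)}_{p,0}(\mathbb M)$ such that for all $\varphi\in C_0^\infty(\mathbb M)$ $$\int_{\mathbb M}x_1|\nabla_{\mathbb M}u|^{p-2}\nabla_{\mathbb M}u\cdot\nabla_{\mathbb M}\varphi\,d\sigma=\lambda\int_{\mathbb M}x_1(x_1x_2)^p|u|^{q-2}u\,\varphi\,d\sigma ,$$ where both integrals converge absolutely. -/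

import Mathlib

open MeasureTheory
open scoped ContDiff

noncomputable section

namespace StretchedCorner

/-- The ambient space `ℝ^N`, `N = n + 2`, with coordinates `x 0 = x₁`, `x 1 = x₂` and
`x (i + 2) = x'ᵢ`. -/
abbrev Amb (n : ℕ) : Type := EuclideanSpace ℝ (Fin (n + 2))

/-- The component `x' ∈ ℝ^n` of the point `(x₁, x₂, x')`. -/
def base {n : ℕ} (x : Amb n) : EuclideanSpace ℝ (Fin n) :=
  WithLp.toLp 2 (fun i => x i.succ.succ)

/-- The stretched corner `𝕄 = (0,δ) × (0,δ) × X`. -/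
def corner {n : ℕ} (δ : ℝ) (X : Set (EuclideanSpace ℝ (Fin n))) : Set (Amb n) :=
  {x | x 0 ∈ Set.Ioo 0 δ ∧ x 1 ∈ Set.Ioo 0 δ ∧ base x ∈ X}

/-- The measure `dσ = (dx₁/x₁) (dx₂/(x₁x₂)) dx'` on `𝕄`. -/
def sigma {n : ℕ} (δ : ℝ) (X : Set (EuclideanSpace ℝ (Fin n))) : Measure (Amb n) :=
  (volume.restrict (corner δ X)).withDensity
    (fun x => ENNReal.ofReal (1 / (x 0 * (x 0 * x 1))))

/-- The corner gradient `∇_𝕄 u = (x₁ ∂_{x₁} u, x₁x₂ ∂_{x₂} u, ∂_{x'₁} u, …, ∂_{x'ₙ} u)` at `x`,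
in terms of the value `g` of the ordinary gradient of `u` at `x`. -/
def cornerGrad {n : ℕ} (x g : Amb n) : Amb n :=
  WithLp.toLp 2 (fun i => (if i = 0 then x 0 else if i = 1 then x 0 * x 1 else 1) * g i)

/-- `φ ∈ C_0^∞(Ω)`. -/
def IsTest {n : ℕ} (Ω : Set (Amb n)) (φ : Amb n → ℝ) : Prop :=
  ContDiff ℝ ∞ φ ∧ HasCompactSupport φ ∧ tsupport φ ⊆ Ω

/-- `G` is the weak (distributional) gradient of `u` in the open set `Ω`. -/
def HasWeakGradient {n : ℕ} (Ω : Set (Amb n)) (u : Amb n → ℝ) (G : Amb n → Amb n) : Prop :=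
  LocallyIntegrableOn u Ω volume ∧ LocallyIntegrableOn G Ω volume ∧
    ∀ φ : Amb n → ℝ, IsTest Ω φ → ∀ i : Fin (n + 2),
      ∫ x in Ω, u x * (gradient φ x) i = -∫ x in Ω, G x i * φ x

/-- The weight `x₁^{N/p - γ₁} x₂^{N/p - γ₂}`, `N = n + 2`. -/
def weight {n : ℕ} (p γ₁ γ₂ : ℝ) (x : Amb n) : ℝ :=
  x 0 ^ (((n : ℝ) + 2) / p - γ₁) * x 1 ^ (((n : ℝ) + 2) / p - γ₂)

/-- The norm of `L_p^{γ₁,γ₂}(𝕄)`, that is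
`(∫_𝕄 |x₁^{N/p - γ₁} x₂^{N/p - γ₂} f|^p dσ)^{1/p}`, with values in `[0, ∞]`. -/
def cornerNorm {n : ℕ} {F : Type} [NormedAddCommGroup F] [NormedSpace ℝ F]
    (δ : ℝ) (X : Set (EuclideanSpace ℝ (Fin n))) (p γ₁ γ₂ : ℝ) (f : Amb n → F) : ENNReal :=
  eLpNorm (fun x => weight p γ₁ γ₂ x • f x) (ENNReal.ofReal p) (sigma δ X)

/-- `f ∈ L_p^{γ₁,γ₂}(𝕄)`. -/
def MemCornerLp {n : ℕ} {F : Type} [NormedAddCommGroup F] [NormedSpace ℝ F]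
    (δ : ℝ) (X : Set (EuclideanSpace ℝ (Fin n))) (p γ₁ γ₂ : ℝ) (f : Amb n → F) : Prop :=
  MemLp (fun x => weight p γ₁ γ₂ x • f x) (ENNReal.ofReal p) (sigma δ X)

/-- `u ∈ H_p^{1,(γ₁,γ₂)}(𝕄)` with weak gradient `G`. Since the weights are bounded above and
below on compact subsets of `𝕄`, such a `u` lies in `W^{1,p}_loc(𝕄)`. -/
def MemH1 {n : ℕ} (δ : ℝ) (X : Set (EuclideanSpace ℝ (Fin n))) (p γ₁ γ₂ : ℝ)
    (u : Amb n → ℝ) (G : Amb n → Amb n) : Prop :=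
  HasWeakGradient (corner δ X) u G ∧
    MemCornerLp δ X p γ₁ γ₂ u ∧
    MemCornerLp δ X p γ₁ γ₂ (fun x => cornerGrad x (G x))

/-- `u ∈ H_{p,0}^{1,(γ₁,γ₂)}(𝕄)` with weak gradient `G`: the function `u` lies in
`H_p^{1,(γ₁,γ₂)}(𝕄)` and in the closure of `C_0^∞(𝕄)` in that space. -/
def MemH10 {n : ℕ} (δ : ℝ) (X : Set (EuclideanSpace ℝ (Fin n))) (p γ₁ γ₂ : ℝ)
    (u : Amb n → ℝ) (G : Amb n → Amb n) : Prop :=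
  MemH1 δ X p γ₁ γ₂ u G ∧
    ∀ ε : ENNReal, 0 < ε → ∃ φ : Amb n → ℝ, IsTest (corner δ X) φ ∧
      cornerNorm δ X p γ₁ γ₂ (fun x => u x - φ x) +
        cornerNorm δ X p γ₁ γ₂ (fun x => cornerGrad x (G x - gradient φ x)) < ε

/-- `u` is a weak solution of the Dirichlet problem
`-(x₁x₂)^{-p} div_𝕄(|∇_𝕄 u|^{p-2} ∇_𝕄 u) = lam |u|^{q-2} u` in `𝕄`, `u = 0` on the boundary:
`u ∈ H_{p,0}^{1,((N-1)/p, N/p)}(𝕄)`, and for all `φ ∈ C_0^∞(𝕄)` both integrals converge and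
`∫ x₁ |∇_𝕄 u|^{p-2} ∇_𝕄 u · ∇_𝕄 φ dσ = lam ∫ x₁ (x₁x₂)^p |u|^{q-2} u φ dσ`. -/
def IsWeakSolution {n : ℕ} (δ : ℝ) (X : Set (EuclideanSpace ℝ (Fin n))) (p q lam : ℝ)
    (u : Amb n → ℝ) : Prop :=
  ∃ G : Amb n → Amb n,
    MemH10 δ X p (((n : ℝ) + 2 - 1) / p) (((n : ℝ) + 2) / p) u G ∧
    ∀ φ : Amb n → ℝ, IsTest (corner δ X) φ →
      Integrable (fun x => x 0 * (‖cornerGrad x (G x)‖ ^ (p - 2) *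
        inner ℝ (cornerGrad x (G x)) (cornerGrad x (gradient φ x)))) (sigma δ X) ∧
      Integrable (fun x => x 0 * (x 0 * x 1) ^ p * (|u x| ^ (q - 2) * u x * φ x)) (sigma δ X) ∧
      ∫ x, x 0 * (‖cornerGrad x (G x)‖ ^ (p - 2) *
          inner ℝ (cornerGrad x (G x)) (cornerGrad x (gradient φ x))) ∂(sigma δ X) =
        lam * ∫ x, x 0 * (x 0 * x 1) ^ p * (|u x| ^ (q - 2) * u x * φ x) ∂(sigma δ X)

end StretchedCorner

end

/-! Up to a scalar factor, solutions are critical points of the norm of u in L^q(x₁(x₁x₂)^p dσ) on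
the unit sphere of the energy norm (∫ x₁|∇_𝕄u|^p dσ)^{1/p}. The energy space is the closure in
L^p(σ) of the weighted gradients x₁^{1/p}∇_𝕄φ of test functions. Clarkson's inequality makes it
uniformly convex, and Poincaré's inequality in an x'-direction, available because X is bounded,
shows that the energy controls u itself.

Critical values come from a minimax. Let Q be the inclusion of the energy space into the weighted
L^q, and let c_m be the supremum, over odd continuous maps g of the m-sphere into the unit ball, of
the lower bounds of ‖Q g‖. A nonlinear power method takes the place of a deformation lemma: u is
replaced by the point of the unit ball at which (norming functional of Qu)∘Q attains its norm. This
step is odd, continuous where Qu ≠ 0, and never decreases ‖Qu‖. Applied to a nearly optimal g it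
must therefore almost stall at some point of the sphere. Stalling points subconverge, by compactness
of Q and uniform convexity, to a critical point with value c_m (`exists_criticalValue`). Each c_m is
positive because the energy space is infinite dimensional. For suitable m it is arbitrarily small: Q
maps the unit ball into a neighbourhood of a finite set, and the Borsuk–Ulam theorem gives a point
of the sphere at which all norming functionals of that set vanish (`exists_level_le`). So there are
infinitely many critical values. Since p ≠ q, scaling absorbs the Lagrange multiplier, and different
critical values give solutions with different L^q norms.

Compactness of Q (`exists_subseq_cauchy`) is proved on dyadic cells x₁ ∼ ε₁, x₂ ∼ ε₂. Rescaling a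
cell to unit size and applying the subcritical Sobolev inequality bounds its contribution by a
constant times ε₁^{p+1-q/p} ε₂^p times a power of the energy. This is summable because q < p(p+1),
so finitely many cells matter, and on each of them Rellich's theorem applies.

The Borsuk–Ulam theorem is proved with mod 2 chains: on a fine antipodally built hemisphere, an odd
number of simplices change the sign of every coordinate of the map (`exists_hemisphere`). -/

noncomputable section

/-! ### Mod 2 chains of tuples, prisms, and the label-change cocycle. -/

namespace OddChain

variable {V : Type*}

/-- Chains mod 2 of ordered tuples of points of `V`. -/
abbrev Chain (V : Type*) : Type _ := List V →₀ ZMod 2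

theorem Chain.add_self (c : Chain V) : c + c = 0 := by
  ext l; exact CharTwo.add_self_eq_zero _

/-- Prepend a point to every tuple of a chain. -/
def consL (x : V) : Chain V →ₗ[ZMod 2] Chain V := Finsupp.lmapDomain _ _ (List.cons x)

/-- The chain map induced by a map of points. -/
def mapL (g : V → V) : Chain V →ₗ[ZMod 2] Chain V := Finsupp.lmapDomain _ _ (List.map g)

/-- The (augmented) boundary of a tuple. -/
def bdryList : List V → Chain V
  | [] => 0
  | x :: l => Finsupp.single l 1 + consL x (bdryList l)

/-- The boundary operator. -/
def bdry : Chain V →ₗ[ZMod 2] Chain V := Finsupp.linearCombination (ZMod 2) bdryList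

/-- The prism over a tuple between the maps `g` and `k`. -/
def prismList (g k : V → V) : List V → Chain V
  | [] => 0
  | x :: l => Finsupp.single (g x :: k x :: l.map k) 1 + consL (g x) (prismList g k l)

/-- The prism operator between the maps `g` and `k`. -/
def prism (g k : V → V) : Chain V →ₗ[ZMod 2] Chain V :=
  Finsupp.linearCombination (ZMod 2) (prismList g k)

@[simp] theorem consL_single (x : V) (l : List V) (a : ZMod 2) :
    consL x (Finsupp.single l a) = Finsupp.single (x :: l) a := by
  simp [consL]

@[simp] theorem mapL_single (g : V → V) (l : List V) (a : ZMod 2) :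
    mapL g (Finsupp.single l a) = Finsupp.single (l.map g) a := by
  simp [mapL]

@[simp] theorem bdry_single (l : List V) : bdry (Finsupp.single l 1) = bdryList l := by
  simp [bdry]

@[simp] theorem prism_single (g g' : V → V) (l : List V) :
    prism g g' (Finsupp.single l 1) = prismList g g' l := by
  simp [prism]

theorem linearMap_ext {M : Type*} [AddCommMonoid M] [Module (ZMod 2) M]
    {f g : Chain V →ₗ[ZMod 2] M}
    (h : ∀ l, f (Finsupp.single l 1) = g (Finsupp.single l 1)) : f = g :=
  Finsupp.lhom_ext' fun l => LinearMap.ext_ring (h l)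

theorem mapL_comp_consL (g : V → V) (x : V) (c : Chain V) :
    mapL g (consL x c) = consL (g x) (mapL g c) := by
  have : (mapL g).comp (consL x) = (consL (g x)).comp (mapL g) :=
    linearMap_ext fun l => by simp
  exact LinearMap.congr_fun this c

theorem mapL_mapL (g g' : V → V) (c : Chain V) : mapL g (mapL g' c) = mapL (g ∘ g') c := by
  have : (mapL g).comp (mapL g') = mapL (g ∘ g') := linearMap_ext fun l => by simp
  exact LinearMap.congr_fun this c

theorem bdry_consL (x : V) (c : Chain V) : bdry (consL x c) = c + consL x (bdry c) := by
  have : bdry.comp (consL x) = LinearMap.id + (consL x).comp bdry :=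
    linearMap_ext fun l => by simp [bdryList]
  exact LinearMap.congr_fun this c

theorem bdry_mapL (g : V → V) (c : Chain V) : bdry (mapL g c) = mapL g (bdry c) := by
  have : bdry.comp (mapL g) = (mapL g).comp bdry := linearMap_ext fun l => by
    simp only [LinearMap.comp_apply, mapL_single, bdry_single]
    induction l with
    | nil => simp [bdryList]
    | cons x l ih => simp [bdryList, ih, mapL_comp_consL]
  exact LinearMap.congr_fun this c

theorem bdry_bdry (c : Chain V) : bdry (bdry c) = 0 := by
  have : bdry.comp bdry = (0 : Chain V →ₗ[ZMod 2] Chain V) := linearMap_ext fun l => by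
    simp only [LinearMap.comp_apply, bdry_single, LinearMap.zero_apply]
    induction l with
    | nil => simp [bdryList]
    | cons x l ih => simp [bdryList, bdry_consL, ih, Chain.add_self]
  exact LinearMap.congr_fun this c

theorem prism_consL (g g' : V → V) (x : V) (c : Chain V) :
    prism g g' (consL x c) = consL (g x) (consL (g' x) (mapL g' c)) + consL (g x) (prism g g' c) := by
  have : (prism g g').comp (consL x) =
      (consL (g x)).comp ((consL (g' x)).comp (mapL g')) + (consL (g x)).comp (prism g g') :=
    linearMap_ext fun l => by simp [prismList]
  exact LinearMap.congr_fun this c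

theorem bdry_prism (g g' : V → V) (c : Chain V) :
    bdry (prism g g' c) + prism g g' (bdry c) = mapL g c + mapL g' c := by
  have : bdry.comp (prism g g') + (prism g g').comp bdry = mapL g + mapL g' :=
    linearMap_ext fun l => by
    simp only [LinearMap.comp_apply, LinearMap.add_apply, bdry_single, prism_single, mapL_single]
    induction l with
    | nil => simp [bdryList, prismList, Chain.add_self]
    | cons x l ih =>
      -- In characteristic 2 an equality can be proved as the vanishing of a sum, so that all
      -- repeated terms simply cancel in pairs.
      have e : ∀ a b : Chain V, a + b = 0 → a = b := fun a b h => by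
        rw [← add_zero a, ← Chain.add_self b, ← add_assoc, h, zero_add]
      have ih' := congrArg (consL (g x)) ih
      simp only [map_add, consL_single] at ih'
      simp only [bdryList, prismList, map_add, bdry_single, bdry_consL, consL_single, prism_single,
        prism_consL, List.map_cons]
      have h1 : bdryList (List.map g' l) = mapL g' (bdryList l) := by
        simpa using bdry_mapL g' (Finsupp.single l 1)
      rw [h1]
      set A := consL (g x) (bdry (prismList g g' l))
      set B := consL (g x) (prism g g' (bdryList l))
      set D := consL (g x) (consL (g' x) (mapL g' (bdryList l)))
      set P := prismList g g' l
      have hD := Chain.add_self D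
      have hP := Chain.add_self P
      have hs := Chain.add_self (Finsupp.single (g x :: List.map g' l) 1 : Chain V)
      apply e
      calc _ = (A + B) + (Finsupp.single (g x :: List.map g' l) 1
            + Finsupp.single (g x :: List.map g l) 1) + (D + D) + (P + P)
            + (Finsupp.single (g' x :: List.map g' l) 1
              + Finsupp.single (g' x :: List.map g' l) 1) := by abel
        _ = 0 := by
          rw [ih', hD, hP, Chain.add_self]
          rw [add_zero, add_zero, add_zero,
            add_comm (Finsupp.single (g x :: List.map g' l) 1 : Chain V), Chain.add_self]
  exact LinearMap.congr_fun this c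

/-- Linear extension of a function on tuples to chains. -/
def eval (φ : List V → ZMod 2) : Chain V →ₗ[ZMod 2] ZMod 2 := Finsupp.linearCombination (ZMod 2) φ

@[simp] theorem eval_single (φ : List V → ZMod 2) (l : List V) :
    eval φ (Finsupp.single l 1) = φ l := by simp [eval]

/-- The cochain counting successive changes of the labels `θ (j-1), …, θ 0` along a tuple. -/
def changes (θ : ℕ → V → ZMod 2) : ℕ → List V → ZMod 2
  | 0, _ => 1
  | j + 1, x :: y :: l => (θ j x + θ j y) * changes θ j (y :: l)
  | _ + 1, _ => 0

/-- The cochain `changes` multiplied by the next label of the first point. -/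
def labelled (θ : ℕ → V → ZMod 2) (j : ℕ) : List V → ZMod 2
  | [] => 0
  | x :: l => θ j x * changes θ j (x :: l)

/-- Chains supported in tuples with a given property. -/
abbrev supp (P : List V → Prop) : Submodule (ZMod 2) (Chain V) :=
  Finsupp.supported (ZMod 2) (ZMod 2) {l | P l}

theorem map_mem_of_supp {M : Type*} [AddCommMonoid M] [Module (ZMod 2) M]
    {P : List V → Prop} (f : Chain V →ₗ[ZMod 2] M) (S : Submodule (ZMod 2) M)
    (h : ∀ l, P l → f (Finsupp.single l 1) ∈ S) {c : Chain V} (hc : c ∈ supp P) : f c ∈ S := by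
  have hle : supp P ≤ S.comap f := by
    rw [supp, Finsupp.supported_eq_span_single, Submodule.span_le]
    rintro _ ⟨l, hl, rfl⟩
    exact h l hl
  exact hle hc

theorem single_mem_supp {P : List V → Prop} {l : List V} (h : P l) :
    (Finsupp.single l 1 : Chain V) ∈ supp P :=
  Finsupp.single_mem_supported _ _ h

theorem eq_of_supp {M : Type*} [AddCommGroup M] [Module (ZMod 2) M]
    {P : List V → Prop} (f g : Chain V →ₗ[ZMod 2] M)
    (h : ∀ l, P l → f (Finsupp.single l 1) = g (Finsupp.single l 1))
    {c : Chain V} (hc : c ∈ supp P) : f c = g c := by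
  have := map_mem_of_supp (f - g) ⊥ (fun l hl => by simp [h l hl]) hc
  simpa [sub_eq_zero] using this

theorem bdryList_length (l : List V) (k : ℕ) (h : l.length = k + 1) :
    bdryList l ∈ supp fun l' : List V => l'.length = k := by
  induction l generalizing k with
  | nil => simp at h
  | cons x l ih =>
    have hl : l.length = k := by simpa using h
    refine Submodule.add_mem _ (single_mem_supp hl) ?_
    cases k with
    | zero => rw [List.length_eq_zero_iff.mp hl]; simp [bdryList]
    | succ k =>
      exact map_mem_of_supp (consL x) _ (fun l' hl' => by
        rw [consL_single]; exact single_mem_supp (by simpa using hl')) (ih k hl)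

/-- The product of successive label differences is the coboundary of `labelled θ j`. The two claims
feed each other: the cocycle property at j gives the coboundary formula at j, and this together with
∂∂ = 0 gives the cocycle property at j + 1. -/
theorem changes_cocycle (θ : ℕ → V → ZMod 2) (j : ℕ) :
    (∀ c ∈ supp (fun l : List V => l.length = j + 2), eval (changes θ j) (bdry c) = 0) ∧
    (∀ c ∈ supp (fun l : List V => l.length = j + 2),
      eval (labelled θ j) (bdry c) = eval (changes θ (j + 1)) c) := by
  have key : ∀ j, (∀ c ∈ supp (fun l : List V => l.length = j + 2),
        eval (changes θ j) (bdry c) = 0) →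
      (∀ c ∈ supp (fun l : List V => l.length = j + 2),
      eval (labelled θ j) (bdry c) = eval (changes θ (j + 1)) c) := by
    intro j hj c hc
    refine eq_of_supp ((eval (labelled θ j)).comp bdry) (eval (changes θ (j + 1))) ?_ hc
    intro l hl
    obtain ⟨x, y, l, rfl⟩ : ∃ x y l', l = x :: y :: l' := by
      match l, hl with
      | x :: y :: l', _ => exact ⟨x, y, l', rfl⟩
    have h0 := hj _ (single_mem_supp hl)
    have hc : ∀ c : Chain V, eval (labelled θ j) (consL x c) = θ j x * eval (changes θ j) (consL x c) := by
      intro c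
      have : (eval (labelled θ j)).comp (consL x) = θ j x • (eval (changes θ j)).comp (consL x) :=
        linearMap_ext fun l => by simp [labelled]
      exact LinearMap.congr_fun this c
    simp only [LinearMap.comp_apply, bdry_single, bdryList, map_add, eval_single, consL_single] at h0 ⊢
    have h2 : eval (changes θ j) (consL x (consL y (bdryList l))) =
        changes θ j (y :: l) + changes θ j (x :: l) := by
      have := CharTwo.add_self_eq_zero (changes θ j (y :: l) + changes θ j (x :: l))
      linear_combination h0 - this
    rw [hc, h2]
    simp only [labelled, changes]
    have := CharTwo.add_self_eq_zero (θ j x * changes θ j (x :: l))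
    linear_combination this
  have hall : ∀ j, ∀ c ∈ supp (fun l : List V => l.length = j + 2),
      eval (changes θ j) (bdry c) = 0 := by
    intro j
    induction j with
    | zero =>
      intro c hc
      refine eq_of_supp ((eval (changes θ 0)).comp bdry) 0 ?_ hc
      intro l hl
      match l, hl with
      | [x, y], _ => simp [bdryList, changes, CharTwo.add_self_eq_zero]
    | succ j ih =>
      intro c hc
      have hb : bdry c ∈ supp (fun l : List V => l.length = j + 2) :=
        map_mem_of_supp bdry _ (fun l hl => by
          rw [bdry_single]; exact bdryList_length l _ hl) hc
      rw [← key j ih _ hb, bdry_bdry, map_zero]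
  exact ⟨hall j, key j (hall j)⟩

end OddChain

end

/-! ### The Borsuk–Ulam theorem. -/

noncomputable section

namespace OddChain

theorem prismList_supp {V : Type*} (g g' : V → V) (l : List V) :
    prismList g g' l ∈ supp fun l' : List V =>
      l'.length = l.length + 1 ∧ ∀ z ∈ l', ∃ x ∈ l, z = g x ∨ z = g' x := by
  induction l with
  | nil => simp [prismList]
  | cons x l ih =>
    refine Submodule.add_mem _ (single_mem_supp ?_) (map_mem_of_supp _ _ ?_ ih)
    · refine ⟨by simp, fun z hz => ?_⟩
      simp only [List.mem_cons, List.mem_map] at hz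
      rcases hz with rfl | rfl | ⟨y, hy, rfl⟩
      · exact ⟨x, by simp, Or.inl rfl⟩
      · exact ⟨x, by simp, Or.inr rfl⟩
      · exact ⟨y, by simp [hy], Or.inr rfl⟩
    · rintro l' ⟨h1, h2⟩
      rw [consL_single]
      refine single_mem_supp ⟨by simp [h1], fun z hz => ?_⟩
      rcases List.mem_cons.mp hz with rfl | hz
      · exact ⟨x, by simp, Or.inl rfl⟩
      · obtain ⟨y, hy, h⟩ := h2 z hz
        exact ⟨y, by simp [hy], h⟩

/-- The telescoping sum of prisms between consecutive maps of a sequence. -/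
theorem bdry_sum_prism {V : Type*} (g : ℕ → V → V) (M : ℕ) (c : Chain V) (hc : bdry c = 0) :
    bdry (∑ l ∈ Finset.range M, prism (g l) (g (l + 1)) c) = mapL (g 0) c + mapL (g M) c := by
  induction M with
  | zero => simp [Chain.add_self]
  | succ M ih =>
    have := bdry_prism (g M) (g (M + 1)) c
    rw [hc, map_zero, add_zero] at this
    rw [Finset.sum_range_succ, map_add, ih, this]
    have h := Chain.add_self (mapL (g M) c)
    calc _ = mapL (g 0) c + mapL (g (M + 1)) c + (mapL (g M) c + mapL (g M) c) := by abel
      _ = _ := by rw [h, add_zero]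

/-- The `ℓ¹` unit sphere of `ℝ^(m+1)`. -/
def l1Sphere (m : ℕ) : Set (Fin (m + 1) → ℝ) := {x | ∑ i, |x i| = 1}

/-- The points of the `ℓ¹` unit sphere whose coordinates after the `j`-th vanish. -/
def subSphere (m j : ℕ) : Set (Fin (m + 1) → ℝ) :=
  {x | ∑ i, |x i| = 1 ∧ ∀ i : Fin (m + 1), j < i.val → x i = 0}

theorem norm_le_one_of_mem {m : ℕ} {x : Fin (m + 1) → ℝ} (hx : ∑ i, |x i| = 1) : ‖x‖ ≤ 1 := by
  rw [pi_norm_le_iff_of_nonneg zero_le_one]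
  intro i
  rw [← hx, Real.norm_eq_abs]
  exact Finset.single_le_sum (f := fun i => |x i|) (fun i _ => abs_nonneg _) (Finset.mem_univ i)

theorem isCompact_l1Sphere (m : ℕ) : IsCompact (l1Sphere m) := by
  apply Metric.isCompact_of_isClosed_isBounded
  · exact isClosed_eq (by fun_prop) continuous_const
  · exact (Metric.isBounded_closedBall (x := 0) (r := 1)).subset fun x hx => by
      simpa using norm_le_one_of_mem hx

theorem neg_mem_subSphere {m j : ℕ} {x : Fin (m + 1) → ℝ} (hx : x ∈ subSphere m j) :
    -x ∈ subSphere m j := by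
  simpa [subSphere] using hx

/-- The segment from `x` to `e`. -/
def cone {m : ℕ} (e : Fin (m + 1) → ℝ) (t : ℝ) (x : Fin (m + 1) → ℝ) : Fin (m + 1) → ℝ :=
  (1 - t) • x + t • e

/-- The points x and e have disjoint supports, so the ℓ¹ norm is affine along the segment and no
renormalization is needed. This is why the ℓ¹ sphere is used. -/
theorem cone_mem {m j : ℕ} (hj : j + 1 < m + 1) {x : Fin (m + 1) → ℝ} (hx : x ∈ subSphere m j)
    {t : ℝ} (h0 : 0 ≤ t) (h1 : t ≤ 1) :
    cone (Pi.single ⟨j + 1, hj⟩ 1) t x ∈ subSphere m (j + 1) := by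
  obtain ⟨hs, hz⟩ := hx
  refine ⟨?_, fun i hi => ?_⟩
  · have : ∀ i, |cone (Pi.single ⟨j + 1, hj⟩ 1) t x i| =
        (1 - t) * |x i| + t * (Pi.single ⟨j + 1, hj⟩ (1 : ℝ) : Fin (m + 1) → ℝ) i := by
      intro i
      by_cases hi : i = ⟨j + 1, hj⟩
      · subst hi
        have := hz ⟨j + 1, hj⟩ (by simp)
        simp [cone, this, abs_of_nonneg h0]
      · simp [cone, Pi.single_eq_of_ne hi, abs_mul, abs_of_nonneg (sub_nonneg.mpr h1)]
    rw [Finset.sum_congr rfl fun i _ => this i, Finset.sum_add_distrib, ← Finset.mul_sum,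
      ← Finset.mul_sum, hs, Finset.sum_pi_single']
    simp
  · have h1 : x i = 0 := hz i (by omega)
    have h2 : i ≠ ⟨j + 1, hj⟩ := by
      rintro rfl
      simp at hi
    simp [cone, h1, Pi.single_eq_of_ne h2]

/-- A time difference of at most 1/M enlarges distances by at most 2/M; hence the mesh j · (2/M)
after j coning steps. -/
theorem norm_cone_sub {m : ℕ} {e x y : Fin (m + 1) → ℝ} {s t ε : ℝ} (he : ‖e‖ ≤ 1)
    (hy : ‖y‖ ≤ 1) (h0 : 0 ≤ s) (h1 : s ≤ 1) (hxy : ‖x - y‖ ≤ ε) :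
    ‖cone e s x - cone e t y‖ ≤ ε + |t - s| * 2 := by
  have : cone e s x - cone e t y = (1 - s) • (x - y) + (t - s) • (y - e) := by
    simp only [cone]; module
  rw [this]
  refine (norm_add_le _ _).trans (add_le_add ?_ ?_)
  · rw [norm_smul, Real.norm_of_nonneg (by linarith)]
    nlinarith [norm_nonneg (x - y)]
  · rw [norm_smul, Real.norm_eq_abs]
    exact mul_le_mul_of_nonneg_left ((norm_sub_le _ _).trans (by linarith)) (abs_nonneg _)

/-- Tuples of `j + 1` points of the sphere of dimension `j` at mutual distance at most `ε`. -/
def Small (m j : ℕ) (ε : ℝ) (l : List (Fin (m + 1) → ℝ)) : Prop :=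
  l.length = j + 1 ∧ (∀ x ∈ l, x ∈ subSphere m j) ∧ ∀ x ∈ l, ∀ y ∈ l, ‖x - y‖ ≤ ε

/-- The antipodal map flips every label, hence preserves all label differences mod 2. -/
theorem changes_neg {m : ℕ} {θ : ℕ → (Fin (m + 1) → ℝ) → ZMod 2}
    (hθ : ∀ i, ∀ x ∈ l1Sphere m, θ i (-x) = θ i x + 1) (j : ℕ) (l : List (Fin (m + 1) → ℝ))
    (hl : ∀ x ∈ l, x ∈ l1Sphere m) : changes θ j (l.map Neg.neg) = changes θ j l := by
  induction j generalizing l with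
  | zero => simp [changes]
  | succ j ih =>
    match l with
    | [] => simp [changes]
    | [x] => simp [changes]
    | x :: y :: l =>
      have h := ih (y :: l) fun z hz => hl z (List.mem_cons_of_mem _ hz)
      have h1 := hθ j x (hl x (by simp))
      have h2 := hθ j y (hl y (by simp))
      simp only [List.map_cons, changes] at h ⊢
      rw [h, h1, h2]
      have : (1 : ZMod 2) + 1 = 0 := by decide
      linear_combination (changes θ j (y :: l)) * this

/-- A fine hemisphere of dimension `j`, on which the number of tuples with successive label
changes is odd. -/
theorem exists_hemisphere (m M : ℕ) (hM : 0 < M) {θ : ℕ → (Fin (m + 1) → ℝ) → ZMod 2}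
    (hθ : ∀ i, ∀ x ∈ l1Sphere m, θ i (-x) = θ i x + 1) (j : ℕ) (hj : j < m + 1) :
    ∃ h ∈ supp (Small m j (j * (2 / M))), bdry (h + mapL Neg.neg h) = 0 ∧
      eval (changes θ j) h = 1 := by
  induction j with
  | zero =>
    refine ⟨Finsupp.single [Pi.single 0 1] 1, single_mem_supp ?_, ?_, ?_⟩
    · refine ⟨rfl, ?_, by simp⟩
      simp only [List.mem_singleton, forall_eq]
      refine ⟨?_, fun i hi => Pi.single_eq_of_ne (by rintro rfl; simp at hi) _⟩
      have : ∀ i, |(Pi.single 0 (1 : ℝ) : Fin (m + 1) → ℝ) i| =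
          (Pi.single 0 (1 : ℝ) : Fin (m + 1) → ℝ) i := by
        intro i
        by_cases h : i = 0
        · subst h; simp
        · simp [Pi.single_eq_of_ne h]
      rw [Finset.sum_congr rfl fun i _ => this i, Finset.sum_pi_single']
      simp
    · simp [bdryList, Chain.add_self]
    · simp [changes]
  | succ j ih =>
    obtain ⟨h, hs, hb, he⟩ := ih (by omega)
    have hMR : (0 : ℝ) < M := by exact_mod_cast hM
    set c := h + mapL Neg.neg h with hc
    have hneg : ∀ l, Small m j (j * (2 / M)) l → Small m j (j * (2 / M)) (l.map Neg.neg) := by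
      rintro l ⟨h1, h2, h3⟩
      refine ⟨by simpa using h1, ?_, ?_⟩
      · intro x hx
        obtain ⟨y, hy, rfl⟩ := List.mem_map.mp hx
        exact neg_mem_subSphere (h2 y hy)
      · intro x hx x' hx'
        obtain ⟨y, hy, rfl⟩ := List.mem_map.mp hx
        obtain ⟨y', hy', rfl⟩ := List.mem_map.mp hx'
        rw [neg_sub_neg, norm_sub_rev]
        exact h3 y hy y' hy'
    have hcs : c ∈ supp (Small m j (j * (2 / M))) :=
      Submodule.add_mem _ hs (map_mem_of_supp _ _ (fun l hl => by
        rw [mapL_single]; exact single_mem_supp (hneg l hl)) hs)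
    set e : Fin (m + 1) → ℝ := Pi.single ⟨j + 1, hj⟩ 1 with hedef
    have hen : ‖e‖ ≤ 1 := by
      rw [hedef, pi_norm_le_iff_of_nonneg zero_le_one]
      intro i
      by_cases hi : i = ⟨j + 1, hj⟩
      · subst hi; simp
      · simp [Pi.single_eq_of_ne hi]
    -- The cone over c is cut into M layers, since one prism from the identity to the pole would not
    -- have small tuples.
    set g : ℕ → (Fin (m + 1) → ℝ) → (Fin (m + 1) → ℝ) := fun l => cone e (l / M) with hg
    set h' := ∑ l ∈ Finset.range M, prism (g l) (g (l + 1)) c with hh'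
    have hs' : h' ∈ supp (Small m (j + 1) ((j + 1 : ℕ) * (2 / M))) := by
      refine Submodule.sum_mem _ fun k hk => map_mem_of_supp _ _ ?_ hcs
      rintro l ⟨hl1, hl2, hl3⟩
      rw [prism_single]
      refine Finsupp.supported_mono (s := {l' | l'.length = l.length + 1 ∧
        ∀ z ∈ l', ∃ x ∈ l, z = g k x ∨ z = g (k + 1) x}) ?_ (prismList_supp (g k) (g (k + 1)) l)
      rintro l' ⟨hl'1, hl'2⟩
      have hkM : (k : ℝ) + 1 ≤ M := by exact_mod_cast Finset.mem_range.mp hk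
      have k0 : (0 : ℝ) ≤ k := Nat.cast_nonneg k
      have hcone : ∀ z ∈ l', ∃ x ∈ l, ∃ t : ℝ, (k : ℝ) / M ≤ t ∧ t ≤ (k + 1) / M ∧
          z = cone e t x := by
        intro z hz
        obtain ⟨x, hx, rfl | rfl⟩ := hl'2 z hz
        · exact ⟨x, hx, k / M, le_rfl, by gcongr; linarith, rfl⟩
        · exact ⟨x, hx, (k + 1) / M, by gcongr; linarith, le_rfl, by simp [hg]⟩
      have hb0 : (0 : ℝ) ≤ k / M := by positivity
      have hb1 : ((k : ℝ) + 1) / M ≤ 1 := (div_le_one hMR).mpr hkM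
      refine ⟨by rw [hl'1, hl1], fun z hz => ?_, fun z hz z' hz' => ?_⟩
      · obtain ⟨x, hx, t, ht0, ht1, rfl⟩ := hcone z hz
        exact cone_mem hj (hl2 x hx) (hb0.trans ht0) (ht1.trans hb1)
      · obtain ⟨x, hx, t, ht0, ht1, rfl⟩ := hcone z hz
        obtain ⟨y, hy, s, hs0, hs1, rfl⟩ := hcone z' hz'
        have hk1 : ((k : ℝ) + 1) / M = k / M + 1 / M := by ring
        have : |s - t| ≤ 1 / M := by rw [abs_le]; constructor <;> linarith
        refine (norm_cone_sub hen (norm_le_one_of_mem (hl2 y hy).1) (hb0.trans ht0)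
          (ht1.trans hb1) (hl3 x hx y hy)).trans ?_
        push_cast
        have : |s - t| * 2 ≤ 1 / M * 2 := by gcongr
        calc _ ≤ (j : ℝ) * (2 / M) + 1 / M * 2 := by gcongr
          _ = _ := by ring
    have hbh : bdry h' = c := by
      rw [hh', bdry_sum_prism g M c hb]
      have h0 : g 0 = id := by funext x; simp [hg, cone]
      -- The last map is constant equal to the pole, so the two antipodal halves of c have the same
      -- image and cancel.
      have h1 : mapL (g M) c = 0 := by
        have : g M ∘ Neg.neg = g M := by
          funext x; simp [hg, cone, div_self hMR.ne']
        rw [hc, map_add, mapL_mapL, this, Chain.add_self]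
      have hid : mapL (id : (Fin (m + 1) → ℝ) → _) = LinearMap.id :=
        linearMap_ext fun l => by simp
      rw [h1, h0, add_zero, hid, LinearMap.id_apply]
    refine ⟨h', hs', ?_, ?_⟩
    · rw [map_add, bdry_mapL, hbh, hc, map_add, mapL_mapL]
      have h2 : (Neg.neg : (Fin (m + 1) → ℝ) → _) ∘ Neg.neg = id := by funext x; simp
      have hid : mapL (id : (Fin (m + 1) → ℝ) → _) = LinearMap.id :=
        linearMap_ext fun l => by simp
      rw [h2, hid, LinearMap.id_apply, add_comm (mapL Neg.neg h) h, Chain.add_self]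
    · rw [← (changes_cocycle θ j).2 h' (Finsupp.supported_mono (fun l hl => hl.1) hs'), hbh, ← he]
      -- Between a tuple and its antipode the factor θ_j of the first point changes by 1 and the
      -- other factors do not change; the two terms add up to `changes θ j`.
      have : (eval (labelled θ j)).comp (LinearMap.id + mapL Neg.neg) h = eval (changes θ j) h := by
        refine eq_of_supp _ _ ?_ hs
        rintro l ⟨hl1, hl2, -⟩
        have hl3 : ∀ x ∈ l, x ∈ l1Sphere m := fun x hx => (hl2 x hx).1
        match l, hl1 with
        | x :: l, _ =>
          have hn := changes_neg hθ j (x :: l) hl3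
          simp only [LinearMap.comp_apply, LinearMap.add_apply, LinearMap.id_apply, mapL_single,
            map_add, eval_single, List.map_cons, labelled] at hn ⊢
          rw [hn, hθ j x (hl3 x (by simp))]
          have := CharTwo.add_self_eq_zero (θ j x * changes θ j (x :: l))
          linear_combination this
      simpa [hc] using this

theorem exists_label_change {V : Type*} (θ : ℕ → V → ZMod 2) (j : ℕ) (l : List V)
    (h : changes θ j l ≠ 0) (i : ℕ) (hi : i < j) : ∃ x ∈ l, ∃ y ∈ l, θ i x ≠ θ i y := by
  induction j generalizing l with
  | zero => omega
  | succ j ih =>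
    match l, h with
    | x :: y :: l, h =>
      simp only [changes] at h
      rcases Nat.lt_succ_iff_lt_or_eq.mp hi with hi | rfl
      · obtain ⟨a, ha, b, hb, hab⟩ := ih (y :: l) (right_ne_zero_of_mul h) hi
        exact ⟨a, List.mem_cons_of_mem _ ha, b, List.mem_cons_of_mem _ hb, hab⟩
      · refine ⟨x, by simp, y, by simp, fun hxy => left_ne_zero_of_mul h ?_⟩
        rw [hxy, CharTwo.add_self_eq_zero]

open Classical in
/-- The sign of `f i x`, ties being broken by a fixed choice between `x` and `-x`. -/
def signLabel {m : ℕ} (f : (Fin (m + 1) → ℝ) → Fin m → ℝ) (i : ℕ) (x : Fin (m + 1) → ℝ) : ZMod 2 :=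
  if h : i < m then
    if 0 < f x ⟨i, h⟩ ∨ (f x ⟨i, h⟩ = 0 ∧ WellOrderingRel x (-x)) then 1 else 0
  else if WellOrderingRel x (-x) then 1 else 0

/-- The tie rule is antisymmetric because x ≠ -x on the sphere. Indices i ≥ m get the tie rule
alone, as the hemisphere construction asks for oddness at every index. -/
theorem signLabel_neg {m : ℕ} {f : (Fin (m + 1) → ℝ) → Fin m → ℝ}
    (hf : ∀ x ∈ l1Sphere m, f (-x) = -f x) (i : ℕ) (x : Fin (m + 1) → ℝ) (hx : x ∈ l1Sphere m) :
    signLabel f i (-x) = signLabel f i x + 1 := by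
  have hne : x ≠ -x := by
    intro h
    have : x = 0 := by
      ext k
      have := congrFun h k
      simp only [Pi.neg_apply] at this
      simp only [Pi.zero_apply]; linarith
    simp [l1Sphere, this] at hx
  have hw : WellOrderingRel (-x) x ↔ ¬ WellOrderingRel x (-x) := by
    constructor
    · exact fun h h' => asymm h h'
    · intro h
      rcases trichotomous_of WellOrderingRel x (-x) with h' | h' | h'
      · exact absurd h' h
      · exact absurd h' hne
      · exact h'
  have h2 : (1 : ZMod 2) + 1 = 0 := by decide
  unfold signLabel
  rw [neg_neg, hf x hx]
  by_cases hi : i < m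
  · simp only [hi, dif_pos, Pi.neg_apply, hw]
    rcases lt_trichotomy (f x ⟨i, hi⟩) 0 with h | h | h
    · simp [h, h.not_gt, h.ne]
    · by_cases hw' : WellOrderingRel x (-x) <;> simp [h, hw, hw', h2]
    · simp [h, h.not_gt, h.ne', h2]
  · simp only [hi, dif_neg, not_false_eq_true, hw]
    by_cases hw' : WellOrderingRel x (-x) <;> simp [hw, hw', h2]

/-- **Borsuk–Ulam theorem** for the `ℓ¹` sphere. -/
theorem exists_zero_of_odd (m : ℕ) (f : (Fin (m + 1) → ℝ) → Fin m → ℝ)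
    (hc : ContinuousOn f (l1Sphere m)) (hf : ∀ x ∈ l1Sphere m, f (-x) = -f x) :
    ∃ x ∈ l1Sphere m, f x = 0 := by
  by_contra! hne
  have hSne : (l1Sphere m).Nonempty := by
    obtain ⟨h, hs, -, he⟩ := exists_hemisphere m 1 one_pos (signLabel_neg hf) 0 (by omega)
    obtain ⟨l, hl⟩ : ∃ l, l ∈ h.support := by
      by_contra! h0
      rw [Finsupp.support_eq_empty.mp (Finset.eq_empty_of_forall_notMem h0)] at he
      simp at he
    obtain ⟨h1, h2, -⟩ := hs (Finset.mem_coe.mpr hl)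
    match l, h1 with
    | [x], _ => exact ⟨x, (h2 x (by simp)).1⟩
  obtain ⟨x₀, hx₀, hmin⟩ := (isCompact_l1Sphere m).exists_isMinOn hSne hc.norm
  have hpos : 0 < ‖f x₀‖ := norm_pos_iff.mpr (hne x₀ hx₀)
  obtain ⟨η, hη, huc⟩ := Metric.uniformContinuousOn_iff.mp
    ((isCompact_l1Sphere m).uniformContinuousOn_of_continuous hc) (‖f x₀‖ / 2) (by positivity)
  -- This makes the mesh m · (2/M) of the m-dimensional hemisphere smaller than the modulus of
  -- continuity η.
  obtain ⟨M, hM⟩ := exists_nat_gt (2 * (m : ℝ) / η)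
  have hMpos : (0 : ℝ) < M := lt_of_le_of_lt (by positivity) hM
  obtain ⟨h, hs, -, he⟩ := exists_hemisphere m M (by exact_mod_cast hMpos) (signLabel_neg hf) m
    (by omega)
  obtain ⟨l, hlm, hl⟩ : ∃ l, Small m m (m * (2 / M)) l ∧ changes (signLabel f) m l ≠ 0 := by
    by_contra! h0
    have := map_mem_of_supp (eval (changes (signLabel f) m)) ⊥
      (fun l hl => by simpa using h0 l hl) hs
    rw [Submodule.mem_bot, he] at this
    exact one_ne_zero this
  obtain ⟨hl1, hl2, hl3⟩ := hlm
  match l, hl1 with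
  | x :: l, _ =>
    have hclose : ∀ y ∈ x :: l, ∀ z ∈ x :: l, dist (f y) (f z) < ‖f x₀‖ / 2 := by
      intro y hy z hz
      refine huc y (hl2 y hy).1 z (hl2 z hz).1 ?_
      rw [dist_eq_norm]
      refine (hl3 y hy z hz).trans_lt ?_
      rw [div_lt_iff₀ hη] at hM
      rw [← mul_div_assoc, div_lt_iff₀ hMpos]
      linarith
    -- Every coordinate of f takes both weak signs on the tuple, and f varies there by less than
    -- half of its minimal norm; so f x lies below the minimum.
    have : ‖f x‖ < ‖f x₀‖ := by
      rw [pi_norm_lt_iff hpos]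
      intro i
      obtain ⟨y, hy, z, hz, hyz⟩ := exists_label_change _ _ _ hl i i.isLt
      have hi : (⟨i.val, i.isLt⟩ : Fin m) = i := rfl
      have hsign : ∃ y ∈ x :: l, ∃ z ∈ x :: l, 0 ≤ f y i ∧ f z i ≤ 0 := by
        simp only [signLabel, i.isLt, dif_pos, hi] at hyz
        by_cases h1 : 0 < f y i ∨ (f y i = 0 ∧ WellOrderingRel y (-y))
        · by_cases h2 : 0 < f z i ∨ (f z i = 0 ∧ WellOrderingRel z (-z))
          · simp [h1, h2] at hyz
          · refine ⟨y, hy, z, hz, ?_, ?_⟩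
            · rcases h1 with h1 | h1
              · exact h1.le
              · exact h1.1.ge
            · exact not_lt.mp fun h => h2 (Or.inl h)
        · by_cases h2 : 0 < f z i ∨ (f z i = 0 ∧ WellOrderingRel z (-z))
          · refine ⟨z, hz, y, hy, ?_, ?_⟩
            · rcases h2 with h2 | h2
              · exact h2.le
              · exact h2.1.ge
            · exact not_lt.mp fun h => h1 (Or.inl h)
          · simp [h1, h2] at hyz
      obtain ⟨y, hy, z, hz, h1, h2⟩ := hsign
      have hxy := (dist_le_pi_dist (f x) (f y) i).trans_lt (hclose x (by simp) y hy)
      have hxz := (dist_le_pi_dist (f x) (f z) i).trans_lt (hclose x (by simp) z hz)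
      rw [Real.dist_eq, abs_lt] at hxy hxz
      rw [Real.norm_eq_abs, abs_lt]
      constructor <;> linarith
    exact absurd (hmin (hl2 x (by simp)).1) (not_le.mpr this)

end OddChain

end

/-! ### Minimax levels and the nonlinear power method. -/

noncomputable section

namespace PowerMethod

open Filter Topology OddChain

variable {E Y : Type*} [NormedAddCommGroup E] [NormedSpace ℝ E] [NormedAddCommGroup Y]
  [NormedSpace ℝ Y]

/-- `r` is a lower bound for `‖ι ·‖` on the image of the `m`-sphere in the unit ball of `E` under
an odd continuous map. -/
def IsLevel (ι : E →L[ℝ] Y) (m : ℕ) (r : ℝ) : Prop :=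
  ∃ g : (Fin (m + 1) → ℝ) → E, ContinuousOn g (l1Sphere m) ∧
    (∀ x ∈ l1Sphere m, g (-x) = -g x) ∧ (∀ x ∈ l1Sphere m, ‖g x‖ ≤ 1) ∧
    ∀ x ∈ l1Sphere m, r ≤ ‖ι (g x)‖

/-- The normalized linear parametrization of the span of the w_i is an admissible odd map, and ‖ι ·‖
has a positive minimum on its compact image. -/
theorem exists_pos_level {ι : E →L[ℝ] Y} {m : ℕ} {w : Fin (m + 1) → E}
    (hw : LinearIndependent ℝ fun i => ι (w i)) : ∃ r > 0, IsLevel ι m r := by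
  set T : (Fin (m + 1) → ℝ) → E := fun a => ∑ i, a i • w i with hT
  have hTc : Continuous T := by fun_prop
  have hι : ∀ x ∈ l1Sphere m, ι (T x) ≠ 0 := by
    intro x hx h0
    have : ∑ i, x i • ι (w i) = 0 := by simpa [hT] using h0
    have hz := Fintype.linearIndependent_iff.mp hw x this
    simp [l1Sphere, hz] at hx
  have hT0 : ∀ x ∈ l1Sphere m, ‖T x‖ ≠ 0 := fun x hx h0 => hι x hx (by
    rw [norm_eq_zero.mp h0, map_zero])
  have hgc : ContinuousOn (fun x => ‖T x‖⁻¹ • T x) (l1Sphere m) :=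
    (hTc.norm.continuousOn.inv₀ hT0).smul hTc.continuousOn
  have hSne : (l1Sphere m).Nonempty := by
    refine ⟨fun _ => 1 / ((m : ℝ) + 1), ?_⟩
    have : (0 : ℝ) < m + 1 := by positivity
    simp [l1Sphere, abs_of_pos this]
    field_simp
  obtain ⟨x₀, hx₀, hmin⟩ := (isCompact_l1Sphere m).exists_isMinOn hSne
    (ι.continuous.comp_continuousOn hgc).norm
  refine ⟨‖ι (‖T x₀‖⁻¹ • T x₀)‖, ?_, fun x => ‖T x‖⁻¹ • T x, hgc, ?_, ?_, fun x hx => hmin hx⟩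
  · rw [gt_iff_lt, norm_pos_iff, map_smul]
    exact smul_ne_zero (inv_ne_zero (hT0 x₀ hx₀)) (hι x₀ hx₀)
  · intro x _
    have : T (-x) = -T x := by simp [hT]
    simp only [this, norm_neg, smul_neg]
  · intro x hx
    rw [norm_smul, norm_inv, norm_norm, inv_mul_cancel₀ (hT0 x hx)]

/-- A system of norming functionals of `Y`, depending continuously on the vector. -/
structure IsDualityMap (D : Y → Y →L[ℝ] ℝ) : Prop where
  norm_le (y : Y) : ‖D y‖ ≤ 1
  apply_self (y : Y) : D y y = ‖y‖
  neg (y : Y) : D (-y) = -D y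
  continuousAt {y : Y} (hy : y ≠ 0) : ContinuousAt D y

variable {D : Y → Y →L[ℝ] ℝ} {ι : E →L[ℝ] Y}

/-- First half of the monotonicity of the power step: testing the functional (D (ι u))∘ι on u itself
already gives ‖ι u‖. The second half is `norm_comp_le`. -/
theorem le_norm_comp (hD : IsDualityMap D) {u : E} (hu : ‖u‖ ≤ 1) :
    ‖ι u‖ ≤ ‖(D (ι u)).comp ι‖ := by
  have h := ((D (ι u)).comp ι).le_opNorm u
  rw [ContinuousLinearMap.comp_apply, hD.apply_self, norm_norm] at h
  exact h.trans (mul_le_of_le_one_right (norm_nonneg _) hu)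

/-- Forces the minimax levels towards 0: with an ε-net of ι(ball) of m elements, Borsuk–Ulam finds
on any admissible m-sphere a point annihilated by the norming functionals of all net elements. -/
theorem exists_level_le (hD : IsDualityMap D)
    (hι : ∀ u : ℕ → E, (∀ k, ‖u k‖ ≤ 1) → ∃ y, ∃ φ : ℕ → ℕ, StrictMono φ ∧
      Tendsto (fun k => ι (u (φ k))) atTop (𝓝 y)) {ε : ℝ} (hε : 0 < ε) :
    ∃ m, ∀ r, IsLevel ι m r → r ≤ 2 * ε := by
  -- Otherwise there would be a sequence in the unit ball whose images are at mutual distance at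
  -- least ε, against compactness of ι.
  obtain ⟨s, hs⟩ : ∃ s : Finset E, ∀ u : E, ‖u‖ ≤ 1 → ∃ v ∈ s, ‖ι u - ι v‖ < ε := by
    by_contra! h
    obtain ⟨f, hf1, hf2⟩ := exists_seq_of_forall_finset_exists (fun u : E => ‖u‖ ≤ 1)
      (fun u v => ε ≤ ‖ι v - ι u‖) (fun s _ => h s)
    obtain ⟨y, φ, hφ, hy⟩ := hι f hf1
    obtain ⟨K, hK⟩ := Metric.cauchySeq_iff'.mp hy.cauchySeq ε hε
    have h1 := hK (K + 1) (by omega)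
    rw [dist_eq_norm] at h1
    exact absurd h1 (not_lt.mpr (hf2 _ _ (hφ (Nat.lt_succ_self K))))
  refine ⟨s.card, fun r ⟨g, hgc, hgo, hgn, hgr⟩ => ?_⟩
  set e := s.equivFin.symm
  obtain ⟨x, hx, h0⟩ := exists_zero_of_odd s.card (fun x i => D (ι (e i)) (ι (g x)))
    (by
      refine continuousOn_pi.mpr fun i => ?_
      exact (D (ι (e i))).continuous.comp_continuousOn (ι.continuous.comp_continuousOn hgc))
    (fun x hx => by ext i; simp [hgo x hx])
  obtain ⟨v, hv, hvx⟩ := hs (g x) (hgn x hx)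
  have h1 : D (ι v) (ι (g x)) = 0 := by
    simpa [e] using congrFun h0 (s.equivFin ⟨v, hv⟩)
  -- The net element v nearest to ι (g x) is itself small, since its norming functional vanishes at
  -- ι (g x).
  have h2 : ‖ι v‖ ≤ ε := by
    have h3 : ‖ι v‖ = D (ι v) (ι v - ι (g x)) := by rw [map_sub, h1, hD.apply_self, sub_zero]
    rw [h3]
    refine (le_abs_self _).trans (((D (ι v)).le_opNorm _).trans ?_)
    rw [norm_sub_rev] at hvx
    exact (mul_le_of_le_one_left (norm_nonneg _) (hD.norm_le _)).trans hvx.le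
  have h4 : ‖ι (g x)‖ ≤ ‖ι (g x) - ι v‖ + ‖ι v‖ := by
    simpa using norm_add_le (ι (g x) - ι v) (ι v)
  linarith [hgr x hx]

/-- Two points at distance at least ε in the unit ball have a sum of norm at most 2 - κ, so ℓ cannot
exceed ‖ℓ‖(1 - κ/2) at both of them; hence η = κ‖ℓ‖/2. -/
theorem norm_sub_lt_of_almost_norming [UniformConvexSpace E] {ℓ : E →L[ℝ] ℝ} (hℓ : ℓ ≠ 0)
    {ε : ℝ} (hε : 0 < ε) : ∃ η > 0, ∀ u v : E, ‖u‖ ≤ 1 → ‖v‖ ≤ 1 → ‖ℓ‖ - η < ℓ u →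
      ‖ℓ‖ - η < ℓ v → ‖u - v‖ < ε := by
  obtain ⟨κ, hκ, h⟩ := exists_forall_closed_ball_dist_add_le_two_sub E hε
  have hn : 0 < ‖ℓ‖ := norm_pos_iff.mpr hℓ
  refine ⟨κ * ‖ℓ‖ / 2, by positivity, fun u v hu hv h1 h2 => ?_⟩
  by_contra! hle
  have h3 := h hu hv hle
  have h4 : ℓ (u + v) ≤ ‖ℓ‖ * (2 - κ) :=
    (le_abs_self _).trans ((ℓ.le_opNorm _).trans (mul_le_mul_of_nonneg_left h3 hn.le))
  rw [map_add] at h4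
  nlinarith

theorem exists_seq_tendsto_norm (ℓ : E →L[ℝ] ℝ) :
    ∃ u : ℕ → E, (∀ k, ‖u k‖ ≤ 1) ∧ Tendsto (fun k => ℓ (u k)) atTop (𝓝 ‖ℓ‖) := by
  have key : ∀ k : ℕ, ∃ u : E, ‖u‖ ≤ 1 ∧ ‖ℓ‖ - 1 / ((k : ℝ) + 1) ≤ ℓ u := by
    intro k
    by_contra! h
    have hpos : (0 : ℝ) < 1 / ((k : ℝ) + 1) := by positivity
    have h0 : 0 ≤ ‖ℓ‖ - 1 / ((k : ℝ) + 1) := by simpa using (h 0 (by simp)).le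
    have : ‖ℓ‖ ≤ ‖ℓ‖ - 1 / ((k : ℝ) + 1) := by
      refine ContinuousLinearMap.opNorm_le_of_unit_norm (𝕜 := ℝ) h0 fun x hx => ?_
      rw [Real.norm_eq_abs, abs_le]
      have h1 := h x hx.le
      have h2 := h (-x) (by simp [hx])
      rw [map_neg] at h2
      constructor <;> linarith
    linarith
  choose u hu1 hu2 using key
  refine ⟨u, hu1, ?_⟩
  refine tendsto_of_tendsto_of_tendsto_of_le_of_le
    (g := fun k : ℕ => ‖ℓ‖ - 1 / ((k : ℝ) + 1)) (h := fun _ => ‖ℓ‖) ?_ tendsto_const_nhds hu2 ?_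
  · simpa using tendsto_const_nhds.sub (tendsto_one_div_add_atTop_nhds_zero_nat (𝕜 := ℝ))
  · intro k
    exact (le_abs_self _).trans ((ℓ.le_opNorm _).trans
      (mul_le_of_le_one_right (norm_nonneg _) (hu1 k)))

theorem cauchySeq_of_norming [UniformConvexSpace E] {ℓ : E →L[ℝ] ℝ} (hℓ : ℓ ≠ 0)
    {u : ℕ → E} (hu : ∀ k, ‖u k‖ ≤ 1) (h : Tendsto (fun k => ℓ (u k)) atTop (𝓝 ‖ℓ‖)) :
    CauchySeq u := by
  rw [Metric.cauchySeq_iff]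
  intro ε hε
  obtain ⟨η, hη, hη'⟩ := norm_sub_lt_of_almost_norming hℓ hε
  obtain ⟨K, hK⟩ := eventually_atTop.mp (h.eventually (lt_mem_nhds (sub_lt_self ‖ℓ‖ hη)))
  exact ⟨K, fun m hm n hn => by
    rw [dist_eq_norm]; exact hη' _ _ (hu m) (hu n) (hK m hm) (hK n hn)⟩

theorem exists_norming [CompleteSpace E] [UniformConvexSpace E] (ℓ : E →L[ℝ] ℝ) :
    ∃ v : E, ‖v‖ ≤ 1 ∧ ℓ v = ‖ℓ‖ := by
  by_cases hℓ : ℓ = 0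
  · exact ⟨0, by simp, by simp [hℓ]⟩
  obtain ⟨u, hu, h⟩ := exists_seq_tendsto_norm ℓ
  obtain ⟨v, hv⟩ := cauchySeq_tendsto_of_complete (cauchySeq_of_norming hℓ hu h)
  exact ⟨v, le_of_tendsto hv.norm (Eventually.of_forall hu),
    tendsto_nhds_unique ((ℓ.continuous.tendsto v).comp hv) h⟩

/-- A point of the unit ball at which the functional `ℓ` attains its norm. -/
def dualMax [CompleteSpace E] [UniformConvexSpace E] (ℓ : E →L[ℝ] ℝ) : E :=
  (exists_norming ℓ).choose

variable [CompleteSpace E] [UniformConvexSpace E]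

theorem norm_dualMax_le (ℓ : E →L[ℝ] ℝ) : ‖dualMax ℓ‖ ≤ 1 := (exists_norming ℓ).choose_spec.1

theorem apply_dualMax (ℓ : E →L[ℝ] ℝ) : ℓ (dualMax ℓ) = ‖ℓ‖ := (exists_norming ℓ).choose_spec.2

theorem eq_dualMax {ℓ : E →L[ℝ] ℝ} (hℓ : ℓ ≠ 0) {v : E} (hv : ‖v‖ ≤ 1) (h : ℓ v = ‖ℓ‖) :
    v = dualMax ℓ := by
  by_contra hne
  obtain ⟨η, hη, hη'⟩ := norm_sub_lt_of_almost_norming hℓ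
    (norm_pos_iff.mpr (sub_ne_zero.mpr hne))
  exact lt_irrefl _ (hη' v (dualMax ℓ) hv (norm_dualMax_le ℓ) (by linarith)
    (by linarith [apply_dualMax ℓ]))

theorem dualMax_neg {ℓ : E →L[ℝ] ℝ} (hℓ : ℓ ≠ 0) : dualMax (-ℓ) = -dualMax ℓ :=
  (eq_dualMax (neg_ne_zero.mpr hℓ) (by simpa using norm_dualMax_le ℓ)
    (by simpa using apply_dualMax ℓ)).symm

/-- The maximizer of a nearby functional almost norms ℓ, so uniform convexity puts it close to the
maximizer of ℓ. -/
theorem continuousAt_dualMax {ℓ : E →L[ℝ] ℝ} (hℓ : ℓ ≠ 0) : ContinuousAt dualMax ℓ := by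
  rw [Metric.continuousAt_iff]
  intro ε hε
  obtain ⟨η, hη, hη'⟩ := norm_sub_lt_of_almost_norming hℓ hε
  -- The distance ‖ℓ' - ℓ‖ is lost twice: once in the value at the maximizer, once in the norm.
  refine ⟨η / 2, by positivity, fun {ℓ'} h => ?_⟩
  rw [dist_eq_norm] at h ⊢
  refine hη' _ _ (norm_dualMax_le _) (norm_dualMax_le _) ?_ (by linarith [apply_dualMax ℓ])
  have h1 : |(ℓ' - ℓ) (dualMax ℓ')| ≤ ‖ℓ' - ℓ‖ :=
    ((ℓ' - ℓ).le_opNorm _).trans (mul_le_of_le_one_right (norm_nonneg _) (norm_dualMax_le _))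
  have h2 := abs_le.mp (abs_norm_sub_norm_le ℓ' ℓ)
  rw [sub_apply, apply_dualMax] at h1
  have h3 := abs_le.mp h1
  linarith

/-- Second half of the monotonicity: D y has norm at most 1, so the maximum of (D y)∘ι is at most
the norm of ι at the maximizer. -/
theorem norm_comp_le (hD : IsDualityMap D) (y : Y) :
    ‖(D y).comp ι‖ ≤ ‖ι (dualMax ((D y).comp ι))‖ := by
  rw [← apply_dualMax, ContinuousLinearMap.comp_apply]
  exact (le_abs_self _).trans (((D y).le_opNorm _).trans
    (mul_le_of_le_one_left (norm_nonneg _) (hD.norm_le _)))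

/-- The critical values of `‖ι ·‖` on the unit sphere of `E`. -/
def criticalValues (D : Y → Y →L[ℝ] ℝ) (ι : E →L[ℝ] Y) : Set ℝ :=
  {r | 0 < r ∧ ∃ u : E, ‖u‖ = 1 ∧ ‖ι u‖ = r ∧ ∀ v, D (ι u) (ι v) ≤ r * ‖v‖}

/-- The supremum cannot be improved by the power step, so along nearly optimal spheres there are
points where the chain ‖ι u‖ ≤ ‖(D (ι u))∘ι‖ ≤ ‖ι (next point)‖ is almost an equality at height c.
Their limit is critical. -/
theorem exists_criticalValue (hD : IsDualityMap D)
    (hι : ∀ u : ℕ → E, (∀ k, ‖u k‖ ≤ 1) → ∃ y, ∃ φ : ℕ → ℕ, StrictMono φ ∧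
      Tendsto (fun k => ι (u (φ k))) atTop (𝓝 y)) {m : ℕ}
    (hm : ∃ r > 0, IsLevel ι m r) : sSup {r | IsLevel ι m r} ∈ criticalValues D ι := by
  obtain ⟨r₀, hr₀, hl₀⟩ := hm
  set c := sSup {r | IsLevel ι m r} with hc
  have hSne : (l1Sphere m).Nonempty := by
    obtain ⟨x, hx, -⟩ := exists_zero_of_odd m 0 continuousOn_const (by simp)
    exact ⟨x, hx⟩
  have hbdd : BddAbove {r | IsLevel ι m r} := by
    refine ⟨‖ι‖, ?_⟩
    rintro r ⟨g, -, -, hgn, hgr⟩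
    obtain ⟨x, hx⟩ := hSne
    exact (hgr x hx).trans ((ι.le_opNorm _).trans
      (mul_le_of_le_one_right (norm_nonneg _) (hgn x hx)))
  have hcpos : 0 < c := hr₀.trans_le (le_csSup hbdd hl₀)
  have key : ∀ k : ℕ, ∃ u : E, ‖u‖ ≤ 1 ∧ c - 1 / ((k : ℝ) + 1) ≤ ‖ι u‖ ∧
      ‖ι u‖ ≤ ‖(D (ι u)).comp ι‖ ∧ ‖(D (ι u)).comp ι‖ ≤ c + 1 / ((k : ℝ) + 1) := by
    intro k
    have hk : (0 : ℝ) < 1 / ((k : ℝ) + 1) := by positivity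
    -- The maximum with 0 keeps r positive, so that ι ∘ g has no zeros on the sphere and the duality
    -- map is continuous along it.
    obtain ⟨r, hr, hrc⟩ := exists_lt_of_lt_csSup (⟨r₀, hl₀⟩ : {r | IsLevel ι m r}.Nonempty)
      (show max 0 (c - 1 / ((k : ℝ) + 1)) < c by
        rw [max_lt_iff]; exact ⟨hcpos, by linarith⟩)
    obtain ⟨g, hgc, hgo, hgn, hgr⟩ := hr
    have hrpos : 0 < r := (le_max_left _ _).trans_lt hrc
    have hgne : ∀ x ∈ l1Sphere m, ι (g x) ≠ 0 := fun x hx =>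
      norm_pos_iff.mp (hrpos.trans_le (hgr x hx))
    have hℓne : ∀ x ∈ l1Sphere m, (D (ι (g x))).comp ι ≠ 0 := fun x hx =>
      norm_pos_iff.mp (hrpos.trans_le ((hgr x hx).trans (le_norm_comp hD (hgn x hx))))
    have hnot : ¬ IsLevel ι m (c + 1 / ((k : ℝ) + 1)) := fun h => by
      have := le_csSup hbdd h
      linarith
    -- The power step applied to g gives another admissible odd map, which cannot realize a level
    -- above the supremum.
    have hx : ∃ x ∈ l1Sphere m, ‖ι (dualMax ((D (ι (g x))).comp ι))‖ < c + 1 / ((k : ℝ) + 1) := by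
      by_contra! h
      refine hnot ⟨fun x => dualMax ((D (ι (g x))).comp ι), ?_, ?_,
        fun x _ => norm_dualMax_le _, h⟩
      · intro x hx
        have h1 : ContinuousWithinAt (fun x => D (ι (g x))) (l1Sphere m) x :=
          (hD.continuousAt (hgne x hx)).comp_continuousWithinAt (f := fun x => ι (g x))
            (ι.continuous.comp_continuousOn hgc x hx)
        have h2 : ContinuousWithinAt (fun x => (D (ι (g x))).comp ι) (l1Sphere m) x :=
          ((ContinuousLinearMap.compL ℝ E Y ℝ).flip ι).continuous.continuousAt.comp_continuousWithinAt
            h1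
        exact (continuousAt_dualMax (hℓne x hx)).comp_continuousWithinAt
          (f := fun x => (D (ι (g x))).comp ι) h2
      · intro x hx
        beta_reduce
        rw [hgo x hx, map_neg, hD.neg, ContinuousLinearMap.neg_comp, dualMax_neg (hℓne x hx)]
    obtain ⟨x, hx, hxlt⟩ := hx
    refine ⟨g x, hgn x hx, ((le_max_right _ _).trans hrc.le).trans (hgr x hx),
      le_norm_comp hD (hgn x hx), (norm_comp_le hD _).trans hxlt.le⟩
  choose u hu1 hu2 hu3 hu4 using key
  obtain ⟨y, φ, hφ, hy⟩ := hι u hu1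
  have hz := (tendsto_one_div_add_atTop_nhds_zero_nat (𝕜 := ℝ)).comp hφ.tendsto_atTop
  have hlo : Tendsto (fun k => c - 1 / ((φ k : ℝ) + 1)) atTop (𝓝 c) := by
    simpa using tendsto_const_nhds.sub hz
  have hhi : Tendsto (fun k => c + 1 / ((φ k : ℝ) + 1)) atTop (𝓝 c) := by
    simpa using tendsto_const_nhds.add hz
  have hyc : ‖y‖ = c := tendsto_nhds_unique hy.norm
    (tendsto_of_tendsto_of_tendsto_of_le_of_le hlo hhi (fun k => hu2 _)
      (fun k => (hu3 _).trans (hu4 _)))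
  have hyne : y ≠ 0 := norm_pos_iff.mp (hyc ▸ hcpos)
  set ℓ := (D y).comp ι with hℓ
  have hℓlim : Tendsto (fun k => (D (ι (u (φ k)))).comp ι) atTop (𝓝 ℓ) :=
    (((ContinuousLinearMap.compL ℝ E Y ℝ).flip ι).continuous.tendsto (D y)).comp
      ((hD.continuousAt hyne).tendsto.comp hy)
  have hℓc : ‖ℓ‖ = c := tendsto_nhds_unique hℓlim.norm
    (tendsto_of_tendsto_of_tendsto_of_le_of_le hlo hhi (fun k => (hu2 _).trans (hu3 _))
      (fun k => hu4 _))
  have hℓne : ℓ ≠ 0 := norm_pos_iff.mp (hℓc ▸ hcpos)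
  -- Since ℓ(u_k) = D y (ι u_k) tends to D y y = ‖y‖ = c = ‖ℓ‖, the u_k form a maximizing sequence
  -- for ℓ and are Cauchy by uniform convexity.
  have hmax : Tendsto (fun k => ℓ (u (φ k))) atTop (𝓝 ‖ℓ‖) := by
    rw [hℓc, ← hyc, ← hD.apply_self y]
    exact ((D y).continuous.tendsto y).comp hy
  obtain ⟨v, hv⟩ := cauchySeq_tendsto_of_complete
    (cauchySeq_of_norming hℓne (fun k => hu1 (φ k)) hmax)
  have hιv : ι v = y := tendsto_nhds_unique ((ι.continuous.tendsto v).comp hv) hy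
  have hv1 : ‖v‖ ≤ 1 := le_of_tendsto hv.norm (Eventually.of_forall fun k => hu1 _)
  have hle : ∀ w, D (ι v) (ι w) ≤ c * ‖w‖ := by
    intro w
    rw [hιv, ← hℓc]
    exact (le_abs_self _).trans (ℓ.le_opNorm w)
  refine ⟨hcpos, v, le_antisymm hv1 ?_, by rw [hιv, hyc], hle⟩
  -- Testing with v gives c ≤ c‖v‖, so v lies on the unit sphere.
  have := hle v
  rw [hD.apply_self, hιv, hyc] at this
  nlinarith

/-- An even functional of this type has infinitely many critical values. -/
theorem infinite_criticalValues (hD : IsDualityMap D)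
    (hι : ∀ u : ℕ → E, (∀ k, ‖u k‖ ≤ 1) → ∃ y, ∃ φ : ℕ → ℕ, StrictMono φ ∧
      Tendsto (fun k => ι (u (φ k))) atTop (𝓝 y))
    (hinf : ∀ m : ℕ, ∃ w : Fin (m + 1) → E, LinearIndependent ℝ fun i => ι (w i)) :
    (criticalValues D ι).Infinite := by
  intro hfin
  have hmem : ∀ m, sSup {r | IsLevel ι m r} ∈ criticalValues D ι := fun m =>
    exists_criticalValue hD hι (exists_pos_level (hinf m).choose_spec)
  -- A finite set of critical values would have a positive minimum r₀, but some level is at most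
  -- r₀/2.
  obtain ⟨r₀, hr₀, hmin⟩ := hfin.exists_minimal ⟨_, hmem 0⟩
  obtain ⟨m, hm⟩ := exists_level_le hD hι (ε := r₀ / 4) (by linarith [hr₀.1])
  have h1 : sSup {r | IsLevel ι m r} ≤ 2 * (r₀ / 4) := by
    obtain ⟨r, -, hr⟩ := exists_pos_level (hinf m).choose_spec
    exact csSup_le ⟨r, hr⟩ hm
  have h2 := hmin (hmem m) (by linarith [hr₀.1])
  linarith [hr₀.1]

end PowerMethod

end

/-! ### Duality map and uniform convexity of L^r for r > 2. -/

noncomputable section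

namespace LpDuality

open Filter Topology

open scoped ENNReal

variable {α : Type*} [MeasurableSpace α] {μ : Measure α}

theorem eLpNorm_ofReal_eq {ε : Type*} [ENorm ε] {r : ℝ} (hr : 0 < r) (f : α → ε) :
    eLpNorm f (ENNReal.ofReal r) μ = (∫⁻ x, ‖f x‖ₑ ^ r ∂μ) ^ (1 / r) := by
  rw [eLpNorm_eq_lintegral_rpow_enorm_toReal (by simpa using hr) ENNReal.ofReal_ne_top,
    ENNReal.toReal_ofReal hr.le]

theorem eLpNorm_ofReal_rpow {ε : Type*} [ENorm ε] {r : ℝ} (hr : 0 < r) (f : α → ε) :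
    eLpNorm f (ENNReal.ofReal r) μ ^ r = ∫⁻ x, ‖f x‖ₑ ^ r ∂μ := by
  rw [eLpNorm_ofReal_eq hr, ← ENNReal.rpow_mul, one_div_mul_cancel hr.ne', ENNReal.rpow_one]

variable {A B C : Type*} [NormedAddCommGroup A] [NormedAddCommGroup B] [NormedAddCommGroup C]

/-- Hölder with exponents r, r/(r-2), r; it yields both the boundedness of the pairing and its
continuity in the nonlinear argument. -/
theorem lintegral_holder_three {r : ℝ} (hr : 2 < r) {f : α → A} {g : α → B} {h : α → C}
    (hf : AEStronglyMeasurable f μ) (hg : AEStronglyMeasurable g μ)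
    (hh : AEStronglyMeasurable h μ) :
    ∫⁻ x, ‖f x‖ₑ * ‖g x‖ₑ ^ (r - 2) * ‖h x‖ₑ ∂μ ≤
      eLpNorm f (ENNReal.ofReal r) μ * eLpNorm g (ENNReal.ofReal r) μ ^ (r - 2) *
        eLpNorm h (ENNReal.ofReal r) μ := by
  have hr0 : 0 < r := by linarith
  have key := ENNReal.lintegral_prod_norm_pow_le (μ := μ) (Finset.univ : Finset (Fin 3))
    (f := ![fun x => ‖f x‖ₑ ^ r, fun x => ‖g x‖ₑ ^ r, fun x => ‖h x‖ₑ ^ r])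
    (p := ![1 / r, (r - 2) / r, 1 / r])
    (by
      intro i _
      fin_cases i
      · exact hf.enorm.pow_const _
      · exact hg.enorm.pow_const _
      · exact hh.enorm.pow_const _)
    (by simp [Fin.sum_univ_three]; field_simp; ring)
    (by
      intro i _
      fin_cases i
      · simp [hr0.le]
      · simp; exact div_nonneg (by linarith) hr0.le
      · simp [hr0.le])
  have h1 : r * ((r - 2) / r) = r - 2 := by field_simp
  simp only [Fin.prod_univ_three, Matrix.cons_val_zero, Matrix.cons_val_one, Matrix.cons_val,
    ← ENNReal.rpow_mul, mul_one_div_cancel hr0.ne', ENNReal.rpow_one, h1] at key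
  rw [eLpNorm_ofReal_eq hr0, eLpNorm_ofReal_eq hr0, eLpNorm_ofReal_eq hr0, ← ENNReal.rpow_mul,
    one_div_mul_eq_div]
  exact key

variable {H : Type*} [NormedAddCommGroup H] [InnerProductSpace ℝ H]

/-- Bernoulli's inequality for the ratio y/x. -/
theorem rpow_succ_sub_le {s x y : ℝ} (hs : 0 ≤ s) (hy : 0 ≤ y) (hyx : y ≤ x) :
    x ^ (s + 1) - y ^ (s + 1) ≤ (s + 1) * x ^ s * (x - y) := by
  rcases (hy.trans hyx).eq_or_lt with rfl | hx
  · have : y = 0 := le_antisymm hyx hy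
    simp [this]
  have h := one_add_mul_self_le_rpow_one_add (s := (y - x) / x) (p := s + 1)
    (by rw [le_div_iff₀ hx]; linarith) (by linarith)
  have h1 : 1 + (y - x) / x = y / x := by field_simp; ring
  rw [h1, Real.div_rpow hy hx.le, le_div_iff₀ (by positivity)] at h
  have h2 : x ^ (s + 1) = x ^ s * x := Real.rpow_add_one hx.ne' s
  rw [h2] at h ⊢
  have h3 : (1 + (s + 1) * ((y - x) / x)) * (x ^ s * x) =
      x ^ s * x + (s + 1) * x ^ s * (y - x) := by field_simp
  linarith

theorem norm_rpow_smul_sub_le_of_le {s : ℝ} (hs : 0 ≤ s) (a b : H) (hab : ‖b‖ ≤ ‖a‖) :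
    ‖‖a‖ ^ s • a - ‖b‖ ^ s • b‖ ≤ (s + 2) * ‖a - b‖ * ‖a‖ ^ s := by
  have e : ‖a‖ ^ s • a - ‖b‖ ^ s • b = ‖a‖ ^ s • (a - b) + (‖a‖ ^ s - ‖b‖ ^ s) • b := by module
  have hA : 0 ≤ ‖a‖ ^ s := by positivity
  have hBA : ‖b‖ ^ s ≤ ‖a‖ ^ s := Real.rpow_le_rpow (norm_nonneg _) hab hs
  rw [e]
  refine (norm_add_le _ _).trans ?_
  rw [norm_smul, norm_smul, Real.norm_of_nonneg hA, Real.norm_of_nonneg (sub_nonneg.mpr hBA)]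
  have h1 := rpow_succ_sub_le hs (norm_nonneg b) hab
  have h2 : ‖a‖ - ‖b‖ ≤ ‖a - b‖ := norm_sub_norm_le a b
  have h3 : (‖a‖ ^ s - ‖b‖ ^ s) * ‖b‖ ≤ ‖a‖ ^ (s + 1) - ‖b‖ ^ (s + 1) := by
    rw [Real.rpow_add_one' (norm_nonneg _) (by linarith),
      Real.rpow_add_one' (norm_nonneg _) (by linarith)]
    nlinarith
  have h4 : (s + 1) * ‖a‖ ^ s * (‖a‖ - ‖b‖) ≤ (s + 1) * ‖a‖ ^ s * ‖a - b‖ := by gcongr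
  nlinarith

/-- A local Lipschitz bound for a ↦ ‖a‖^s a; with s = r - 2 it gives continuity of the duality map
in operator norm. -/
theorem norm_rpow_smul_sub_le {s : ℝ} (hs : 0 ≤ s) (a b : H) :
    ‖‖a‖ ^ s • a - ‖b‖ ^ s • b‖ ≤ (s + 2) * ‖a - b‖ * (‖a‖ + ‖b‖) ^ s := by
  rcases le_total ‖b‖ ‖a‖ with h | h
  · refine (norm_rpow_smul_sub_le_of_le hs a b h).trans ?_
    gcongr
    linarith [norm_nonneg b]
  · rw [norm_sub_rev, norm_sub_rev a]
    refine (norm_rpow_smul_sub_le_of_le hs b a h).trans ?_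
    gcongr
    linarith [norm_nonneg a]

variable {r : ℝ}

theorem lintegral_inner_le (hr : 2 < r) {f g : α → H} (hf : AEStronglyMeasurable f μ)
    (hg : AEStronglyMeasurable g μ) :
    ∫⁻ x, ‖inner ℝ (‖f x‖ ^ (r - 2) • f x) (g x)‖ₑ ∂μ ≤
      eLpNorm f (ENNReal.ofReal r) μ * eLpNorm f (ENNReal.ofReal r) μ ^ (r - 2) *
        eLpNorm g (ENNReal.ofReal r) μ := by
  refine (lintegral_mono fun x => ?_).trans (lintegral_holder_three hr hf hf hg)
  have h : ‖inner ℝ (‖f x‖ ^ (r - 2) • f x) (g x)‖ ≤ ‖f x‖ * ‖f x‖ ^ (r - 2) * ‖g x‖ := by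
    refine (norm_inner_le_norm _ _).trans ?_
    rw [norm_smul, Real.norm_of_nonneg (by positivity), mul_comm (‖f x‖ ^ (r - 2))]
  rw [← ofReal_norm, ← ofReal_norm (f x), ← ofReal_norm (g x),
    ENNReal.ofReal_rpow_of_nonneg (norm_nonneg _) (by linarith), ← ENNReal.ofReal_mul (by positivity),
    ← ENNReal.ofReal_mul (by positivity)]
  exact ENNReal.ofReal_le_ofReal h

theorem aestronglyMeasurable_rpow_smul {f : α → H} (hf : AEStronglyMeasurable f μ) (s : ℝ) :
    AEStronglyMeasurable (fun x => ‖f x‖ ^ s • f x) μ :=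
  ((hf.norm.aemeasurable.pow_const s).aestronglyMeasurable).smul hf

theorem integrable_inner (hr : 2 < r) {f g : α → H} (hf : MemLp f (ENNReal.ofReal r) μ)
    (hg : MemLp g (ENNReal.ofReal r) μ) :
    Integrable (fun x => inner ℝ (‖f x‖ ^ (r - 2) • f x) (g x)) μ := by
  refine ⟨(aestronglyMeasurable_rpow_smul hf.1 _).inner hg.1, ?_⟩
  refine (lintegral_inner_le hr hf.1 hg.1).trans_lt ?_
  exact ENNReal.mul_lt_top (ENNReal.mul_lt_top hf.2
    (ENNReal.rpow_lt_top_of_nonneg (by linarith) hf.2.ne)) hg.2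

/-- The parallelogram law for squares, combined with superadditivity and then convexity of t ↦
t^{r/2}; the constants multiply to 2^{r/2} · 2^{r/2-1} = 2^{r-1}. -/
theorem clarkson_pointwise (hr : 2 ≤ r) (a b : H) :
    ‖a + b‖ₑ ^ r + ‖a - b‖ₑ ^ r ≤ 2 ^ (r - 1) * (‖a‖ₑ ^ r + ‖b‖ₑ ^ r) := by
  have hk : 1 ≤ r / 2 := by linarith
  have hsq : ∀ c : H, ‖c‖ₑ ^ r = (‖c‖ₑ ^ (2 : ℝ)) ^ (r / 2) := fun c => by
    rw [← ENNReal.rpow_mul]; congr 1; ring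
  have hpar : ‖a + b‖ₑ ^ (2 : ℝ) + ‖a - b‖ₑ ^ (2 : ℝ) = 2 * (‖a‖ₑ ^ (2 : ℝ) + ‖b‖ₑ ^ (2 : ℝ)) := by
    have h := parallelogram_law_with_norm ℝ a b
    simp only [← ofReal_norm, ENNReal.ofReal_rpow_of_nonneg (norm_nonneg _) zero_le_two,
      Real.rpow_two]
    rw [← ENNReal.ofReal_add (by positivity) (by positivity),
      ← ENNReal.ofReal_add (by positivity) (by positivity), ← ENNReal.ofReal_ofNat,
      ← ENNReal.ofReal_mul (by norm_num)]
    congr 1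
  rw [hsq, hsq, hsq, hsq]
  refine (ENNReal.add_rpow_le_rpow_add _ _ hk).trans ?_
  rw [hpar, ENNReal.mul_rpow_of_nonneg _ _ (by linarith)]
  refine (mul_le_mul_right (ENNReal.rpow_add_le_mul_rpow_add_rpow _ _ hk) _).trans ?_
  rw [← mul_assoc, ← ENNReal.rpow_add _ _ (by norm_num) (by norm_num)]
  apply le_of_eq
  congr 2
  ring

variable [Fact (1 ≤ ENNReal.ofReal r)]

/-- The pairing of `‖f‖^(r-2) f` with `g`. -/
def pairing (r : ℝ) (f g : α → H) (μ : Measure α) : ℝ :=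
  ∫ x, inner ℝ (‖f x‖ ^ (r - 2) • f x) (g x) ∂μ

theorem abs_pairing_le (hr : 2 < r) (f g : Lp H (ENNReal.ofReal r) μ) :
    |pairing r f g μ| ≤ ‖f‖ ^ (r - 1) * ‖g‖ := by
  have h1 := enorm_integral_le_lintegral_enorm (μ := μ)
    (fun x => inner ℝ (‖f x‖ ^ (r - 2) • f x) (g x))
  have h2 := h1.trans (lintegral_inner_le hr (Lp.aestronglyMeasurable f) (Lp.aestronglyMeasurable g))
  rw [← Lp.enorm_def, ← Lp.enorm_def, ← ofReal_norm, ← ofReal_norm f, ← ofReal_norm g,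
    ENNReal.ofReal_rpow_of_nonneg (norm_nonneg _) (by linarith), ← ENNReal.ofReal_mul (by positivity),
    ← ENNReal.ofReal_mul (by positivity), ENNReal.ofReal_le_ofReal_iff (by positivity)] at h2
  refine h2.trans (le_of_eq ?_)
  congr 1
  have : r - 1 = (r - 2) + 1 := by ring
  rw [this, Real.rpow_add_one' (norm_nonneg _) (by linarith), mul_comm]

theorem abs_pairing_sub_le (hr : 2 < r) (f f' g : Lp H (ENNReal.ofReal r) μ) :
    |pairing r f g μ - pairing r f' g μ| ≤ r * ‖f - f'‖ * (‖f‖ + ‖f'‖) ^ (r - 2) * ‖g‖ := by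
  have hf := Lp.memLp f
  have hf' := Lp.memLp f'
  have hg := Lp.memLp g
  rw [pairing, pairing, ← integral_sub (integrable_inner hr hf hg) (integrable_inner hr hf' hg)]
  have h1 := enorm_integral_le_lintegral_enorm (μ := μ)
    (fun x => inner ℝ (‖f x‖ ^ (r - 2) • f x) (g x) - inner ℝ (‖f' x‖ ^ (r - 2) • f' x) (g x))
  have h2 : ∫⁻ x, ‖inner ℝ (‖f x‖ ^ (r - 2) • f x) (g x) -
        inner ℝ (‖f' x‖ ^ (r - 2) • f' x) (g x)‖ₑ ∂μ ≤
      ENNReal.ofReal r * ∫⁻ x, ‖f x - f' x‖ₑ * ‖‖f x‖ + ‖f' x‖‖ₑ ^ (r - 2) * ‖g x‖ₑ ∂μ := by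
    rw [← lintegral_const_mul' _ _ ENNReal.ofReal_ne_top]
    refine lintegral_mono fun x => ?_
    rw [← inner_sub_left, ← ofReal_norm, ← ofReal_norm (f x - f' x), ← ofReal_norm (g x),
      ← ofReal_norm (‖f x‖ + ‖f' x‖), Real.norm_of_nonneg (by positivity : 0 ≤ ‖f x‖ + ‖f' x‖),
      ENNReal.ofReal_rpow_of_nonneg (by positivity) (by linarith),
      ← ENNReal.ofReal_mul (by positivity), ← ENNReal.ofReal_mul (by positivity),
      ← ENNReal.ofReal_mul (by linarith)]
    refine ENNReal.ofReal_le_ofReal ((norm_inner_le_norm _ _).trans ?_)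
    have h3 := norm_rpow_smul_sub_le (s := r - 2) (by linarith) (f x) (f' x)
    rw [sub_add_cancel] at h3
    calc _ ≤ r * ‖f x - f' x‖ * (‖f x‖ + ‖f' x‖) ^ (r - 2) * ‖g x‖ := by gcongr
      _ = _ := by ring
  have h3 := lintegral_holder_three hr (hf.1.sub hf'.1) (hf.1.norm.add hf'.1.norm) hg.1
  have e1 : eLpNorm (fun x => f x - f' x) (ENNReal.ofReal r) μ = ENNReal.ofReal ‖f - f'‖ := by
    rw [ofReal_norm, Lp.enorm_def]
    exact eLpNorm_congr_ae (Lp.coeFn_sub f f').symm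
  have e2 : eLpNorm (fun x => ‖f x‖ + ‖f' x‖) (ENNReal.ofReal r) μ ≤
      ENNReal.ofReal (‖f‖ + ‖f'‖) := by
    refine (eLpNorm_add_le hf.1.norm hf'.1.norm Fact.out).trans (le_of_eq ?_)
    rw [eLpNorm_norm, eLpNorm_norm, ENNReal.ofReal_add (norm_nonneg _) (norm_nonneg _), ofReal_norm,
      ofReal_norm, Lp.enorm_def, Lp.enorm_def]
  have h4 : ∫⁻ x, ‖f x - f' x‖ₑ * ‖‖f x‖ + ‖f' x‖‖ₑ ^ (r - 2) * ‖g x‖ₑ ∂μ ≤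
      ENNReal.ofReal ‖f - f'‖ * ENNReal.ofReal (‖f‖ + ‖f'‖) ^ (r - 2) * ENNReal.ofReal ‖g‖ := by
    refine h3.trans ?_
    have e3 : eLpNorm g (ENNReal.ofReal r) μ = ENNReal.ofReal ‖g‖ := by
      rw [ofReal_norm, Lp.enorm_def]
    gcongr ?_ * ?_ ^ _ * ?_
    · exact e1.le
    · exact e2
    · exact e3.le
  have h5 := h1.trans (h2.trans (mul_le_mul_right h4 _))
  rw [← ofReal_norm, ENNReal.ofReal_rpow_of_nonneg (by positivity) (by linarith),
    ← ENNReal.ofReal_mul (by positivity), ← ENNReal.ofReal_mul (by positivity),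
    ← ENNReal.ofReal_mul (by linarith), ENNReal.ofReal_le_ofReal_iff (by
      have : 0 ≤ r := by linarith
      positivity)] at h5
  refine h5.trans (le_of_eq (by ring))

theorem pairing_self (hr : 2 < r) (f : Lp H (ENNReal.ofReal r) μ) :
    pairing r f f μ = ‖f‖ ^ r := by
  have h0 : 0 < r := by linarith
  have h1 : ∀ x, inner ℝ (‖f x‖ ^ (r - 2) • f x) (f x) = ‖f x‖ ^ r := by
    intro x
    rw [real_inner_smul_left, real_inner_self_eq_norm_sq, ← Real.rpow_natCast,
      ← Real.rpow_add' (norm_nonneg _) (by push_cast; linarith)]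
    congr 1
    push_cast; ring
  rw [pairing, integral_congr_ae (Eventually.of_forall h1),
    integral_eq_lintegral_of_nonneg_ae (Eventually.of_forall fun x => by positivity)
      ((Lp.aestronglyMeasurable f).norm.aemeasurable.pow_const r).aestronglyMeasurable]
  have h2 : ∫⁻ x, ENNReal.ofReal (‖f x‖ ^ r) ∂μ = ∫⁻ x, ‖f x‖ₑ ^ r ∂μ := by
    refine lintegral_congr fun x => ?_
    rw [← ofReal_norm, ENNReal.ofReal_rpow_of_nonneg (norm_nonneg _) h0.le]
  rw [h2, ← eLpNorm_ofReal_rpow h0, ← Lp.enorm_def, ← ENNReal.toReal_rpow, toReal_enorm]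

/-- The functional `g ↦ ∫ ‖f‖^(r-2) ⟪f, g⟫`. -/
def pairingCLM (hr : 2 < r) (f : Lp H (ENNReal.ofReal r) μ) : Lp H (ENNReal.ofReal r) μ →L[ℝ] ℝ :=
  LinearMap.mkContinuous
    { toFun := fun g => pairing r f g μ
      map_add' := fun g g' => by
        have hf := Lp.memLp f
        rw [pairing, pairing, pairing, ← integral_add (integrable_inner hr hf (Lp.memLp g))
          (integrable_inner hr hf (Lp.memLp g'))]
        refine integral_congr_ae ?_
        filter_upwards [Lp.coeFn_add g g'] with x hx
        rw [hx, Pi.add_apply, inner_add_right]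
      map_smul' := fun c g => by
        rw [pairing, pairing, RingHom.id_apply, smul_eq_mul, ← integral_const_mul]
        refine integral_congr_ae ?_
        filter_upwards [Lp.coeFn_smul c g] with x hx
        rw [hx, Pi.smul_apply, inner_smul_right] }
    (‖f‖ ^ (r - 1)) fun g => abs_pairing_le hr f g

theorem pairingCLM_apply (hr : 2 < r) (f g : Lp H (ENNReal.ofReal r) μ) :
    pairingCLM hr f g = pairing r f g μ := rfl

theorem norm_pairingCLM_le (hr : 2 < r) (f : Lp H (ENNReal.ofReal r) μ) :
    ‖pairingCLM hr f‖ ≤ ‖f‖ ^ (r - 1) :=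
  LinearMap.mkContinuous_norm_le _ (by positivity) _

theorem continuous_pairingCLM (hr : 2 < r) :
    Continuous (pairingCLM (μ := μ) (H := H) hr) := by
  rw [continuous_iff_continuousAt]
  intro f
  refine (tendsto_iff_norm_sub_tendsto_zero (E := Lp H (ENNReal.ofReal r) μ →L[ℝ] ℝ)).mpr ?_
  have hb : ∀ f', ‖pairingCLM hr f' - pairingCLM hr f‖ ≤
      r * ‖f' - f‖ * (‖f'‖ + ‖f‖) ^ (r - 2) := by
    intro f'
    refine ContinuousLinearMap.opNorm_le_bound _ ?_ fun g => abs_pairing_sub_le hr f' f g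
    have : 0 ≤ r := by linarith
    positivity
  refine squeeze_zero (fun f' => norm_nonneg (pairingCLM hr f' - pairingCLM hr f)) hb ?_
  have hc : Continuous fun f' : Lp H (ENNReal.ofReal r) μ =>
      r * ‖f' - f‖ * (‖f'‖ + ‖f‖) ^ (r - 2) := by
    refine (continuous_const.mul (continuous_id.sub continuous_const).norm).mul ?_
    exact (continuous_norm.add continuous_const).rpow_const fun _ => Or.inr (by linarith)
  simpa using hc.tendsto f

/-- The norming functional of `f ∈ L^r`. -/
def dualityMap (hr : 2 < r) (f : Lp H (ENNReal.ofReal r) μ) : Lp H (ENNReal.ofReal r) μ →L[ℝ] ℝ :=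
  ‖f‖ ^ (1 - r) • pairingCLM hr f

theorem isDualityMap (hr : 2 < r) :
    PowerMethod.IsDualityMap (dualityMap (μ := μ) (H := H) hr) where
  norm_le f := by
    rw [dualityMap, norm_smul, Real.norm_of_nonneg (by positivity)]
    refine (mul_le_mul_of_nonneg_left (norm_pairingCLM_le hr f) (by positivity)).trans ?_
    -- At f = 0 the prefactor `0 ^ (1 - r)` is 0 by convention, so the functional is 0 there.
    rcases eq_or_ne f 0 with rfl | hf
    · rw [norm_zero, Real.zero_rpow (by linarith), zero_mul]; exact zero_le_one
    · rw [← Real.rpow_add (norm_pos_iff.mpr hf)]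
      simp
  apply_self f := by
    rw [dualityMap, smul_apply, pairingCLM_apply, pairing_self hr, smul_eq_mul]
    rcases eq_or_ne f 0 with rfl | hf
    · simp [Real.zero_rpow (by linarith : r ≠ 0)]
    · rw [← Real.rpow_add (norm_pos_iff.mpr hf)]
      simp
  neg f := by
    ext g
    simp only [dualityMap, norm_neg, smul_apply, neg_apply,
      pairingCLM_apply, smul_eq_mul]
    rw [← mul_neg]
    congr 1
    rw [pairing, pairing, ← integral_neg]
    refine integral_congr_ae ?_
    filter_upwards [Lp.coeFn_neg f] with x hx
    rw [hx, Pi.neg_apply, norm_neg, smul_neg, inner_neg_left]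
  continuousAt {f} hf := by
    have h1 : ContinuousAt (fun f : Lp H (ENNReal.ofReal r) μ => ‖f‖ ^ (1 - r)) f :=
      continuousAt_id.norm.rpow_const (Or.inl (norm_ne_zero_iff.mpr hf))
    exact h1.smul (continuous_pairingCLM (μ := μ) (H := H) hr).continuousAt

theorem clarkson (hr : 2 ≤ r) (f g : Lp H (ENNReal.ofReal r) μ) :
    ‖f + g‖ ^ r + ‖f - g‖ ^ r ≤ 2 ^ (r - 1) * (‖f‖ ^ r + ‖g‖ ^ r) := by
  have h0 : 0 < r := by linarith
  have hn : ∀ f : Lp H (ENNReal.ofReal r) μ, ENNReal.ofReal (‖f‖ ^ r) = ∫⁻ x, ‖f x‖ₑ ^ r ∂μ := by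
    intro f
    rw [← ENNReal.ofReal_rpow_of_nonneg (norm_nonneg _) h0.le, ofReal_norm, Lp.enorm_def,
      eLpNorm_ofReal_rpow h0]
  have hm : ∀ f : Lp H (ENNReal.ofReal r) μ, AEMeasurable (fun x => ‖f x‖ₑ ^ r) μ := fun f =>
    (Lp.aestronglyMeasurable f).enorm.pow_const _
  rw [← ENNReal.ofReal_le_ofReal_iff (by positivity), ENNReal.ofReal_add (by positivity)
    (by positivity), ENNReal.ofReal_mul (by positivity), ENNReal.ofReal_add (by positivity)
    (by positivity), hn, hn, hn, hn, ← lintegral_add_left' (hm _), ← lintegral_add_left' (hm _),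
    ← lintegral_const_mul' _ _ ENNReal.ofReal_ne_top]
  refine lintegral_mono_ae ?_
  filter_upwards [Lp.coeFn_add f g, Lp.coeFn_sub f g] with x h1 h2
  rw [h1, h2, Pi.add_apply, Pi.sub_apply, ← ENNReal.ofReal_rpow_of_pos (by norm_num)]
  simpa using clarkson_pointwise hr (f x) (g x)

theorem uniformConvexSpace (hr : 2 ≤ r) : UniformConvexSpace (Lp H (ENNReal.ofReal r) μ) := by
  constructor
  intro ε hε
  have h0 : 0 < r := by linarith
  -- Clarkson's inequality bounds ‖f + g‖^r by 2^r - ε^r; the maximum with 0 covers ε > 2, where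
  -- this is negative.
  set b : ℝ := max 0 (2 ^ r - ε ^ r) with hb
  have hb2 : b < 2 ^ r := by
    rw [hb, max_lt_iff]
    have : 0 < ε ^ r := by positivity
    exact ⟨by positivity, by linarith⟩
  have hb0 : 0 ≤ b := le_max_left _ _
  refine ⟨2 - b ^ (1 / r), ?_, fun {f} hf {g} hg hfg => ?_⟩
  · have : b ^ (1 / r) < (2 ^ r) ^ (1 / r) := Real.rpow_lt_rpow hb0 hb2 (by positivity)
    rw [← Real.rpow_mul (by norm_num), mul_one_div_cancel h0.ne', Real.rpow_one] at this
    linarith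
  · have h := clarkson hr f g
    have h2 : (2 : ℝ) ^ (r - 1) * (1 + 1) = 2 ^ r := by
      rw [Real.rpow_sub_one (by norm_num)]; ring
    rw [hf, hg, Real.one_rpow, h2] at h
    have h3 : ε ^ r ≤ ‖f - g‖ ^ r := Real.rpow_le_rpow hε.le hfg h0.le
    have h4 : ‖f + g‖ ^ r ≤ b := le_max_of_le_right (by linarith)
    have h5 := Real.rpow_le_rpow (by positivity) h4 (by positivity : 0 ≤ 1 / r)
    rw [← Real.rpow_mul (norm_nonneg _), mul_one_div_cancel h0.ne', Real.rpow_one] at h5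
    linarith

end LpDuality

/-! ### Uniqueness of norming functionals. -/

namespace PowerMethod

open Filter Topology

/-- A functional which attains its norm at `f` is a multiple of the norming functional of `f`. -/
theorem eq_of_norming {Z : Type*} [NormedAddCommGroup Z] [NormedSpace ℝ Z] {D : Z → Z →L[ℝ] ℝ}
    (hD : IsDualityMap D) {K : Submodule ℝ Z} {ℓ : K →ₗ[ℝ] ℝ} {c : ℝ} (hc : 0 ≤ c) {f : K}
    (hf : f ≠ 0) (hℓf : ℓ f = c * ‖f‖) (hℓ : ∀ v, ℓ v ≤ c * ‖v‖) (v : K) :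
    ℓ v = c * D f v := by
  have hle : ∀ v : K, ℓ v ≤ c * D f v := by
    intro v
    have hfZ : (f : Z) ≠ 0 := fun h => hf (Subtype.ext h)
    have hlim : Tendsto (fun t : ℝ => c * D (f + t • v) v) (𝓝[>] 0) (𝓝 (c * D f v)) := by
      have h1 : ContinuousAt (fun t : ℝ => ((f : Z) + t • (v : Z))) 0 := by fun_prop
      have h2 : ContinuousAt (fun t : ℝ => D ((f : Z) + t • (v : Z))) 0 := by
        refine ContinuousAt.comp (g := D) ?_ h1
        simpa using hD.continuousAt hfZ
      have h3 : ContinuousAt (fun t : ℝ => c * D ((f : Z) + t • (v : Z)) v) 0 :=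
        continuousAt_const.mul (h2.clm_apply continuousAt_const)
      have h4 := h3.tendsto
      simp only [zero_smul, add_zero] at h4
      exact h4.mono_left nhdsWithin_le_nhds
    refine ge_of_tendsto hlim ?_
    filter_upwards [self_mem_nhdsWithin] with t ht
    have ht : (0 : ℝ) < t := ht
    have h1 := hℓ (f + t • v)
    rw [map_add, map_smul, hℓf, smul_eq_mul] at h1
    -- Half of the differentiability of the norm: the functional at the displaced point bounds the
    -- increment from above. Dividing by t and letting t → 0+ uses only the continuity of D at f.
    have h2 : ‖f + t • v‖ ≤ ‖f‖ + t * D (f + t • v) v := by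
      have h3 : ‖f + t • v‖ = D (f + t • v) (f + t • v) := (hD.apply_self _).symm
      rw [h3, map_add, map_smul, smul_eq_mul]
      have h4 : D ((f : Z) + t • (v : Z)) f ≤ ‖f‖ :=
        (le_abs_self _).trans (((D _).le_opNorm _).trans
          (mul_le_of_le_one_left (norm_nonneg _) (hD.norm_le _)))
      linarith
    have h5 := mul_le_mul_of_nonneg_left h2 hc
    have h6 : t * ℓ v ≤ t * (c * D (f + t • v) v) := by linarith
    exact le_of_mul_le_mul_left h6 ht
  -- The reverse inequality is the same bound at -v.
  refine le_antisymm (hle v) ?_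
  have := hle (-v)
  rw [map_neg, Submodule.coe_neg, map_neg] at this
  linarith

end PowerMethod

end

/-! ### Translation estimates and a quantitative Rellich theorem. -/

noncomputable section

namespace Rellich

open Filter Topology Metric

open scoped ENNReal

/-- Jensen's inequality for the power p, as Hölder against the constant 1. -/
theorem lintegral_rpow_le_of_prob {α : Type*} [MeasurableSpace α] {ν : Measure α}
    [IsProbabilityMeasure ν] {p : ℝ} (hp : 1 ≤ p) {g : α → ℝ≥0∞} (hg : AEMeasurable g ν) :
    (∫⁻ x, g x ∂ν) ^ p ≤ ∫⁻ x, g x ^ p ∂ν := by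
  have h0 : 0 < p := by linarith
  have h := ENNReal.lintegral_mul_norm_pow_le (μ := ν) (hg.pow_const p)
    (aemeasurable_const (b := (1 : ℝ≥0∞))) (p := 1 / p) (q := 1 - 1 / p) (by positivity)
    (by rw [sub_nonneg, div_le_one h0]; exact hp) (by ring)
  simp only [← ENNReal.rpow_mul, mul_one_div_cancel h0.ne', ENNReal.rpow_one, ENNReal.one_rpow,
    mul_one, lintegral_const, measure_univ] at h
  calc _ ≤ ((∫⁻ x, g x ^ p ∂ν) ^ (1 / p)) ^ p := by gcongr
    _ = _ := by rw [← ENNReal.rpow_mul, one_div_mul_cancel h0.ne', ENNReal.rpow_one]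

theorem enorm_translate_sub_le {F : Type*} [NormedAddCommGroup F] [NormedSpace ℝ F] {φ : F → ℝ} (hφ : ContDiff ℝ 1 φ) (x h : F) :
    ‖φ (x + h) - φ x‖ₑ ≤ ∫⁻ t in Set.Ioc (0 : ℝ) 1, ‖fderiv ℝ φ (x + t • h) h‖ₑ := by
  have hd : ∀ t : ℝ, HasDerivAt (fun t : ℝ => φ (x + t • h)) (fderiv ℝ φ (x + t • h) h) t := by
    intro t
    have h1 : HasDerivAt (fun t : ℝ => x + t • h) h t := by
      simpa using ((hasDerivAt_id t).smul_const h).const_add x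
    exact ((hφ.differentiable (by norm_num)) _).hasFDerivAt.comp_hasDerivAt t h1
  have hc : Continuous fun t : ℝ => fderiv ℝ φ (x + t • h) h :=
    ((hφ.continuous_fderiv (by norm_num)).comp (by fun_prop)).clm_apply continuous_const
  have h1 := intervalIntegral.integral_eq_sub_of_hasDerivAt (fun t _ => hd t)
    (hc.intervalIntegrable 0 1)
  simp only [one_smul, zero_smul, add_zero] at h1
  rw [← h1, intervalIntegral.integral_of_le zero_le_one]
  exact enorm_integral_le_lintegral_enorm _

variable {F : Type*} [NormedAddCommGroup F] [NormedSpace ℝ F] [MeasurableSpace F] [BorelSpace F]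
  [FiniteDimensional ℝ F] {μ : Measure F} [μ.IsAddHaarMeasure]

/-- The `L^p` norm of a difference, for a weight which is constant along the increment. -/
theorem lintegral_translate_sub_le {φ : F → ℝ} (hφ : ContDiff ℝ 1 φ) (h : F) {p : ℝ} (hp : 1 ≤ p)
    {w : F → ℝ≥0∞} (hwm : Measurable w) (hw : ∀ (t : ℝ) x, w (x + t • h) = w x) :
    ∫⁻ x, ‖φ (x + h) - φ x‖ₑ ^ p * w x ∂μ ≤ ∫⁻ x, ‖fderiv ℝ φ x h‖ₑ ^ p * w x ∂μ := by
  have : IsProbabilityMeasure (volume.restrict (Set.Ioc (0 : ℝ) 1)) := ⟨by simp⟩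
  have hc : Continuous fun z : F × ℝ => fderiv ℝ φ (z.1 + z.2 • h) h :=
    ((hφ.continuous_fderiv (by norm_num)).comp (by fun_prop)).clm_apply continuous_const
  have hm : Measurable fun z : F × ℝ => ‖fderiv ℝ φ (z.1 + z.2 • h) h‖ₑ ^ p * w z.1 :=
    (hc.measurable.enorm.pow_const _).mul (hwm.comp measurable_fst)
  calc ∫⁻ x, ‖φ (x + h) - φ x‖ₑ ^ p * w x ∂μ
      ≤ ∫⁻ x, (∫⁻ t in Set.Ioc (0 : ℝ) 1, ‖fderiv ℝ φ (x + t • h) h‖ₑ ^ p * w x) ∂μ := by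
        refine lintegral_mono fun x => ?_
        have hcx : Measurable fun t : ℝ => ‖fderiv ℝ φ (x + t • h) h‖ₑ :=
          (hc.comp (Continuous.prodMk_right x)).measurable.enorm
        rw [lintegral_mul_const _ (hcx.pow_const _)]
        gcongr
        exact (ENNReal.rpow_le_rpow (enorm_translate_sub_le hφ x h) (by linarith)).trans
          (lintegral_rpow_le_of_prob hp hcx.aemeasurable)
    _ = ∫⁻ t in Set.Ioc (0 : ℝ) 1, ∫⁻ x, ‖fderiv ℝ φ (x + t • h) h‖ₑ ^ p * w x ∂μ :=
        lintegral_lintegral_swap hm.aemeasurable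
    _ = ∫⁻ t in Set.Ioc (0 : ℝ) 1, ∫⁻ x, ‖fderiv ℝ φ x h‖ₑ ^ p * w x ∂μ := by
        refine lintegral_congr fun t => ?_
        rw [← lintegral_add_right_eq_self (μ := μ) (fun x => ‖fderiv ℝ φ x h‖ₑ ^ p * w x) (t • h)]
        refine lintegral_congr fun x => ?_
        rw [hw]
    _ = _ := by simp

/-- Poincaré's inequality in the direction of a translation that displaces the support. -/
theorem lintegral_poincare {φ : F → ℝ} (hφ : ContDiff ℝ 1 φ) (h : F) {p : ℝ} (hp : 1 ≤ p)
    {w : F → ℝ≥0∞} (hwm : Measurable w) (hw : ∀ (t : ℝ) x, w (x + t • h) = w x)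
    (hs : ∀ x, φ x ≠ 0 → φ (x + h) = 0) :
    ∫⁻ x, ‖φ x‖ₑ ^ p * w x ∂μ ≤ ∫⁻ x, ‖fderiv ℝ φ x h‖ₑ ^ p * w x ∂μ := by
  refine (lintegral_mono fun x => ?_).trans (lintegral_translate_sub_le hφ h hp hwm hw)
  gcongr
  by_cases hx : φ x = 0
  · simp [hx]
  · rw [hs x hx, zero_sub, enorm_neg]

theorem lintegral_translate_sub_le' {φ : F → ℝ} (hφ : ContDiff ℝ 1 φ) (h : F) {p : ℝ}
    (hp : 1 ≤ p) :
    ∫⁻ x, ‖φ (x + h) - φ x‖ₑ ^ p ∂μ ≤ ‖h‖ₑ ^ p * ∫⁻ x, ‖fderiv ℝ φ x‖ₑ ^ p ∂μ := by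
  have h1 := lintegral_translate_sub_le (μ := μ) hφ h hp (w := fun _ => 1) measurable_const
    (fun _ _ => rfl)
  simp only [mul_one] at h1
  have hne : ‖h‖ₑ ^ p ≠ ⊤ := ENNReal.rpow_ne_top_of_nonneg (by linarith) enorm_ne_top
  rw [← lintegral_const_mul' _ _ hne]
  refine h1.trans (lintegral_mono fun x => ?_)
  rw [← ENNReal.mul_rpow_of_nonneg _ _ (by linarith), mul_comm]
  gcongr
  exact (fderiv ℝ φ x).le_opENorm h

variable {ν : Measure F} [IsProbabilityMeasure ν]

/-- The difference from the average is an average of translation differences, each controlled in L^p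
by its length times the gradient. -/
theorem lintegral_sub_average_le {u : F → ℝ} (hu : ContDiff ℝ 1 u) (hInt : ∀ x, Integrable
    (fun z => u (x + z)) ν) {p : ℝ} (hp : 1 ≤ p) {h : ℝ≥0∞} (hν : ∀ᵐ z ∂ν, ‖z‖ₑ ≤ h) :
    ∫⁻ x, ‖u x - ∫ z, u (x + z) ∂ν‖ₑ ^ p ∂μ ≤ h ^ p * ∫⁻ x, ‖fderiv ℝ u x‖ₑ ^ p ∂μ := by
  have hc : Continuous fun z : F × F => u (z.1 + z.2) - u z.1 := by
    have := hu.continuous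
    fun_prop
  calc ∫⁻ x, ‖u x - ∫ z, u (x + z) ∂ν‖ₑ ^ p ∂μ
      ≤ ∫⁻ x, ∫⁻ z, ‖u (x + z) - u x‖ₑ ^ p ∂ν ∂μ := by
        refine lintegral_mono fun x => ?_
        have hcx : Measurable fun z => ‖u (x + z) - u x‖ₑ :=
          (hc.comp (Continuous.prodMk_right x)).measurable.enorm
        refine le_trans ?_ (lintegral_rpow_le_of_prob hp hcx.aemeasurable)
        gcongr
        have h1 : u x - ∫ z, u (x + z) ∂ν = -∫ z, (u (x + z) - u x) ∂ν := by
          rw [integral_sub (hInt x) (integrable_const _)]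
          simp
        rw [h1, enorm_neg]
        exact enorm_integral_le_lintegral_enorm _
    _ = ∫⁻ z, ∫⁻ x, ‖u (x + z) - u x‖ₑ ^ p ∂μ ∂ν :=
        lintegral_lintegral_swap (hc.measurable.enorm.pow_const _).aemeasurable
    _ ≤ ∫⁻ _, h ^ p * ∫⁻ x, ‖fderiv ℝ u x‖ₑ ^ p ∂μ ∂ν := by
        refine lintegral_mono_ae ?_
        filter_upwards [hν] with z hz
        refine (lintegral_translate_sub_le' hu z hp).trans ?_
        gcongr
    _ = _ := by simp

/-- Averages are equicontinuous: since ν has bounded density, the difference of two averages is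
bounded by the L^p norm of a translation difference. Smallness at finitely many centres thus gives
smallness everywhere. -/
theorem enorm_average_sub_le {u : F → ℝ} (hu : ContDiff ℝ 1 u) (hInt : ∀ x, Integrable
    (fun z => u (x + z)) ν) {p : ℝ} (hp : 1 ≤ p) {c : ℝ≥0∞} (hν : ν ≤ c • μ) (x y : F) :
    ‖(∫ z, u (x + z) ∂ν) - ∫ z, u (y + z) ∂ν‖ₑ ^ p ≤
      c * (‖x - y‖ₑ ^ p * ∫⁻ x, ‖fderiv ℝ u x‖ₑ ^ p ∂μ) := by
  rw [← integral_sub (hInt x) (hInt y)]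
  have hcm : Measurable fun z => ‖u (x + z) - u (y + z)‖ₑ := by
    have := hu.continuous
    have : Continuous fun z => u (x + z) - u (y + z) := by fun_prop
    exact this.measurable.enorm
  calc _ ≤ (∫⁻ z, ‖u (x + z) - u (y + z)‖ₑ ∂ν) ^ p := by
        gcongr
        exact enorm_integral_le_lintegral_enorm _
    _ ≤ ∫⁻ z, ‖u (x + z) - u (y + z)‖ₑ ^ p ∂ν := lintegral_rpow_le_of_prob hp hcm.aemeasurable
    _ ≤ ∫⁻ z, ‖u (x + z) - u (y + z)‖ₑ ^ p ∂(c • μ) := lintegral_mono' hν le_rfl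
    _ = c * ∫⁻ z, ‖u (x + z) - u (y + z)‖ₑ ^ p ∂μ := by rw [lintegral_smul_measure, smul_eq_mul]
    _ = c * ∫⁻ z, ‖u (z + (x - y)) - u z‖ₑ ^ p ∂μ := by
        rw [← lintegral_add_left_eq_self (μ := μ) (fun z => ‖u (z + (x - y)) - u z‖ₑ ^ p) y]
        congr 1
        refine lintegral_congr fun z => ?_
        have : y + z + (x - y) = x + z := by abel
        rw [this]
    _ ≤ _ := by
        gcongr
        exact lintegral_translate_sub_le' hu _ hp

set_option linter.unusedSectionVars false in
theorem enorm_average_le {u : F → ℝ} (hu : Continuous u) {p : ℝ} (hp : 1 ≤ p) {c : ℝ≥0∞}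
    (hν : ν ≤ c • μ) (x : F) :
    ‖∫ z, u (x + z) ∂ν‖ₑ ^ p ≤ c * ∫⁻ z, ‖u z‖ₑ ^ p ∂μ := by
  have hcm : Measurable fun z => ‖u (x + z)‖ₑ := by
    have : Continuous fun z => u (x + z) := by fun_prop
    exact this.measurable.enorm
  calc _ ≤ (∫⁻ z, ‖u (x + z)‖ₑ ∂ν) ^ p := by
        gcongr
        exact enorm_integral_le_lintegral_enorm _
    _ ≤ ∫⁻ z, ‖u (x + z)‖ₑ ^ p ∂ν := lintegral_rpow_le_of_prob hp hcm.aemeasurable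
    _ ≤ ∫⁻ z, ‖u (x + z)‖ₑ ^ p ∂(c • μ) := lintegral_mono' hν le_rfl
    _ = c * ∫⁻ z, ‖u (x + z)‖ₑ ^ p ∂μ := by rw [lintegral_smul_measure, smul_eq_mul]
    _ = _ := by rw [lintegral_add_left_eq_self (μ := μ) (fun z => ‖u z‖ₑ ^ p) x]

variable (μ) in
/-- Uniform probability measures on small balls. -/
theorem exists_uniform (h : ℝ) (hh : 0 < h) : ∃ ν : Measure F, IsProbabilityMeasure ν ∧
    (∀ᵐ z ∂ν, ‖z‖ ≤ h) ∧ ∃ c : ℝ≥0∞, c ≠ ⊤ ∧ ν ≤ c • μ := by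
  have h0 : μ (closedBall (0 : F) h) ≠ 0 := (measure_closedBall_pos μ 0 hh).ne'
  have h1 : μ (closedBall (0 : F) h) ≠ ⊤ := measure_closedBall_lt_top.ne
  refine ⟨(μ (closedBall 0 h))⁻¹ • μ.restrict (closedBall 0 h), ⟨?_⟩, ?_,
    (μ (closedBall 0 h))⁻¹, ENNReal.inv_ne_top.mpr h0, ?_⟩
  · simp [ENNReal.inv_mul_cancel h0 h1]
  · refine Measure.ae_smul_measure ?_ _
    filter_upwards [ae_restrict_mem measurableSet_closedBall] with z hz
    simpa using hz
  · gcongr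
    exact Measure.restrict_le_self

theorem exists_mul_rpow_le {K ε : ℝ≥0∞} (hK : K ≠ ⊤) (hε : 0 < ε) {p : ℝ} (hp : 0 < p) :
    ∃ s₀ : ℝ, 0 < s₀ ∧ ∀ s : ℝ, s ≤ s₀ → K * ENNReal.ofReal s ^ p ≤ ε := by
  have h1 : Tendsto (fun s : ℝ => K * ENNReal.ofReal s ^ p) (𝓝 0) (𝓝 (K * 0 ^ p)) := by
    refine ENNReal.Tendsto.const_mul ?_ (Or.inr hK)
    refine (ENNReal.continuous_rpow_const.tendsto 0).comp ?_
    simpa using (ENNReal.continuous_ofReal.tendsto (0 : ℝ))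
  rw [ENNReal.zero_rpow_of_pos hp, mul_zero] at h1
  obtain ⟨s₀, hs₀, h2⟩ := Metric.eventually_nhds_iff.mp (h1.eventually (ge_mem_nhds hε))
  refine ⟨s₀ / 2, by positivity, fun s hs => ?_⟩
  have h3 : K * ENNReal.ofReal (s₀ / 2) ^ p ≤ ε := h2 (by
    rw [Real.dist_eq, sub_zero, abs_of_pos (by positivity)]; linarith)
  refine le_trans ?_ h3
  gcongr

variable (μ) in
/-- Quantitative form of Rellich's theorem: a function with bounded gradient and finitely many
small averages has a small norm. -/
theorem lintegral_le_of_averages {D : ℕ → F} (hD : DenseRange D) {ν : ℕ → Measure F}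
    [∀ m, IsProbabilityMeasure (ν m)] (hν : ∀ m : ℕ, ∀ᵐ z ∂ν m, ‖z‖ ≤ 1 / ((m : ℝ) + 1))
    (hνc : ∀ m, ∃ c : ℝ≥0∞, c ≠ ⊤ ∧ ν m ≤ c • μ) {p : ℝ} (hp : 1 ≤ p) (R : ℝ) {C : ℝ≥0∞}
    (hC : C ≠ ⊤) {ε : ℝ≥0∞} (hε : 0 < ε) :
    ∃ (m : ℕ) (t : Finset ℕ) (η : ℝ), 0 < η ∧ ∀ u : F → ℝ, ContDiff ℝ 1 u →
      (∀ x, u x ≠ 0 → ‖x‖ ≤ R) → ∫⁻ x, ‖fderiv ℝ u x‖ₑ ^ p ∂μ ≤ C →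
      (∀ i ∈ t, |∫ z, u (D i + z) ∂ν m| ≤ η) → ∫⁻ x, ‖u x‖ₑ ^ p ∂μ ≤ ε := by
  have hp0 : 0 < p := by linarith
  set k : ℝ≥0∞ := 2 ^ (p - 1) with hk
  have hkt : k ≠ ⊤ := ENNReal.rpow_ne_top_of_nonneg (by linarith) (by norm_num)
  have hε2 : 0 < ε / 2 := ENNReal.half_pos hε.ne'
  have hε4 : 0 < ε / 2 / 2 := ENNReal.half_pos hε2.ne'
  -- The order of choices matters: first the radius, bringing the error of averaging below ε/2; then
  -- the net width s and the threshold η, whose contributions depend on the density bound c of the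
  -- chosen measure and are at most ε/4 each.
  obtain ⟨h, hh, hsmall⟩ := exists_mul_rpow_le (ENNReal.mul_ne_top hkt hC) hε2 hp0
  obtain ⟨m, hm⟩ := exists_nat_one_div_lt hh
  obtain ⟨c, hc, hcν⟩ := hνc m
  -- The averaging radius is at most 1, so the averages vanish outside the ball of radius R + 1.
  set V := μ (closedBall (0 : F) (R + 1)) with hV
  have hVt : V ≠ ⊤ := measure_closedBall_lt_top.ne
  obtain ⟨s, hs, hs'⟩ := exists_mul_rpow_le (K := k * (V * (k * (c * C)))) (by
    refine ENNReal.mul_ne_top hkt (ENNReal.mul_ne_top hVt (ENNReal.mul_ne_top hkt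
      (ENNReal.mul_ne_top hc hC)))) hε4 hp0
  obtain ⟨η, hη, hη'⟩ := exists_mul_rpow_le (K := k * (V * k)) (by
    refine ENNReal.mul_ne_top hkt (ENNReal.mul_ne_top hVt hkt)) hε4 hp0
  obtain ⟨t, ht⟩ := (isCompact_closedBall (0 : F) (R + 1)).elim_finite_subcover
    (fun i => ball (D i) s) (fun i => isOpen_ball) (fun x _ => by
      obtain ⟨i, hi⟩ := hD.exists_dist_lt x hs
      exact Set.mem_iUnion.mpr ⟨i, hi⟩)
  refine ⟨m, t, η, hη, fun u hu hsupp hDu havg => ?_⟩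
  have hcs : HasCompactSupport u := by
    refine HasCompactSupport.intro (isCompact_closedBall (0 : F) R) fun x hx => ?_
    by_contra h0
    exact hx (by simpa using hsupp x h0)
  obtain ⟨b, hb⟩ := hu.continuous.bounded_above_of_compact_support hcs
  have hInt : ∀ x, Integrable (fun z => u (x + z)) (ν m) := fun x =>
    Integrable.of_bound (hu.continuous.comp (continuous_const.add
      continuous_id)).aestronglyMeasurable b (Eventually.of_forall fun z => hb _)
  have hmz : ∀ᵐ z ∂ν m, ‖z‖ₑ ≤ ENNReal.ofReal (1 / ((m : ℝ) + 1)) := by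
    filter_upwards [hν m] with z hz
    rw [← ofReal_norm]
    exact ENNReal.ofReal_le_ofReal hz
  have h1 : k * ∫⁻ x, ‖u x - ∫ z, u (x + z) ∂ν m‖ₑ ^ p ∂μ ≤ ε / 2 := by
    refine le_trans ?_ (hsmall _ hm.le)
    calc _ ≤ k * (ENNReal.ofReal (1 / ((m : ℝ) + 1)) ^ p * ∫⁻ x, ‖fderiv ℝ u x‖ₑ ^ p ∂μ) := by
          gcongr
          exact lintegral_sub_average_le hu hInt hp hmz
      _ ≤ k * (ENNReal.ofReal (1 / ((m : ℝ) + 1)) ^ p * C) := by gcongr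
      _ = _ := by ring
  have hpt : ∀ x, ‖∫ z, u (x + z) ∂ν m‖ₑ ^ p ≤ (closedBall (0 : F) (R + 1)).indicator
      (fun _ => k * (c * C * ENNReal.ofReal s ^ p + ENNReal.ofReal η ^ p)) x := by
    intro x
    by_cases hx : x ∈ closedBall (0 : F) (R + 1)
    · rw [Set.indicator_of_mem hx]
      obtain ⟨i, hi, hxi⟩ : ∃ i ∈ t, x ∈ ball (D i) s := by simpa using ht hx
      have h2 := enorm_average_sub_le hu hInt hp hcν x (D i)
      have h3 : ‖x - D i‖ₑ ≤ ENNReal.ofReal s := by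
        rw [← ofReal_norm]
        rw [mem_ball, dist_eq_norm] at hxi
        exact ENNReal.ofReal_le_ofReal hxi.le
      have h4 : ‖∫ z, u (D i + z) ∂ν m‖ₑ ≤ ENNReal.ofReal η := by
        rw [← ofReal_norm]
        exact ENNReal.ofReal_le_ofReal (havg i hi)
      have h5 : ‖∫ z, u (x + z) ∂ν m‖ₑ ≤
          ‖(∫ z, u (x + z) ∂ν m) - ∫ z, u (D i + z) ∂ν m‖ₑ + ‖∫ z, u (D i + z) ∂ν m‖ₑ := by
        simpa using enorm_add_le ((∫ z, u (x + z) ∂ν m) - ∫ z, u (D i + z) ∂ν m)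
          (∫ z, u (D i + z) ∂ν m)
      calc _ ≤ (‖(∫ z, u (x + z) ∂ν m) - ∫ z, u (D i + z) ∂ν m‖ₑ +
              ‖∫ z, u (D i + z) ∂ν m‖ₑ) ^ p := by gcongr
        _ ≤ k * (‖(∫ z, u (x + z) ∂ν m) - ∫ z, u (D i + z) ∂ν m‖ₑ ^ p +
              ‖∫ z, u (D i + z) ∂ν m‖ₑ ^ p) := ENNReal.rpow_add_le_mul_rpow_add_rpow _ _ hp
        _ ≤ k * (c * (‖x - D i‖ₑ ^ p * ∫⁻ x, ‖fderiv ℝ u x‖ₑ ^ p ∂μ) +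
              ENNReal.ofReal η ^ p) := by gcongr
        _ ≤ k * (c * (ENNReal.ofReal s ^ p * C) + ENNReal.ofReal η ^ p) := by gcongr
        _ = _ := by ring
    · rw [Set.indicator_of_notMem hx]
      have : ∫ z, u (x + z) ∂ν m = 0 := by
        refine integral_eq_zero_of_ae ?_
        filter_upwards [hν m] with z hz
        by_contra h0
        have h2 := hsupp _ h0
        have h3 : ‖x‖ ≤ ‖x + z‖ + ‖z‖ := by simpa using norm_sub_le (x + z) z
        have h4 : 1 / ((m : ℝ) + 1) ≤ 1 := by
          rw [div_le_one (by positivity)]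
          linarith [(Nat.cast_nonneg m : (0 : ℝ) ≤ m)]
        exact hx (by rw [mem_closedBall, dist_zero_right]; linarith)
      rw [this]
      simp [hp0]
  have h2 : ∫⁻ x, ‖∫ z, u (x + z) ∂ν m‖ₑ ^ p ∂μ ≤
      V * (k * (c * C * ENNReal.ofReal s ^ p + ENNReal.ofReal η ^ p)) := by
    refine (lintegral_mono hpt).trans ?_
    rw [lintegral_indicator measurableSet_closedBall, lintegral_const,
      Measure.restrict_apply_univ, mul_comm]
  have hmeas : AEMeasurable (fun x => ‖u x - ∫ z, u (x + z) ∂ν m‖ₑ ^ p) μ := by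
    have h3 : StronglyMeasurable fun x => ∫ z, u (x + z) ∂ν m := by
      refine StronglyMeasurable.integral_prod_right' (f := fun q : F × F => u (q.1 + q.2)) ?_
      exact (hu.continuous.comp (continuous_fst.add continuous_snd)).stronglyMeasurable
    exact ((hu.continuous.measurable.sub h3.measurable).enorm.pow_const _).aemeasurable
  calc ∫⁻ x, ‖u x‖ₑ ^ p ∂μ ≤ ∫⁻ x, k * (‖u x - ∫ z, u (x + z) ∂ν m‖ₑ ^ p +
          ‖∫ z, u (x + z) ∂ν m‖ₑ ^ p) ∂μ := by
        refine lintegral_mono fun x => ?_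
        refine le_trans ?_ (ENNReal.rpow_add_le_mul_rpow_add_rpow _ _ hp)
        gcongr
        simpa using enorm_add_le (u x - ∫ z, u (x + z) ∂ν m) (∫ z, u (x + z) ∂ν m)
    _ = k * ∫⁻ x, ‖u x - ∫ z, u (x + z) ∂ν m‖ₑ ^ p ∂μ +
          k * ∫⁻ x, ‖∫ z, u (x + z) ∂ν m‖ₑ ^ p ∂μ := by
        rw [lintegral_const_mul' _ _ hkt, lintegral_add_left' hmeas, mul_add]
    _ ≤ ε / 2 + k * (V * (k * (c * C * ENNReal.ofReal s ^ p + ENNReal.ofReal η ^ p))) := by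
        gcongr
    _ = ε / 2 + (k * (V * (k * (c * C))) * ENNReal.ofReal s ^ p +
          k * (V * k) * ENNReal.ofReal η ^ p) := by ring
    _ ≤ ε / 2 + (ε / 2 / 2 + ε / 2 / 2) := by
        gcongr
        · exact hs' s le_rfl
        · exact hη' η le_rfl
    _ = ε := by rw [ENNReal.add_halves, ENNReal.add_halves]

end Rellich

end

/-! ### Sobolev inequalities with anisotropic scaling. -/

noncomputable section

namespace StretchedCorner

open Filter Topology

open scoped ENNReal NNReal

variable {n : ℕ}

/-- The diagonal linear map with entries `a`. -/
def diagMap (a : Fin (n + 2) → ℝ) : Amb n →L[ℝ] Amb n :=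
  LinearMap.toContinuousLinearMap
    { toFun := fun x => WithLp.toLp 2 fun i => a i * x i
      map_add' := fun x y => by ext i; simp [mul_add]
      map_smul' := fun c x => by ext i; simp [mul_left_comm] }

@[simp] theorem diagMap_apply (a : Fin (n + 2) → ℝ) (x : Amb n) (i : Fin (n + 2)) :
    diagMap a x i = a i * x i := rfl

theorem det_diagMap (a : Fin (n + 2) → ℝ) :
    LinearMap.det (diagMap a : Amb n →ₗ[ℝ] Amb n) = ∏ i, a i := by
  have h : (diagMap a : Amb n →ₗ[ℝ] Amb n) =
      ((WithLp.linearEquiv 2 ℝ (Fin (n + 2) → ℝ)).symm : (Fin (n + 2) → ℝ) →ₗ[ℝ] Amb n) ∘ₗ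
        Matrix.toLin' (Matrix.diagonal a) ∘ₗ
        ((WithLp.linearEquiv 2 ℝ (Fin (n + 2) → ℝ)).symm.symm : Amb n →ₗ[ℝ] (Fin (n + 2) → ℝ)) := by
    ext x i
    simp [Matrix.mulVec_diagonal]
  rw [h, LinearMap.det_conj, LinearMap.det_toLin', Matrix.det_diagonal]

theorem lintegral_comp_diagMap {a : Fin (n + 2) → ℝ} (ha : ∀ i, 0 < a i) {f : Amb n → ℝ≥0∞}
    (hf : Measurable f) :
    ∫⁻ x, f (diagMap a x) = (ENNReal.ofReal (∏ i, a i))⁻¹ * ∫⁻ x, f x := by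
  have hpos : 0 < ∏ i, a i := Finset.prod_pos fun i _ => ha i
  have hdet : LinearMap.det (diagMap a : Amb n →ₗ[ℝ] Amb n) ≠ 0 := by
    rw [det_diagMap]; exact hpos.ne'
  have h1 := Measure.map_linearMap_addHaar_eq_smul_addHaar (volume : Measure (Amb n)) hdet
  rw [← lintegral_map hf (diagMap a).continuous.measurable]
  have h2 : Measure.map (diagMap a) (volume : Measure (Amb n)) =
      ENNReal.ofReal |(∏ i, a i)⁻¹| • volume := by
    rw [← det_diagMap, ← h1]; rfl
  rw [h2, lintegral_smul_measure, abs_of_pos (inv_pos.mpr hpos), ENNReal.ofReal_inv_of_pos hpos,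
    smul_eq_mul]

/-- The Gagliardo–Nirenberg–Sobolev inequality with anisotropic scaling. -/
theorem sobolev_scaled {p s : ℝ} (hp : 1 ≤ p) (hs : 0 < s) (hps : s⁻¹ = p⁻¹ - ((n : ℝ) + 2)⁻¹) :
    ∃ K : ℝ≥0∞, K ≠ ⊤ ∧ ∀ (ψ : Amb n → ℝ) (a : Fin (n + 2) → ℝ), ContDiff ℝ 1 ψ →
      HasCompactSupport ψ → (∀ i, 0 < a i) →
      ∫⁻ x, ‖ψ x‖ₑ ^ s ≤ K * ENNReal.ofReal (∏ i, a i) ^ (1 - s / p) *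
        (∫⁻ x, ‖(fderiv ℝ ψ x).comp (diagMap a)‖ₑ ^ p) ^ (s / p) := by
  have hp0 : 0 < p := by linarith
  set C : ℝ≥0 := SNormLESNormFDerivOfEqConst ℝ (volume : Measure (Amb n)) p.toNNReal with hC
  refine ⟨(C : ℝ≥0∞) ^ s, ENNReal.rpow_ne_top_of_nonneg hs.le ENNReal.coe_ne_top,
    fun ψ a hψ hψc ha => ?_⟩
  have hpos : 0 < ∏ i, a i := Finset.prod_pos fun i _ => ha i
  set d := ENNReal.ofReal (∏ i, a i) with hd
  have hd0 : d ≠ 0 := by simpa [hd] using hpos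
  have hdt : d ≠ ⊤ := ENNReal.ofReal_ne_top
  -- The isotropic inequality is applied after precomposition with the diagonal map. The change of
  -- variables puts a factor d⁻¹ on both integrals, which leaves d · d^{-s/p}.
  set u : Amb n → ℝ := fun x => ψ (diagMap a x) with hu
  have huc : ContDiff ℝ 1 u := hψ.comp (diagMap a).contDiff
  have hdet : LinearMap.det (diagMap a : Amb n →ₗ[ℝ] Amb n) ≠ 0 := by
    rw [det_diagMap]; exact hpos.ne'
  have hus : HasCompactSupport u := by
    have hcl : Topology.IsClosedEmbedding (diagMap a) := by
      have hinj : LinearMap.ker (diagMap a : Amb n →ₗ[ℝ] Amb n) = ⊥ := by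
        rw [LinearMap.ker_eq_bot']
        intro x hx
        ext i
        have := congrArg (fun y : Amb n => y i) hx
        simpa [(ha i).ne'] using this
      exact LinearMap.isClosedEmbedding_of_injective hinj
    exact hψc.comp_isClosedEmbedding hcl
  have hfd : ∀ x, fderiv ℝ u x = (fderiv ℝ ψ (diagMap a x)).comp (diagMap a) := by
    intro x
    have h1 : HasFDerivAt ψ (fderiv ℝ ψ (diagMap a x)) (diagMap a x) :=
      (hψ.differentiable (by norm_num) _).hasFDerivAt
    exact (h1.comp x (diagMap a).hasFDerivAt).fderiv
  have hG := eLpNorm_le_eLpNorm_fderiv_of_eq (volume : Measure (Amb n)) huc hus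
    (p := p.toNNReal) (p' := s.toNNReal) (by simpa using hp) (by simp) (by
      rw [Real.coe_toNNReal _ hs.le, NNReal.coe_inv, Real.coe_toNNReal _ hp0.le, hps]; simp)
  change eLpNorm u (ENNReal.ofReal s) volume ≤ C * eLpNorm (fderiv ℝ u) (ENNReal.ofReal p) volume
    at hG
  rw [LpDuality.eLpNorm_ofReal_eq hs, LpDuality.eLpNorm_ofReal_eq hp0] at hG
  have h1 : ∫⁻ x, ‖u x‖ₑ ^ s = d⁻¹ * ∫⁻ x, ‖ψ x‖ₑ ^ s :=
    lintegral_comp_diagMap ha (f := fun x => ‖ψ x‖ₑ ^ s)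
      (hψ.continuous.measurable.enorm.pow_const _)
  have h2 : ∫⁻ x, ‖fderiv ℝ u x‖ₑ ^ p =
      d⁻¹ * ∫⁻ x, ‖(fderiv ℝ ψ x).comp (diagMap a)‖ₑ ^ p := by
    simp_rw [hfd]
    refine lintegral_comp_diagMap ha (f := fun x => ‖(fderiv ℝ ψ x).comp (diagMap a)‖ₑ ^ p) ?_
    have hc : Continuous fun x => (fderiv ℝ ψ x).comp (diagMap a) :=
      (hψ.continuous_fderiv (by norm_num)).clm_comp continuous_const
    exact hc.measurable.enorm.pow_const _
  rw [h1, h2] at hG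
  have h3 := ENNReal.rpow_le_rpow hG hs.le
  rw [← ENNReal.rpow_mul, one_div_mul_cancel hs.ne', ENNReal.rpow_one,
    ENNReal.mul_rpow_of_nonneg _ _ hs.le, ← ENNReal.rpow_mul, one_div_mul_eq_div,
    ENNReal.mul_rpow_of_nonneg _ _ (by positivity)] at h3
  set A := ∫⁻ x, ‖ψ x‖ₑ ^ s
  set B := (∫⁻ x, ‖(fderiv ℝ ψ x).comp (diagMap a)‖ₑ ^ p) ^ (s / p)
  calc A = d * (d⁻¹ * A) := by rw [← mul_assoc, ENNReal.mul_inv_cancel hd0 hdt, one_mul]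
    _ ≤ d * (C ^ s * (d⁻¹ ^ (s / p) * B)) := by gcongr
    _ = C ^ s * (d * d⁻¹ ^ (s / p)) * B := by ring
    _ = _ := by
      congr 2
      rw [ENNReal.rpow_sub _ _ hd0 hdt, ENNReal.rpow_one, ENNReal.inv_rpow, ENNReal.div_eq_inv_mul,
        mul_comm]

theorem lintegral_interpolate {α : Type*} [MeasurableSpace α] {μ : Measure α} {f : α → ℝ≥0∞}
    (hf : AEMeasurable f μ) {p q s θ : ℝ} (hθ0 : 0 ≤ θ) (hθ1 : θ ≤ 1) (hp : 0 ≤ p) (hs : 0 ≤ s)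
    (hq : q = (1 - θ) * p + θ * s) :
    ∫⁻ x, f x ^ q ∂μ ≤ (∫⁻ x, f x ^ p ∂μ) ^ (1 - θ) * (∫⁻ x, f x ^ s ∂μ) ^ θ := by
  have h := ENNReal.lintegral_mul_norm_pow_le (hf.pow_const p) (hf.pow_const s)
    (sub_nonneg.mpr hθ1) hθ0 (by ring)
  refine le_trans (le_of_eq (lintegral_congr fun x => ?_)) h
  rw [← ENNReal.rpow_mul, ← ENNReal.rpow_mul, ← ENNReal.rpow_add_of_nonneg _ _
    (mul_nonneg hp (sub_nonneg.mpr hθ1)) (mul_nonneg hs hθ0), hq]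
  ring_nf

/-- The subcritical Sobolev inequality with anisotropic scaling. -/
theorem sobolev_interpolated {p q : ℝ} (hp : 1 ≤ p) (hpN : p < (n : ℝ) + 2) (hpq : p < q)
    (hq : q < ((n : ℝ) + 2) * p / ((n : ℝ) + 2 - p)) :
    ∃ K : ℝ≥0∞, ∃ θ : ℝ, K ≠ ⊤ ∧ 0 < θ ∧ θ < 1 ∧ 0 < q / p - (1 - θ) ∧
      ∀ (ψ : Amb n → ℝ) (a : Fin (n + 2) → ℝ), ContDiff ℝ 1 ψ →
      HasCompactSupport ψ → (∀ i, 0 < a i) →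
      ∫⁻ x, ‖ψ x‖ₑ ^ q ≤ K * ENNReal.ofReal (∏ i, a i) ^ (1 - q / p) *
        ((∫⁻ x, ‖ψ x‖ₑ ^ p) ^ (1 - θ) *
        (∫⁻ x, ‖(fderiv ℝ ψ x).comp (diagMap a)‖ₑ ^ p) ^ (q / p - (1 - θ))) := by
  have hp0 : 0 < p := by linarith
  have hN : 0 < (n : ℝ) + 2 - p := by linarith
  set s := ((n : ℝ) + 2) * p / ((n : ℝ) + 2 - p) with hs
  have hsp : p < s := hpq.trans hq
  have hs0 : 0 < s := hp0.trans hsp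
  obtain ⟨K, hK, h⟩ := sobolev_scaled (n := n) (s := s) hp hs0 (by
    rw [hs]; field_simp)
  -- The weight for which q = (1 - θ)p + θs, interpolating between p and the critical exponent s.
  set θ := (q - p) / (s - p) with hθ
  have hsp' : 0 < s - p := by linarith
  have hθ0 : 0 < θ := div_pos (by linarith) hsp'
  have hθ1 : θ < 1 := by rw [hθ, div_lt_one hsp']; linarith
  have hqe : q = (1 - θ) * p + θ * s := by rw [hθ]; field_simp; ring
  have e1 : (1 - s / p) * θ = 1 - q / p := by
    rw [hqe]; field_simp; ring
  have e2 : s / p * θ = q / p - (1 - θ) := by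
    rw [hqe]; field_simp; ring
  refine ⟨K ^ θ, θ, ENNReal.rpow_ne_top_of_nonneg hθ0.le hK, hθ0, hθ1, ?_,
    fun ψ a hψ hψc ha => ?_⟩
  · rw [← e2]; positivity
  refine (lintegral_interpolate hψ.continuous.measurable.enorm.aemeasurable hθ0.le hθ1.le hp0.le
    hs0.le hqe).trans ?_
  calc _ ≤ (∫⁻ x, ‖ψ x‖ₑ ^ p) ^ (1 - θ) * (K * ENNReal.ofReal (∏ i, a i) ^ (1 - s / p) *
        (∫⁻ x, ‖(fderiv ℝ ψ x).comp (diagMap a)‖ₑ ^ p) ^ (s / p)) ^ θ := by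
        gcongr
        exact h ψ a hψ hψc ha
    _ = _ := by
        rw [ENNReal.mul_rpow_of_nonneg _ _ hθ0.le, ENNReal.mul_rpow_of_nonneg _ _ hθ0.le,
          ← ENNReal.rpow_mul, ← ENNReal.rpow_mul, e1, e2]
        ring

end StretchedCorner

end

/-! ### Localization to cells x₁ ∼ ε₁, x₂ ∼ ε₂. -/

noncomputable section

namespace StretchedCorner

open Filter Topology

open scoped ENNReal NNReal

variable {n : ℕ}

theorem inner_gradient {φ : Amb n → ℝ} (x v : Amb n) :
    inner ℝ (gradient φ x) v = fderiv ℝ φ x v := by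
  simp [gradient]

/-- A smooth cutoff function for the interval `[1, 2]`. -/
structure IsCutoff (ρ : ℝ → ℝ) (B : ℝ) : Prop where
  contDiff : ContDiff ℝ ∞ ρ
  nonneg (y : ℝ) : 0 ≤ ρ y
  le_one (y : ℝ) : ρ y ≤ 1
  eq_one {y : ℝ} (h1 : 1 ≤ y) (h2 : y ≤ 2) : ρ y = 1
  mem_of_ne {y : ℝ} (h : ρ y ≠ 0) : 1 / 2 < y ∧ y < 5 / 2
  deriv_le (y : ℝ) : |deriv ρ y| ≤ B

theorem exists_isCutoff : ∃ ρ B, IsCutoff ρ B := by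
  let b : ContDiffBump (3 / 2 : ℝ) := ⟨1 / 2, 1, by norm_num, by norm_num⟩
  have hb : ContDiff ℝ ∞ b := b.contDiff
  have hd : Continuous (deriv b) := hb.continuous_deriv (by simp)
  obtain ⟨B, hB⟩ := hd.bounded_above_of_compact_support b.hasCompactSupport.deriv
  refine ⟨b, B, hb, fun y => b.nonneg, fun y => b.le_one, fun {y} h1 h2 => ?_, fun {y} h => ?_, hB⟩
  · refine b.one_of_mem_closedBall ?_
    rw [Metric.mem_closedBall, Real.dist_eq, abs_le]
    constructor <;> simp only [b] <;> linarith
  · have h1 : y ∈ Function.support b := h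
    rw [b.support_eq, Metric.mem_ball, Real.dist_eq, abs_lt] at h1
    simp only [b] at h1
    constructor <;> linarith [h1.1, h1.2]

theorem IsCutoff.deriv_eq_zero {ρ : ℝ → ℝ} {B : ℝ} (hρ : IsCutoff ρ B) {y : ℝ} (h : ρ y = 0) :
    deriv ρ y = 0 := by
  have : IsLocalMin ρ y := Eventually.of_forall fun z => by rw [h]; exact hρ.nonneg z
  exact this.deriv_eq_zero

theorem IsCutoff.bound_nonneg {ρ : ℝ → ℝ} {B : ℝ} (hρ : IsCutoff ρ B) : 0 ≤ B :=
  (abs_nonneg _).trans (hρ.deriv_le 0)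

/-- Localization of `φ` to `x₁ ∼ ε₁`, `x₂ ∼ ε₂`. -/
def localize (ρ : ℝ → ℝ) (ε₁ ε₂ : ℝ) (φ : Amb n → ℝ) (x : Amb n) : ℝ :=
  ρ (x 0 / ε₁) * ρ (x 1 / ε₂) * φ x

/-- The scales of the coordinates in the cell `x₁ ∼ ε₁`, `x₂ ∼ ε₂`. -/
def cellScale (ε₁ ε₂ : ℝ) (i : Fin (n + 2)) : ℝ := if i = 0 then ε₁ else if i = 1 then ε₁ * ε₂ else 1

theorem cellScale_pos {ε₁ ε₂ : ℝ} (h1 : 0 < ε₁) (h2 : 0 < ε₂) (i : Fin (n + 2)) :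
    0 < cellScale ε₁ ε₂ i := by
  unfold cellScale
  split_ifs <;> positivity

theorem prod_cellScale (ε₁ ε₂ : ℝ) : ∏ i : Fin (n + 2), cellScale ε₁ ε₂ i = ε₁ * (ε₁ * ε₂) := by
  rw [Fin.prod_univ_succ, Fin.prod_univ_succ]
  have h : ∀ i : Fin n, cellScale ε₁ ε₂ i.succ.succ = 1 := fun i => by
    have h1 : (i.succ.succ : Fin (n + 2)) ≠ 1 := by
      rw [← Fin.succ_zero_eq_one]
      exact fun h => Fin.succ_ne_zero i (Fin.succ_injective _ h)
    simp [cellScale, h1]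
  rw [Finset.prod_congr rfl fun i _ => h i]
  simp [cellScale]

theorem contDiff_coord (i : Fin (n + 2)) {k : WithTop ℕ∞} : ContDiff ℝ k fun x : Amb n => x i :=
  (EuclideanSpace.proj (𝕜 := ℝ) i).contDiff

theorem contDiff_localize {ρ : ℝ → ℝ} {B : ℝ} (hρ : IsCutoff ρ B) (ε₁ ε₂ : ℝ) {φ : Amb n → ℝ}
    (hφ : ContDiff ℝ 1 φ) : ContDiff ℝ 1 (localize ρ ε₁ ε₂ φ) := by
  have h : ContDiff ℝ 1 ρ := hρ.contDiff.of_le (by exact_mod_cast le_top)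
  exact ((h.comp ((contDiff_coord 0).div_const _)).mul
    (h.comp ((contDiff_coord 1).div_const _))).mul hφ

theorem hasFDerivAt_coord_div (i : Fin (n + 2)) (ε : ℝ) (x : Amb n) :
    HasFDerivAt (fun x : Amb n => x i / ε) (ε⁻¹ • (EuclideanSpace.proj (𝕜 := ℝ) i)) x := by
  have h := ((EuclideanSpace.proj i : Amb n →L[ℝ] ℝ).hasFDerivAt (x := x)).const_smul ε⁻¹
  refine h.congr_of_eventuallyEq (Eventually.of_forall fun y => ?_)
  simp [div_eq_inv_mul]

theorem fderiv_localize {ρ : ℝ → ℝ} {B : ℝ} (hρ : IsCutoff ρ B) (ε₁ ε₂ : ℝ) {φ : Amb n → ℝ}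
    (hφ : ContDiff ℝ 1 φ) (x v : Amb n) :
    fderiv ℝ (localize ρ ε₁ ε₂ φ) x v = ρ (x 0 / ε₁) * ρ (x 1 / ε₂) * fderiv ℝ φ x v +
      φ x * (ρ (x 0 / ε₁) * (deriv ρ (x 1 / ε₂) * (v 1 / ε₂)) +
        ρ (x 1 / ε₂) * (deriv ρ (x 0 / ε₁) * (v 0 / ε₁))) := by
  have hd : ∀ y, HasDerivAt ρ (deriv ρ y) y := fun y =>
    (hρ.contDiff.differentiable (by simp) y).hasDerivAt
  have h1 : HasFDerivAt (fun x : Amb n => ρ (x 0 / ε₁)) _ x :=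
    (hd _).comp_hasFDerivAt x (hasFDerivAt_coord_div 0 ε₁ x)
  have h2 : HasFDerivAt (fun x : Amb n => ρ (x 1 / ε₂)) _ x :=
    (hd _).comp_hasFDerivAt x (hasFDerivAt_coord_div 1 ε₂ x)
  have h3 : HasFDerivAt φ (fderiv ℝ φ x) x := (hφ.differentiable (by norm_num) x).hasFDerivAt
  have h4 := ((h1.mul h2).mul h3).fderiv
  have h5 : localize ρ ε₁ ε₂ φ = fun x => ρ (x 0 / ε₁) * ρ (x 1 / ε₂) * φ x := rfl
  rw [h5]
  have h6 := congrArg (fun L : Amb n →L[ℝ] ℝ => L v) h4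
  refine h6.trans ?_
  simp
  ring

/-- On the support of the cutoffs the frozen coefficients ε₁ and ε₁ε₂ are at most 2 and 4 times the
true coefficients x₁ and x₁x₂. -/
theorem norm_diag_gradient_le {ε₁ ε₂ : ℝ} (h1 : 0 < ε₁) (h2 : 0 < ε₂) {x : Amb n}
    (hx1 : ε₁ ≤ 2 * x 0) (hx2 : ε₂ ≤ 2 * x 1) (g : Amb n) :
    ‖diagMap (cellScale ε₁ ε₂) g‖ ≤ 4 * ‖cornerGrad x g‖ := by
  have hx0 : 0 < x 0 := by linarith
  have hx1' : 0 < x 1 := by linarith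
  have h4 : 4 * ‖cornerGrad x g‖ = ‖(4 : ℝ) • cornerGrad x g‖ := by
    rw [norm_smul]; norm_num
  rw [h4, EuclideanSpace.norm_eq, EuclideanSpace.norm_eq]
  refine Real.sqrt_le_sqrt (Finset.sum_le_sum fun i _ => ?_)
  rw [Real.norm_eq_abs, Real.norm_eq_abs, sq_abs, sq_abs, diagMap_apply, mul_pow,
    PiLp.smul_apply, smul_eq_mul, mul_pow]
  simp only [cornerGrad, cellScale]
  split_ifs with hi hi'
  · rw [mul_pow (x 0), ← mul_assoc]
    have : ε₁ ^ 2 ≤ 4 ^ 2 * x 0 ^ 2 := by nlinarith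
    gcongr
  · rw [mul_pow (x 0 * x 1), ← mul_assoc]
    have h5 : ε₁ * ε₂ ≤ 4 * (x 0 * x 1) := by nlinarith
    have : (ε₁ * ε₂) ^ 2 ≤ 4 ^ 2 * (x 0 * x 1) ^ 2 := by
      rw [← mul_pow]
      exact pow_le_pow_left₀ (by positivity) h5 2
    gcongr
  · have : 0 ≤ (g i) ^ 2 := sq_nonneg _
    nlinarith

/-- The cell scales compensate the cutoff derivatives: ε₁ · ε₁⁻¹ = 1 in the direction x₁ and ε₁ε₂ ·
ε₂⁻¹ = ε₁ ≤ δ in the direction x₂, whence B + Bδ. The 4 comes from `norm_diag_gradient_le`. -/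
theorem norm_fderiv_localize_le {ρ : ℝ → ℝ} {B : ℝ} (hρ : IsCutoff ρ B) {ε₁ ε₂ δ : ℝ}
    (h1 : 0 < ε₁) (h2 : 0 < ε₂) (h1δ : ε₁ ≤ δ) {φ : Amb n → ℝ} (hφ : ContDiff ℝ 1 φ) (x : Amb n) :
    ‖(fderiv ℝ (localize ρ ε₁ ε₂ φ) x).comp (diagMap (cellScale ε₁ ε₂))‖ ≤
      (B + B * δ + 4) * (|φ x| + ‖cornerGrad x (gradient φ x)‖) := by
  have hB := hρ.bound_nonneg
  have hδ : 0 < δ := h1.trans_le h1δ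
  refine ContinuousLinearMap.opNorm_le_bound _ (by positivity) fun v => ?_
  rw [ContinuousLinearMap.comp_apply, fderiv_localize hρ ε₁ ε₂ hφ, diagMap_apply, diagMap_apply]
  have e0 : cellScale ε₁ ε₂ (0 : Fin (n + 2)) = ε₁ := by simp [cellScale]
  have e1 : cellScale ε₁ ε₂ (1 : Fin (n + 2)) = ε₁ * ε₂ := by simp [cellScale]
  rw [e0, e1]
  have e2 : ε₁ * ε₂ * v 1 / ε₂ = ε₁ * v 1 := by field_simp
  have e3 : ε₁ * v 0 / ε₁ = v 0 := by field_simp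
  rw [e2, e3]
  by_cases hz : ρ (x 0 / ε₁) = 0 ∨ ρ (x 1 / ε₂) = 0
  · have : ρ (x 0 / ε₁) * ρ (x 1 / ε₂) * (fderiv ℝ φ x) (diagMap (cellScale ε₁ ε₂) v) +
        φ x * (ρ (x 0 / ε₁) * (deriv ρ (x 1 / ε₂) * (ε₁ * v 1)) +
        ρ (x 1 / ε₂) * (deriv ρ (x 0 / ε₁) * v 0)) = 0 := by
      rcases hz with hz | hz
      · rw [hρ.deriv_eq_zero hz, hz]; ring
      · rw [hρ.deriv_eq_zero hz, hz]; ring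
    rw [this, norm_zero]
    positivity
  push Not at hz
  have hx1 : ε₁ ≤ 2 * x 0 := by
    have := (hρ.mem_of_ne hz.1).1
    rw [lt_div_iff₀ h1] at this; linarith
  have hx2 : ε₂ ≤ 2 * x 1 := by
    have := (hρ.mem_of_ne hz.2).1
    rw [lt_div_iff₀ h2] at this; linarith
  have hv : ∀ i, |v i| ≤ ‖v‖ := fun i => by simpa using PiLp.norm_apply_le v i
  have t1 : |fderiv ℝ φ x (diagMap (cellScale ε₁ ε₂) v)| ≤
      4 * ‖cornerGrad x (gradient φ x)‖ * ‖v‖ := by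
    have e : fderiv ℝ φ x (diagMap (cellScale ε₁ ε₂) v) =
        inner ℝ (diagMap (cellScale ε₁ ε₂) (gradient φ x)) v := by
      rw [← inner_gradient, PiLp.inner_apply, PiLp.inner_apply]
      refine Finset.sum_congr rfl fun i _ => ?_
      simp only [diagMap_apply, RCLike.inner_apply, conj_trivial]
      ring
    rw [e]
    exact (abs_real_inner_le_norm _ _).trans
      (mul_le_mul_of_nonneg_right (norm_diag_gradient_le h1 h2 hx1 hx2 _) (norm_nonneg _))
  have ha0 := hρ.nonneg (x 0 / ε₁)
  have ha1 := hρ.le_one (x 0 / ε₁)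
  have hb0 := hρ.nonneg (x 1 / ε₂)
  have hb1 := hρ.le_one (x 1 / ε₂)
  have hab : ρ (x 0 / ε₁) * ρ (x 1 / ε₂) ≤ 1 := mul_le_one₀ ha1 hb0 hb1
  have t2 : |ρ (x 0 / ε₁) * (deriv ρ (x 1 / ε₂) * (ε₁ * v 1))| ≤ B * δ * ‖v‖ := by
    rw [abs_mul, abs_mul, abs_mul, abs_of_nonneg ha0, abs_of_pos h1]
    calc _ ≤ 1 * (B * (δ * ‖v‖)) := by
          gcongr
          · exact hρ.deriv_le _
          · exact hv 1
      _ = _ := by ring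
  have t3 : |ρ (x 1 / ε₂) * (deriv ρ (x 0 / ε₁) * v 0)| ≤ B * ‖v‖ := by
    rw [abs_mul, abs_mul, abs_of_nonneg hb0]
    calc _ ≤ 1 * (B * ‖v‖) := by
          gcongr
          · exact hρ.deriv_le _
          · exact hv 0
      _ = _ := by ring
  rw [Real.norm_eq_abs]
  refine (abs_add_le _ _).trans ?_
  rw [abs_mul, abs_mul (φ x), abs_of_nonneg (mul_nonneg ha0 hb0)]
  have t4 := (abs_add_le (ρ (x 0 / ε₁) * (deriv ρ (x 1 / ε₂) * (ε₁ * v 1)))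
    (ρ (x 1 / ε₂) * (deriv ρ (x 0 / ε₁) * v 0))).trans (add_le_add t2 t3)
  calc _ ≤ 1 * (4 * ‖cornerGrad x (gradient φ x)‖ * ‖v‖) +
        |φ x| * (B * δ * ‖v‖ + B * ‖v‖) := by gcongr
    _ ≤ _ := by
      have := norm_nonneg (cornerGrad x (gradient φ x))
      have := norm_nonneg v
      have := abs_nonneg (φ x)
      have a1 : 0 ≤ (B + B * δ) * (‖cornerGrad x (gradient φ x)‖ * ‖v‖) := by positivity
      have a2 : 0 ≤ 4 * (|φ x| * ‖v‖) := by positivity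
      linarith

theorem fderiv_localize_eq_zero {ρ : ℝ → ℝ} {B : ℝ} (hρ : IsCutoff ρ B) (ε₁ ε₂ : ℝ) {φ : Amb n → ℝ}
    (hφ : ContDiff ℝ 1 φ) (x : Amb n) (hz : ρ (x 0 / ε₁) = 0 ∨ ρ (x 1 / ε₂) = 0) :
    fderiv ℝ (localize ρ ε₁ ε₂ φ) x = 0 := by
  ext v
  rw [fderiv_localize hρ ε₁ ε₂ hφ]
  rcases hz with hz | hz
  · rw [hρ.deriv_eq_zero hz, hz]; simp
  · rw [hρ.deriv_eq_zero hz, hz]; simp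

/-- The density of `x₁ dσ` with respect to Lebesgue measure. -/
def wt (x : Amb n) : ℝ≥0∞ := ENNReal.ofReal (1 / (x 0 * x 1))

theorem measurable_wt : Measurable (wt : Amb n → ℝ≥0∞) := by
  have h : ∀ i, Measurable fun x : Amb n => x i := fun i =>
    (contDiff_coord (k := 0) i).continuous.measurable
  exact ENNReal.measurable_ofReal.comp (measurable_const.div ((h 0).mul (h 1)))

/-- On the support x₁x₂ ≤ (5/2)² ε₁ε₂, and 25/4 ≤ 7. This is how the factor ε₁ε₂ enters the cell
estimates. -/
theorem one_le_wt {ρ : ℝ → ℝ} {B : ℝ} (hρ : IsCutoff ρ B) {ε₁ ε₂ : ℝ} (h1 : 0 < ε₁) (h2 : 0 < ε₂)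
    {x : Amb n} (hz1 : ρ (x 0 / ε₁) ≠ 0) (hz2 : ρ (x 1 / ε₂) ≠ 0) :
    1 ≤ ENNReal.ofReal (7 * (ε₁ * ε₂)) * wt x := by
  have a1 := (hρ.mem_of_ne hz1)
  have a2 := (hρ.mem_of_ne hz2)
  rw [lt_div_iff₀ h1, div_lt_iff₀ h1] at a1
  rw [lt_div_iff₀ h2, div_lt_iff₀ h2] at a2
  have hx0 : 0 < x 0 := by linarith [a1.1]
  have hx1 : 0 < x 1 := by linarith [a2.1]
  rw [wt, ← ENNReal.ofReal_mul (by positivity), ← ENNReal.ofReal_one]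
  refine ENNReal.ofReal_le_ofReal ?_
  rw [mul_one_div, le_div_iff₀ (by positivity), one_mul]
  have : x 0 * x 1 ≤ (5 / 2 * ε₁) * (5 / 2 * ε₂) := by
    apply mul_le_mul a1.2.le a2.2.le hx1.le (by positivity)
  nlinarith [mul_pos h1 h2]

/-- `∫ |φ|^p x₁ dσ`. -/
def massP (p : ℝ) (φ : Amb n → ℝ) : ℝ≥0∞ := ∫⁻ x, ‖φ x‖ₑ ^ p * wt x

/-- `∫ |∇_𝕄 φ|^p x₁ dσ`. -/
def gradP (p : ℝ) (φ : Amb n → ℝ) : ℝ≥0∞ := ∫⁻ x, ‖cornerGrad x (gradient φ x)‖ₑ ^ p * wt x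

theorem continuous_cornerGrad_gradient {φ : Amb n → ℝ} (hφ : ContDiff ℝ 1 φ) :
    Continuous fun x => cornerGrad x (gradient φ x) := by
  have hg : Continuous (gradient φ) :=
    (InnerProductSpace.toDual ℝ (Amb n)).symm.continuous.comp (hφ.continuous_fderiv (by norm_num))
  have h : ∀ i, Continuous fun x : Amb n => x i := fun i => (contDiff_coord (k := 0) i).continuous
  refine (PiLp.continuous_toLp 2 _).comp (continuous_pi fun i => ?_)
  refine Continuous.mul ?_ ((h i).comp hg)
  split_ifs
  · exact h 0
  · exact (h 0).mul (h 1)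
  · exact continuous_const

theorem lintegral_localize_le {ρ : ℝ → ℝ} {B : ℝ} (hρ : IsCutoff ρ B) {ε₁ ε₂ : ℝ}
    (h1 : 0 < ε₁) (h2 : 0 < ε₂) (φ : Amb n → ℝ) {p : ℝ} (hp : 0 < p) :
    ∫⁻ x, ‖localize ρ ε₁ ε₂ φ x‖ₑ ^ p ≤ ENNReal.ofReal (7 * (ε₁ * ε₂)) * massP p φ := by
  rw [massP, ← lintegral_const_mul' _ _ ENNReal.ofReal_ne_top]
  refine lintegral_mono fun x => ?_
  by_cases hz : ρ (x 0 / ε₁) = 0 ∨ ρ (x 1 / ε₂) = 0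
  · have : localize ρ ε₁ ε₂ φ x = 0 := by rcases hz with hz | hz <;> simp [localize, hz]
    simp [this, hp]
  push Not at hz
  have h3 := one_le_wt hρ h1 h2 hz.1 hz.2
  have h4 : ‖localize ρ ε₁ ε₂ φ x‖ₑ ≤ ‖φ x‖ₑ := by
    rw [← ofReal_norm, ← ofReal_norm]
    refine ENNReal.ofReal_le_ofReal ?_
    rw [localize, norm_mul, Real.norm_of_nonneg (mul_nonneg (hρ.nonneg _) (hρ.nonneg _))]
    exact mul_le_of_le_one_left (norm_nonneg _)
      (mul_le_one₀ (hρ.le_one _) (hρ.nonneg _) (hρ.le_one _))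
  calc _ ≤ ‖φ x‖ₑ ^ p * 1 := by rw [mul_one]; gcongr
    _ ≤ ‖φ x‖ₑ ^ p * (ENNReal.ofReal (7 * (ε₁ * ε₂)) * wt x) := by gcongr
    _ = _ := by ring

/-- The constant in the gradient estimate for localized functions. -/
def gradConst (B δ p : ℝ) : ℝ≥0∞ := ENNReal.ofReal (B + B * δ + 4) ^ p * 2 ^ (p - 1)

theorem gradConst_ne_top {B δ p : ℝ} (hp : 1 ≤ p) : gradConst B δ p ≠ ⊤ :=
  ENNReal.mul_ne_top (ENNReal.rpow_ne_top_of_nonneg (by linarith) ENNReal.ofReal_ne_top)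
    (ENNReal.rpow_ne_top_of_nonneg (by linarith) (by norm_num))

theorem lintegral_fderiv_localize_le {ρ : ℝ → ℝ} {B : ℝ} (hρ : IsCutoff ρ B) {ε₁ ε₂ δ : ℝ}
    (h1 : 0 < ε₁) (h2 : 0 < ε₂) (h1δ : ε₁ ≤ δ) {φ : Amb n → ℝ} (hφ : ContDiff ℝ 1 φ) {p : ℝ}
    (hp : 1 ≤ p) :
    ∫⁻ x, ‖(fderiv ℝ (localize ρ ε₁ ε₂ φ) x).comp (diagMap (cellScale ε₁ ε₂))‖ₑ ^ p ≤
      gradConst B δ p * ENNReal.ofReal (7 * (ε₁ * ε₂)) * (massP p φ + gradP p φ) := by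
  have hp0 : 0 < p := by linarith
  have hB := hρ.bound_nonneg
  have hδ : 0 < δ := h1.trans_le h1δ
  have hm : Measurable fun x => ‖φ x‖ₑ ^ p * wt x :=
    (hφ.continuous.measurable.enorm.pow_const _).mul measurable_wt
  rw [massP, gradP, ← lintegral_add_left hm, ← lintegral_const_mul' _ _
    (ENNReal.mul_ne_top (gradConst_ne_top hp) ENNReal.ofReal_ne_top)]
  refine lintegral_mono fun x => ?_
  by_cases hz : ρ (x 0 / ε₁) = 0 ∨ ρ (x 1 / ε₂) = 0
  · rw [fderiv_localize_eq_zero hρ ε₁ ε₂ hφ x hz, ContinuousLinearMap.zero_comp, ← ofReal_norm, norm_zero,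
      ENNReal.ofReal_zero, ENNReal.zero_rpow_of_pos hp0]
    exact zero_le
  push Not at hz
  have h3 := one_le_wt hρ h1 h2 hz.1 hz.2
  have h4 : ‖(fderiv ℝ (localize ρ ε₁ ε₂ φ) x).comp (diagMap (cellScale ε₁ ε₂))‖ₑ ≤
      ENNReal.ofReal (B + B * δ + 4) * (‖φ x‖ₑ + ‖cornerGrad x (gradient φ x)‖ₑ) := by
    rw [← ofReal_norm, ← ofReal_norm, ← ofReal_norm,
      ← ENNReal.ofReal_add (norm_nonneg _) (norm_nonneg _), ← ENNReal.ofReal_mul (by positivity)]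
    exact ENNReal.ofReal_le_ofReal (norm_fderiv_localize_le hρ h1 h2 h1δ hφ x)
  calc _ ≤ (ENNReal.ofReal (B + B * δ + 4) * (‖φ x‖ₑ + ‖cornerGrad x (gradient φ x)‖ₑ)) ^ p * 1 := by
        rw [mul_one]; gcongr
    _ ≤ (ENNReal.ofReal (B + B * δ + 4) ^ p *
          (2 ^ (p - 1) * (‖φ x‖ₑ ^ p + ‖cornerGrad x (gradient φ x)‖ₑ ^ p))) *
          (ENNReal.ofReal (7 * (ε₁ * ε₂)) * wt x) := by
        rw [ENNReal.mul_rpow_of_nonneg _ _ hp0.le]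
        gcongr
        exact ENNReal.rpow_add_le_mul_rpow_add_rpow _ _ hp
    _ = _ := by rw [gradConst]; ring

end StretchedCorner

end

/-! ### Poincaré's inequality and the dyadic cell estimates. -/

noncomputable section

namespace StretchedCorner

open Filter Topology

open scoped ENNReal NNReal

variable {n : ℕ} {X : Set (EuclideanSpace ℝ (Fin n))} {δ p q : ℝ}

theorem IsTest.contDiff_one {Ω : Set (Amb n)} {φ : Amb n → ℝ} (h : IsTest Ω φ) : ContDiff ℝ 1 φ :=
  h.1.of_le (by exact_mod_cast le_top)

theorem IsTest.mem_of_ne {Ω : Set (Amb n)} {φ : Amb n → ℝ} (h : IsTest Ω φ) {x : Amb n}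
    (hx : φ x ≠ 0) : x ∈ Ω := h.2.2 (subset_tsupport φ hx)

theorem norm_sq_eq (x : Amb n) : ‖x‖ ^ 2 = x 0 ^ 2 + (x 1 ^ 2 + ‖base x‖ ^ 2) := by
  rw [EuclideanSpace.real_norm_sq_eq, EuclideanSpace.real_norm_sq_eq, Fin.sum_univ_succ,
    Fin.sum_univ_succ]
  rfl

theorem exists_norm_le_of_mem_corner (hX : Bornology.IsBounded X) (δ : ℝ) :
    ∃ R, ∀ x ∈ corner δ X, ‖x‖ ≤ R := by
  obtain ⟨R, hR⟩ := hX.exists_norm_le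
  refine ⟨|δ| + |δ| + |R|, fun x hx => ?_⟩
  obtain ⟨⟨h1, h2⟩, ⟨h3, h4⟩, h5⟩ := hx
  have h6 := hR _ h5
  have hδ : δ ≤ |δ| := le_abs_self δ
  have hR' : R ≤ |R| := le_abs_self R
  refine abs_le_of_sq_le_sq' ?_ (by positivity) |>.2
  rw [norm_sq_eq]
  have := norm_nonneg (base x)
  have := abs_nonneg δ
  have := abs_nonneg R
  have a1 : x 0 ^ 2 ≤ |δ| ^ 2 := by nlinarith
  have a2 : x 1 ^ 2 ≤ |δ| ^ 2 := by nlinarith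
  have a3 : ‖base x‖ ^ 2 ≤ |R| ^ 2 := by nlinarith
  nlinarith [mul_nonneg (abs_nonneg δ) (abs_nonneg R), mul_nonneg (abs_nonneg δ) (abs_nonneg δ)]

/-- Poincaré's inequality on the stretched corner. -/
theorem exists_massP_le (hn : 0 < n) (hX : Bornology.IsBounded X) (δ : ℝ) (hp : 1 ≤ p) :
    ∃ C : ℝ≥0∞, C ≠ ⊤ ∧ ∀ φ : Amb n → ℝ, IsTest (corner δ X) φ →
      massP p φ ≤ C * gradP p φ := by
  obtain ⟨R, hR⟩ := hX.exists_norm_le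
  set j : Fin (n + 2) := (⟨0, hn⟩ : Fin n).succ.succ with hj
  have hj0 : j ≠ 0 := Fin.succ_ne_zero _
  have hj1 : j ≠ 1 := by
    rw [← Fin.succ_zero_eq_one]
    exact fun h => Fin.succ_ne_zero _ (Fin.succ_injective _ h)
  -- A shift longer than the width of X in one x'-coordinate moves the support off itself; the
  -- weight depends on x₁ and x₂ only and is unchanged.
  set c : ℝ := 2 * |R| + 1 with hc
  have hc0 : 0 < c := by positivity
  set h : Amb n := EuclideanSpace.single j c with hh
  refine ⟨ENNReal.ofReal c ^ p, ENNReal.rpow_ne_top_of_nonneg (by linarith) ENNReal.ofReal_ne_top,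
    fun φ hφ => ?_⟩
  have h1 := Rellich.lintegral_poincare (μ := (volume : Measure (Amb n))) hφ.contDiff_one h hp
    (w := wt) measurable_wt (fun t x => by simp [wt, hh, hj0.symm, hj1.symm]) (fun x hx => by
      by_contra h0
      have h2 := hR _ (hφ.mem_of_ne hx).2.2
      have h3 := hR _ (hφ.mem_of_ne h0).2.2
      have h4 := (PiLp.norm_apply_le (base x) ⟨0, hn⟩).trans h2
      have h5 := (PiLp.norm_apply_le (base (x + h)) ⟨0, hn⟩).trans h3
      have e : base (x + h) ⟨0, hn⟩ = base x ⟨0, hn⟩ + c := by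
        simp [base, hh, hj]
      rw [e, Real.norm_eq_abs, abs_le] at h5
      rw [Real.norm_eq_abs, abs_le] at h4
      have := le_abs_self R
      linarith [h4.1, h5.2])
  refine h1.trans ?_
  rw [gradP, ← lintegral_const_mul' _ _ (ENNReal.rpow_ne_top_of_nonneg (by linarith)
    ENNReal.ofReal_ne_top)]
  refine lintegral_mono fun x => ?_
  rw [← mul_assoc, ← ENNReal.mul_rpow_of_nonneg _ _ (by linarith)]
  gcongr
  rw [← ofReal_norm, ← ofReal_norm, ← ENNReal.ofReal_mul hc0.le]
  refine ENNReal.ofReal_le_ofReal ?_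
  rw [← inner_gradient, hh, EuclideanSpace.inner_single_right, norm_mul, Real.norm_of_nonneg hc0.le]
  gcongr
  have e : gradient φ x j = cornerGrad x (gradient φ x) j := by simp [cornerGrad, hj0, hj1]
  simp only [conj_trivial]
  rw [e]
  exact PiLp.norm_apply_le _ _

/-- The density of `x₁ (x₁x₂)^p dσ` with respect to Lebesgue measure. -/
def qWt (p : ℝ) (x : Amb n) : ℝ≥0∞ := ENNReal.ofReal ((x 0 * x 1) ^ (p - 1))

/-- `∫ |φ|^q x₁ (x₁x₂)^p dσ`. -/
def massQ (p q : ℝ) (φ : Amb n → ℝ) : ℝ≥0∞ := ∫⁻ x, ‖φ x‖ₑ ^ q * qWt p x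

/-- The dyadic cell with scales `ε₁`, `ε₂`. -/
def cell (ε₁ ε₂ : ℝ) : Set (Amb n) :=
  {x | ε₁ ≤ x 0 ∧ x 0 ≤ 2 * ε₁ ∧ ε₂ ≤ x 1 ∧ x 1 ≤ 2 * ε₂}

theorem measurableSet_cell (ε₁ ε₂ : ℝ) : MeasurableSet (cell ε₁ ε₂ : Set (Amb n)) := by
  have h : ∀ i, Measurable fun x : Amb n => x i := fun i =>
    (contDiff_coord (k := 0) i).continuous.measurable
  exact (measurableSet_le measurable_const (h 0)).inter ((measurableSet_le (h 0)
    measurable_const).inter ((measurableSet_le measurable_const (h 1)).inter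
    (measurableSet_le (h 1) measurable_const)))

theorem setLIntegral_cell_le {ρ : ℝ → ℝ} {B : ℝ} (hρ : IsCutoff ρ B) {ε₁ ε₂ : ℝ}
    (h1 : 0 < ε₁) (h2 : 0 < ε₂) (hp : 1 ≤ p) (φ : Amb n → ℝ) :
    ∫⁻ x in cell ε₁ ε₂, ‖φ x‖ₑ ^ q * qWt p x ≤
      ENNReal.ofReal ((4 * (ε₁ * ε₂)) ^ (p - 1)) * ∫⁻ x, ‖localize ρ ε₁ ε₂ φ x‖ₑ ^ q := by
  rw [← lintegral_const_mul' _ _ ENNReal.ofReal_ne_top]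
  refine le_trans ?_ (setLIntegral_le_lintegral (cell ε₁ ε₂) _)
  refine setLIntegral_mono' (measurableSet_cell _ _) fun x hx => ?_
  obtain ⟨a1, a2, a3, a4⟩ := hx
  have e1 : ρ (x 0 / ε₁) = 1 := hρ.eq_one (by rwa [le_div_iff₀ h1, one_mul])
    (by rwa [div_le_iff₀ h1])
  have e2 : ρ (x 1 / ε₂) = 1 := hρ.eq_one (by rwa [le_div_iff₀ h2, one_mul])
    (by rwa [div_le_iff₀ h2])
  have e : localize ρ ε₁ ε₂ φ x = φ x := by simp [localize, e1, e2]
  rw [e, mul_comm]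
  gcongr
  refine ENNReal.ofReal_le_ofReal (Real.rpow_le_rpow ?_ ?_ (by linarith))
  · exact mul_nonneg (by linarith) (by linarith)
  · nlinarith

theorem hasCompactSupport_localize (ρ : ℝ → ℝ) (ε₁ ε₂ : ℝ) {φ : Amb n → ℝ}
    (hφ : HasCompactSupport φ) : HasCompactSupport (localize ρ ε₁ ε₂ φ) :=
  HasCompactSupport.mono hφ fun _ hx => right_ne_zero_of_mul hx

/-- The two estimates for the contribution of a cell: one with the optimal dependence on the
scales, the other one compact. -/
theorem exists_cell_estimates (hp : 1 ≤ p) (hpN : p < (n : ℝ) + 2) (hpq : p < q)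
    (hq : q < ((n : ℝ) + 2) * p / ((n : ℝ) + 2 - p)) {ρ : ℝ → ℝ} {B : ℝ} (hρ : IsCutoff ρ B)
    (δ : ℝ) :
    ∃ K : ℝ≥0∞, ∃ θ : ℝ, K ≠ ⊤ ∧ 0 < 1 - θ ∧ 0 < q / p - (1 - θ) ∧ ∀ ε₁ ε₂ : ℝ, 0 < ε₁ → 0 < ε₂ →
      ε₁ ≤ δ →
      (∀ φ : Amb n → ℝ, ContDiff ℝ 1 φ → HasCompactSupport φ →
        ∫⁻ x in cell ε₁ ε₂, ‖φ x‖ₑ ^ q * qWt p x ≤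
          K * ENNReal.ofReal (ε₁ ^ (p + 1 - q / p) * ε₂ ^ p) *
            (massP p φ + gradP p φ) ^ (q / p)) ∧
      ∃ K' : ℝ≥0∞, K' ≠ ⊤ ∧ ∀ φ : Amb n → ℝ, ContDiff ℝ 1 φ → HasCompactSupport φ →
        ∫⁻ x in cell ε₁ ε₂, ‖φ x‖ₑ ^ q * qWt p x ≤
          K' * (∫⁻ x, ‖localize ρ ε₁ ε₂ φ x‖ₑ ^ p) ^ (1 - θ) *
            (massP p φ + gradP p φ) ^ (q / p - (1 - θ)) := by
  have hp0 : 0 < p := by linarith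
  obtain ⟨K, θ, hK, hθ0, hθ1, hβ, hS⟩ := sobolev_interpolated (n := n) hp hpN hpq hq
  set β := q / p - (1 - θ) with hβdef
  have hθ : 0 < 1 - θ := by linarith
  set Γ := gradConst B δ p with hΓ
  have hΓt : Γ ≠ ⊤ := gradConst_ne_top hp
  have main : ∀ ε₁ ε₂ : ℝ, 0 < ε₁ → 0 < ε₂ → ε₁ ≤ δ → ∀ φ : Amb n → ℝ, ContDiff ℝ 1 φ →
      HasCompactSupport φ → ∫⁻ x in cell ε₁ ε₂, ‖φ x‖ₑ ^ q * qWt p x ≤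
        (ENNReal.ofReal ((4 * (ε₁ * ε₂)) ^ (p - 1)) *
          (K * ENNReal.ofReal (ε₁ * (ε₁ * ε₂)) ^ (1 - q / p)) *
          (Γ ^ β * ENNReal.ofReal (7 * (ε₁ * ε₂)) ^ β)) *
          (∫⁻ x, ‖localize ρ ε₁ ε₂ φ x‖ₑ ^ p) ^ (1 - θ) *
            (massP p φ + gradP p φ) ^ β := by
    intro ε₁ ε₂ h1 h2 h1δ φ hφ hφc
    have hψ := contDiff_localize hρ ε₁ ε₂ hφ
    have hψc := hasCompactSupport_localize ρ ε₁ ε₂ hφc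
    have s1 := hS (localize ρ ε₁ ε₂ φ) (cellScale ε₁ ε₂) hψ hψc (cellScale_pos h1 h2)
    rw [prod_cellScale] at s1
    have s2 := lintegral_fderiv_localize_le hρ h1 h2 h1δ hφ hp
    refine (setLIntegral_cell_le hρ h1 h2 hp φ).trans ?_
    calc _ ≤ ENNReal.ofReal ((4 * (ε₁ * ε₂)) ^ (p - 1)) *
          (K * ENNReal.ofReal (ε₁ * (ε₁ * ε₂)) ^ (1 - q / p) *
            ((∫⁻ x, ‖localize ρ ε₁ ε₂ φ x‖ₑ ^ p) ^ (1 - θ) *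
              (Γ * ENNReal.ofReal (7 * (ε₁ * ε₂)) * (massP p φ + gradP p φ)) ^ β)) := by
          refine mul_le_mul_right (s1.trans ?_) _
          gcongr
      _ = _ := by
          rw [ENNReal.mul_rpow_of_nonneg _ _ hβ.le, ENNReal.mul_rpow_of_nonneg _ _ hβ.le]
          ring
  refine ⟨ENNReal.ofReal (4 ^ (p - 1) * 7 ^ (q / p)) * (K * Γ ^ β), θ,
    ENNReal.mul_ne_top ENNReal.ofReal_ne_top (ENNReal.mul_ne_top hK
      (ENNReal.rpow_ne_top_of_nonneg hβ.le hΓt)), hθ, hβ, fun ε₁ ε₂ h1 h2 h1δ => ⟨?_, ?_⟩⟩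
  · intro φ hφ hφc
    refine (main ε₁ ε₂ h1 h2 h1δ φ hφ hφc).trans ?_
    have h7 : 0 < 7 * (ε₁ * ε₂) := by positivity
    have hN : (∫⁻ x, ‖localize ρ ε₁ ε₂ φ x‖ₑ ^ p) ≤
        ENNReal.ofReal (7 * (ε₁ * ε₂)) * (massP p φ + gradP p φ) :=
      (lintegral_localize_le hρ h1 h2 φ hp0).trans (mul_le_mul_right le_self_add _)
    set T := massP p φ + gradP p φ
    have hT : T ^ (1 - θ) * T ^ β = T ^ (q / p) := by
      rw [← ENNReal.rpow_add_of_nonneg _ _ hθ.le hβ.le, hβdef]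
      congr 1; ring
    -- Exponent count: (p-1) + 2(1-q/p) + q/p = p + 1 - q/p for ε₁ and (p-1) + (1-q/p) + q/p = p for
    -- ε₂.
    have hreal : (4 * (ε₁ * ε₂)) ^ (p - 1) * (ε₁ * (ε₁ * ε₂)) ^ (1 - q / p) *
        (7 * (ε₁ * ε₂)) ^ β * (7 * (ε₁ * ε₂)) ^ (1 - θ) =
        4 ^ (p - 1) * 7 ^ (q / p) * (ε₁ ^ (p + 1 - q / p) * ε₂ ^ p) := by
      have e1 : (7 * (ε₁ * ε₂)) ^ β * (7 * (ε₁ * ε₂)) ^ (1 - θ) = (7 * (ε₁ * ε₂)) ^ (q / p) := by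
        rw [← Real.rpow_add h7, hβdef]; congr 1; ring
      rw [mul_assoc _ ((7 * (ε₁ * ε₂)) ^ β), e1, Real.mul_rpow (by norm_num) (by positivity),
        Real.mul_rpow (by norm_num : (0 : ℝ) ≤ 7) (by positivity),
        Real.mul_rpow h1.le (by positivity : 0 ≤ ε₁ * ε₂), Real.mul_rpow h1.le h2.le,
        Real.mul_rpow h1.le h2.le, Real.mul_rpow h1.le h2.le]
      have e2 : ε₁ ^ (p + 1 - q / p) = ε₁ ^ (p - 1) * (ε₁ ^ (1 - q / p) * ε₁ ^ (1 - q / p)) *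
          ε₁ ^ (q / p) := by
        rw [← Real.rpow_add h1, ← Real.rpow_add h1, ← Real.rpow_add h1]; congr 1; ring
      have e3 : ε₂ ^ p = ε₂ ^ (p - 1) * ε₂ ^ (1 - q / p) * ε₂ ^ (q / p) := by
        rw [← Real.rpow_add h2, ← Real.rpow_add h2]; congr 1; ring
      rw [e2, e3]; ring
    calc _ ≤ (ENNReal.ofReal ((4 * (ε₁ * ε₂)) ^ (p - 1)) *
          (K * ENNReal.ofReal (ε₁ * (ε₁ * ε₂)) ^ (1 - q / p)) *
          (Γ ^ β * ENNReal.ofReal (7 * (ε₁ * ε₂)) ^ β)) *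
          (ENNReal.ofReal (7 * (ε₁ * ε₂)) * T) ^ (1 - θ) * T ^ β := by gcongr
      _ = ENNReal.ofReal ((4 * (ε₁ * ε₂)) ^ (p - 1)) *
          ENNReal.ofReal (ε₁ * (ε₁ * ε₂)) ^ (1 - q / p) * ENNReal.ofReal (7 * (ε₁ * ε₂)) ^ β *
          ENNReal.ofReal (7 * (ε₁ * ε₂)) ^ (1 - θ) * (K * Γ ^ β) * (T ^ (1 - θ) * T ^ β) := by
          rw [ENNReal.mul_rpow_of_nonneg _ _ hθ.le]; ring
      _ = _ := by
          rw [hT, ENNReal.ofReal_rpow_of_pos (by positivity), ENNReal.ofReal_rpow_of_pos h7,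
            ENNReal.ofReal_rpow_of_pos h7, ← ENNReal.ofReal_mul (by positivity),
            ← ENNReal.ofReal_mul (by positivity), ← ENNReal.ofReal_mul (by positivity), hreal,
            ENNReal.ofReal_mul (by positivity)]
          ring
  -- Here the constant may depend on the cell. What counts is the positive power 1 - θ of the
  -- localized L^p norm, which Rellich's theorem makes small.
  · refine ⟨_, ?_, fun φ hφ hφc => main ε₁ ε₂ h1 h2 h1δ φ hφ hφc⟩
    rw [ENNReal.ofReal_rpow_of_pos (by positivity)]
    exact ENNReal.mul_ne_top (ENNReal.mul_ne_top ENNReal.ofReal_ne_top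
      (ENNReal.mul_ne_top hK ENNReal.ofReal_ne_top)) (ENNReal.mul_ne_top
      (ENNReal.rpow_ne_top_of_nonneg hβ.le hΓt)
      (ENNReal.rpow_ne_top_of_nonneg hβ.le ENNReal.ofReal_ne_top))

/-- The dyadic scales below `δ`. -/
def dyadic (δ : ℝ) (k : ℕ) : ℝ := δ / 2 * (1 / 2) ^ k

theorem dyadic_pos (hδ : 0 < δ) (k : ℕ) : 0 < dyadic δ k := by unfold dyadic; positivity

theorem dyadic_le (hδ : 0 < δ) (k : ℕ) : dyadic δ k ≤ δ := by
  have : ((1 : ℝ) / 2) ^ k ≤ 1 := pow_le_one₀ (by norm_num) (by norm_num)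
  unfold dyadic
  nlinarith

theorem exists_dyadic (hδ : 0 < δ) {y : ℝ} (h0 : 0 < y) (h1 : y < δ) :
    ∃ k, dyadic δ k ≤ y ∧ y ≤ 2 * dyadic δ k := by
  obtain ⟨k, hk1, hk2⟩ := exists_nat_pow_near_of_lt_one (x := y / δ) (y := 1 / 2) (by positivity)
    ((div_le_one hδ).mpr h1.le) (by norm_num) (by norm_num)
  refine ⟨k, ?_, ?_⟩
  · rw [lt_div_iff₀ hδ, pow_succ] at hk1
    unfold dyadic
    linarith
  · rw [div_le_iff₀ hδ] at hk2
    unfold dyadic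
    linarith

theorem massQ_le_tsum (hδ : 0 < δ) (hq : 0 < q) {φ : Amb n → ℝ} (hφ : IsTest (corner δ X) φ) :
    massQ p q φ ≤ ∑' k : ℕ × ℕ, ∫⁻ x in cell (dyadic δ k.1) (dyadic δ k.2),
      ‖φ x‖ₑ ^ q * qWt p x := by
  refine le_trans ?_ (lintegral_iUnion_le _ _)
  rw [massQ, ← lintegral_indicator (MeasurableSet.iUnion fun k : ℕ × ℕ => measurableSet_cell _ _)]
  refine lintegral_mono fun x => ?_
  by_cases hx : φ x = 0
  · simp [hx, hq]
  · have hxM := hφ.mem_of_ne hx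
    obtain ⟨k, hk1, hk2⟩ := exists_dyadic hδ hxM.1.1 hxM.1.2
    obtain ⟨l, hl1, hl2⟩ := exists_dyadic hδ hxM.2.1.1 hxM.2.1.2
    have hmem : x ∈ ⋃ k : ℕ × ℕ, cell (dyadic δ k.1) (dyadic δ k.2) :=
      Set.mem_iUnion.mpr ⟨(k, l), hk1, hk2, hl1, hl2⟩
    rw [Set.indicator_of_mem hmem]

theorem tsum_dyadic_ne_top {s t : ℝ} (hδ : 0 < δ) (hs : 0 < s) (ht : 0 < t) :
    ∑' k : ℕ × ℕ, ENNReal.ofReal (dyadic δ k.1 ^ s * dyadic δ k.2 ^ t) ≠ ⊤ := by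
  have hd : ∀ s : ℝ, 0 < s → Summable fun k => dyadic δ k ^ s := by
    intro s hs
    have e : ∀ k, dyadic δ k ^ s = (δ / 2) ^ s * (((1 : ℝ) / 2) ^ s) ^ k := by
      intro k
      rw [dyadic, Real.mul_rpow (by positivity) (by positivity), ← Real.rpow_natCast,
        ← Real.rpow_natCast, ← Real.rpow_mul (by norm_num), ← Real.rpow_mul (by norm_num),
        mul_comm s]
    simp_rw [e]
    exact (summable_geometric_of_lt_one (by positivity)
      (Real.rpow_lt_one (by norm_num) (by norm_num) hs)).mul_left _
  have h := (hd s hs).mul_of_nonneg (hd t ht)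
    (fun k => Real.rpow_nonneg (dyadic_pos hδ k).le _)
    (fun k => Real.rpow_nonneg (dyadic_pos hδ k).le _)
  exact h.tsum_ofReal_ne_top

end StretchedCorner

end

/-! ### The weighted Sobolev inequality and its compactness. -/

noncomputable section

namespace StretchedCorner

open Filter Topology

open scoped ENNReal NNReal

variable {n : ℕ} {X : Set (EuclideanSpace ℝ (Fin n))} {δ p q : ℝ}

/-- The space `C_0^∞(Ω)`. -/
def testSpace (Ω : Set (Amb n)) : Submodule ℝ (Amb n → ℝ) where
  carrier := {φ | IsTest Ω φ}
  zero_mem' := ⟨contDiff_const, HasCompactSupport.zero, by simp [tsupport]⟩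
  add_mem' := fun {φ ψ} hφ hψ => ⟨hφ.1.add hψ.1, hφ.2.1.add hψ.2.1,
    (tsupport_add φ ψ).trans (Set.union_subset hφ.2.2 hψ.2.2)⟩
  smul_mem' := fun c φ hφ => ⟨contDiff_const.smul hφ.1, hφ.2.1.smul_left,
    (tsupport_smul_subset_right (fun _ => c) φ).trans hφ.2.2⟩

theorem IsTest.sub {Ω : Set (Amb n)} {φ ψ : Amb n → ℝ} (hφ : IsTest Ω φ) (hψ : IsTest Ω ψ) :
    IsTest Ω (fun x => φ x - ψ x) :=
  (testSpace Ω).sub_mem hφ hψ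

theorem gradient_sub_apply {φ ψ : Amb n → ℝ} (hφ : ContDiff ℝ 1 φ) (hψ : ContDiff ℝ 1 ψ)
    (x : Amb n) : gradient (fun x => φ x - ψ x) x = gradient φ x - gradient ψ x := by
  simp only [gradient]
  rw [fderiv_fun_sub (hφ.differentiable (by norm_num) x) (hψ.differentiable (by norm_num) x),
    map_sub]

theorem cornerGrad_sub (x g h : Amb n) : cornerGrad x (g - h) = cornerGrad x g - cornerGrad x h := by
  ext i
  simp [cornerGrad, mul_sub]

theorem gradP_sub_le (hp : 1 ≤ p) {φ ψ : Amb n → ℝ} (hφ : ContDiff ℝ 1 φ) (hψ : ContDiff ℝ 1 ψ) :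
    gradP p (fun x => φ x - ψ x) ≤ 2 ^ (p - 1) * (gradP p φ + gradP p ψ) := by
  have hm : Measurable fun x => ‖cornerGrad x (gradient φ x)‖ₑ ^ p * wt x :=
    ((continuous_cornerGrad_gradient hφ).measurable.enorm.pow_const _).mul measurable_wt
  rw [gradP, gradP, gradP, ← lintegral_add_left hm, ← lintegral_const_mul' _ _
    (ENNReal.rpow_ne_top_of_nonneg (by linarith) (by norm_num))]
  refine lintegral_mono fun x => ?_
  rw [gradient_sub_apply hφ hψ, cornerGrad_sub, ← add_mul, ← mul_assoc]
  gcongr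
  refine le_trans ?_ (ENNReal.rpow_add_le_mul_rpow_add_rpow _ _ hp)
  gcongr
  exact enorm_sub_le

/-- The weighted Sobolev inequality on the stretched corner. -/
theorem exists_massQ_le (hδ : 0 < δ) (hX : Bornology.IsBounded X) (hn : 0 < n) (hp : 1 ≤ p)
    (hpN : p < (n : ℝ) + 2) (hpq : p < q) (hq : q < ((n : ℝ) + 2) * p / ((n : ℝ) + 2 - p))
    (hqp : q < p * (p + 1)) :
    ∃ C : ℝ≥0∞, C ≠ ⊤ ∧ ∀ φ : Amb n → ℝ, IsTest (corner δ X) φ →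
      massQ p q φ ≤ C * gradP p φ ^ (q / p) := by
  have hp0 : 0 < p := by linarith
  have hqp0 : 0 < q / p := div_pos (hp0.trans hpq) hp0
  -- This is where q < p(p+1) is needed: it makes the sum over the scales ε₁ converge.
  have hs : 0 < p + 1 - q / p := by
    rw [sub_pos, div_lt_iff₀ hp0]; linarith
  obtain ⟨ρ, B, hρ⟩ := exists_isCutoff
  obtain ⟨K, θ, hK, -, -, h⟩ := exists_cell_estimates (n := n) hp hpN hpq hq hρ δ
  obtain ⟨P, hP, hPoin⟩ := exists_massP_le hn hX δ hp
  refine ⟨(∑' k : ℕ × ℕ, ENNReal.ofReal (dyadic δ k.1 ^ (p + 1 - q / p) * dyadic δ k.2 ^ p)) *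
    (K * (P + 1) ^ (q / p)), ?_, fun φ hφ => ?_⟩
  · exact ENNReal.mul_ne_top (tsum_dyadic_ne_top hδ hs hp0) (ENNReal.mul_ne_top hK
      (ENNReal.rpow_ne_top_of_nonneg hqp0.le (ENNReal.add_ne_top.mpr ⟨hP, ENNReal.one_ne_top⟩)))
  · refine (massQ_le_tsum hδ (hp0.trans hpq) hφ).trans ?_
    rw [mul_assoc, ← ENNReal.tsum_mul_right]
    refine ENNReal.tsum_le_tsum fun k => ?_
    refine ((h _ _ (dyadic_pos hδ k.1) (dyadic_pos hδ k.2) (dyadic_le hδ k.1)).1 φ hφ.contDiff_one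
      hφ.2.1).trans ?_
    have hT : massP p φ + gradP p φ ≤ (P + 1) * gradP p φ := by
      rw [add_mul, one_mul]
      gcongr
      exact hPoin φ hφ
    calc _ ≤ K * ENNReal.ofReal (dyadic δ k.1 ^ (p + 1 - q / p) * dyadic δ k.2 ^ p) *
          ((P + 1) * gradP p φ) ^ (q / p) := by gcongr
      _ = _ := by rw [ENNReal.mul_rpow_of_nonneg _ _ hqp0.le]; ring

/-- Passes from the rescaled to the ordinary gradient. The loss depends on the cell, which is
harmless as only finitely many cells are treated this way. -/
theorem enorm_fderiv_le_comp_diagMap {a : Fin (n + 2) → ℝ} (ha : ∀ i, 0 < a i)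
    (L : Amb n →L[ℝ] ℝ) : ‖L‖ₑ ≤ ‖L.comp (diagMap a)‖ₑ * ‖diagMap (n := n) fun i => (a i)⁻¹‖ₑ := by
  have e : L = (L.comp (diagMap a)).comp (diagMap fun i => (a i)⁻¹) := by
    ext v
    rw [ContinuousLinearMap.comp_apply, ContinuousLinearMap.comp_apply]
    congr 1
    ext i
    simp [(ha i).ne']
  rw [← ofReal_norm, ← ofReal_norm, ← ofReal_norm, ← ENNReal.ofReal_mul (norm_nonneg _)]
  refine ENNReal.ofReal_le_ofReal ?_
  conv_lhs => rw [e]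
  exact ContinuousLinearMap.opNorm_comp_le _ _

/-- The tail is controlled by the majorant, uniformly in c, and the finitely many remaining terms
share the other ε/2. -/
theorem exists_finset_tsum_le {ι : Type*} {g : ι → ℝ≥0∞} (hg : ∑' k, g k ≠ ⊤) {ε : ℝ≥0∞}
    (hε : 0 < ε) : ∃ (S : Finset ι) (ε' : ℝ≥0∞), 0 < ε' ∧ ∀ c : ι → ℝ≥0∞, (∀ k, c k ≤ g k) →
      (∀ k ∈ S, c k ≤ ε') → ∑' k, c k ≤ ε := by
  have hε2 : 0 < ε / 2 := ENNReal.half_pos hε.ne'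
  obtain ⟨S, hS⟩ := ((ENNReal.tendsto_tsum_compl_atTop_zero hg).eventually
    (ge_mem_nhds hε2)).exists
  refine ⟨S, ε / 2 / (S.card + 1), ENNReal.div_pos hε2.ne'
    (ENNReal.add_ne_top.mpr ⟨ENNReal.natCast_ne_top _, ENNReal.one_ne_top⟩), fun c hcg hcS => ?_⟩
  calc ∑' k, c k = ∑ k ∈ S, c k + ∑' k : { k // k ∉ S }, c k := by
        rw [← Summable.tsum_add_tsum_compl (s := (S : Set ι)) ENNReal.summable ENNReal.summable,
          Finset.tsum_subtype']
        rfl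
    _ ≤ ∑ _k ∈ S, ε / 2 / (S.card + 1) + ∑' k : { k // k ∉ S }, g k :=
        add_le_add (Finset.sum_le_sum fun k hk => hcS k hk) (ENNReal.tsum_le_tsum fun k => hcg k)
    _ ≤ ε / 2 + ε / 2 := by
        refine add_le_add ?_ hS
        rw [Finset.sum_const, nsmul_eq_mul]
        refine ENNReal.mul_le_of_le_div' ?_
        gcongr
        exact le_self_add
    _ = ε := ENNReal.add_halves ε

/-- The averages which detect compactness: the first pair of indices is the cell, the second one
the radius and the centre. -/
def cellAverage (ρ : ℝ → ℝ) (δ : ℝ) (D : ℕ → Amb n) (ν : ℕ → Measure (Amb n))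
    (j : (ℕ × ℕ) × (ℕ × ℕ)) (φ : Amb n → ℝ) : ℝ :=
  ∫ z, localize ρ (dyadic δ j.1.1) (dyadic δ j.1.2) φ (D j.2.2 + z) ∂ν j.2.1

/-- A function of bounded energy with finitely many small averages is small in `L^q`. -/
theorem massQ_le_of_averages (hδ : 0 < δ) (hX : Bornology.IsBounded X) (hn : 0 < n) (hp : 1 ≤ p)
    (hpN : p < (n : ℝ) + 2) (hpq : p < q) (hq : q < ((n : ℝ) + 2) * p / ((n : ℝ) + 2 - p))
    (hqp : q < p * (p + 1)) {ρ : ℝ → ℝ} {B : ℝ} (hρ : IsCutoff ρ B)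
    {D : ℕ → Amb n} (hD : DenseRange D) {ν : ℕ → Measure (Amb n)}
    [∀ m, IsProbabilityMeasure (ν m)] (hν : ∀ m : ℕ, ∀ᵐ z ∂ν m, ‖z‖ ≤ 1 / ((m : ℝ) + 1))
    (hνc : ∀ m, ∃ c : ℝ≥0∞, c ≠ ⊤ ∧ ν m ≤ c • volume) {C : ℝ≥0∞} (hC : C ≠ ⊤) {ε : ℝ≥0∞}
    (hε : 0 < ε) :
    ∃ (t : Finset ((ℕ × ℕ) × (ℕ × ℕ))) (η : ℝ), 0 < η ∧ ∀ φ : Amb n → ℝ, IsTest (corner δ X) φ →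
      gradP p φ ≤ C → (∀ j ∈ t, |cellAverage ρ δ D ν j φ| ≤ η) → massQ p q φ ≤ ε := by
  have hp0 : 0 < p := by linarith
  have hqp0 : 0 < q / p := div_pos (hp0.trans hpq) hp0
  have hs : 0 < p + 1 - q / p := by
    rw [sub_pos, div_lt_iff₀ hp0]; linarith
  obtain ⟨K, θ, hK, hθ, hβ, h⟩ := exists_cell_estimates (n := n) hp hpN hpq hq hρ δ
  obtain ⟨P, hP, hPoin⟩ := exists_massP_le hn hX δ hp
  obtain ⟨R, hR⟩ := exists_norm_le_of_mem_corner hX δ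
  set T := (P + 1) * C with hTdef
  have hTt : T ≠ ⊤ := ENNReal.mul_ne_top (ENNReal.add_ne_top.mpr ⟨hP, ENNReal.one_ne_top⟩) hC
  have hT : ∀ φ : Amb n → ℝ, IsTest (corner δ X) φ → gradP p φ ≤ C →
      massP p φ + gradP p φ ≤ T := by
    intro φ hφ hC
    rw [hTdef, add_mul, one_mul]
    gcongr
    exact (hPoin φ hφ).trans (by gcongr)
  -- On a single cell, Rellich's theorem makes the localized L^p norm small, and the compact cell
  -- estimate transfers this to the L^q contribution.
  have hcell : ∀ (k : ℕ × ℕ) {ε' : ℝ≥0∞}, 0 < ε' →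
      ∃ (t : Finset ((ℕ × ℕ) × (ℕ × ℕ))) (η : ℝ), 0 < η ∧ ∀ φ : Amb n → ℝ,
        IsTest (corner δ X) φ → gradP p φ ≤ C → (∀ j ∈ t, |cellAverage ρ δ D ν j φ| ≤ η) →
        ∫⁻ x in cell (dyadic δ k.1) (dyadic δ k.2), ‖φ x‖ₑ ^ q * qWt p x ≤ ε' := by
    intro k ε' hε'
    have d1 := dyadic_pos hδ k.1
    have d2 := dyadic_pos hδ k.2
    obtain ⟨K', hK', hcomp⟩ := (h _ _ d1 d2 (dyadic_le hδ k.1)).2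
    set β := q / p - (1 - θ)
    obtain ⟨s, hs0, hs'⟩ := Rellich.exists_mul_rpow_le (K := K' * T ^ β)
      (ENNReal.mul_ne_top hK' (ENNReal.rpow_ne_top_of_nonneg hβ.le hTt)) hε' hθ
    set A := ‖diagMap (n := n) fun i => (cellScale (dyadic δ k.1) (dyadic δ k.2) i)⁻¹‖ₑ
    have hAt : A ^ p ≠ ⊤ := ENNReal.rpow_ne_top_of_nonneg hp0.le (by
      rw [show A = _ from (ofReal_norm _).symm]; exact ENNReal.ofReal_ne_top)
    set G := gradConst B δ p * ENNReal.ofReal (7 * (dyadic δ k.1 * dyadic δ k.2)) * T with hG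
    obtain ⟨m, t, η, hη, hrel⟩ := Rellich.lintegral_le_of_averages (volume : Measure (Amb n)) hD hν
      hνc hp R (C := G * A ^ p) (ENNReal.mul_ne_top (ENNReal.mul_ne_top (ENNReal.mul_ne_top
        (gradConst_ne_top hp) ENNReal.ofReal_ne_top) hTt) hAt) (ε := ENNReal.ofReal s)
      (ENNReal.ofReal_pos.mpr hs0)
    refine ⟨t.image fun i => (k, (m, i)), η, hη, fun φ hφ hφC havg => ?_⟩
    have hψ := contDiff_localize hρ (dyadic δ k.1) (dyadic δ k.2) hφ.contDiff_one
    have hN := hrel _ hψ (fun x hx => hR x (hφ.mem_of_ne (right_ne_zero_of_mul hx))) (by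
      calc _ ≤ ∫⁻ x, ‖(fderiv ℝ (localize ρ (dyadic δ k.1) (dyadic δ k.2) φ) x).comp
              (diagMap (cellScale (dyadic δ k.1) (dyadic δ k.2)))‖ₑ ^ p * A ^ p := by
            refine lintegral_mono fun x => ?_
            rw [← ENNReal.mul_rpow_of_nonneg _ _ hp0.le]
            gcongr
            exact enorm_fderiv_le_comp_diagMap (cellScale_pos d1 d2) _
        _ = (∫⁻ x, ‖(fderiv ℝ (localize ρ (dyadic δ k.1) (dyadic δ k.2) φ) x).comp
              (diagMap (cellScale (dyadic δ k.1) (dyadic δ k.2)))‖ₑ ^ p) * A ^ p :=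
            lintegral_mul_const' _ _ hAt
        _ ≤ _ := by
            gcongr
            refine (lintegral_fderiv_localize_le hρ d1 d2 (dyadic_le hδ k.1) hφ.contDiff_one
              hp).trans ?_
            rw [hG]
            gcongr
            exact hT φ hφ hφC) (fun i hi => havg (k, (m, i)) (Finset.mem_image_of_mem _ hi))
    refine (hcomp φ hφ.contDiff_one hφ.2.1).trans (le_trans ?_ (hs' s le_rfl))
    calc _ ≤ K' * ENNReal.ofReal s ^ (1 - θ) * T ^ β := by
          gcongr
          exact hT φ hφ hφC
      _ = _ := by ring
  have hfin : ∀ (S : Finset (ℕ × ℕ)) {ε' : ℝ≥0∞}, 0 < ε' →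
      ∃ (t : Finset ((ℕ × ℕ) × (ℕ × ℕ))) (η : ℝ), 0 < η ∧ ∀ φ : Amb n → ℝ,
        IsTest (corner δ X) φ → gradP p φ ≤ C → (∀ j ∈ t, |cellAverage ρ δ D ν j φ| ≤ η) →
        ∀ k ∈ S, ∫⁻ x in cell (dyadic δ k.1) (dyadic δ k.2), ‖φ x‖ₑ ^ q * qWt p x ≤ ε' := by
    intro S ε' hε'
    induction S using Finset.induction_on with
    | empty => exact ⟨∅, 1, one_pos, by simp⟩
    | insert k S _ ih =>
      obtain ⟨t₁, η₁, hη₁, H₁⟩ := ih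
      obtain ⟨t₂, η₂, hη₂, H₂⟩ := hcell k hε'
      refine ⟨t₁ ∪ t₂, min η₁ η₂, lt_min hη₁ hη₂, fun φ hφ hφC havg l hl => ?_⟩
      rcases Finset.mem_insert.mp hl with rfl | hl
      · exact H₂ φ hφ hφC (fun j hj => (havg j (Finset.mem_union_right _ hj)).trans
          (min_le_right _ _))
      · exact H₁ φ hφ hφC (fun j hj => (havg j (Finset.mem_union_left _ hj)).trans
          (min_le_left _ _)) l hl
  set g : ℕ × ℕ → ℝ≥0∞ := fun k => K * ENNReal.ofReal
    (dyadic δ k.1 ^ (p + 1 - q / p) * dyadic δ k.2 ^ p) * T ^ (q / p) with hg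
  have hgsum : ∑' k, g k ≠ ⊤ := by
    rw [hg, ENNReal.tsum_mul_right, ENNReal.tsum_mul_left]
    exact ENNReal.mul_ne_top (ENNReal.mul_ne_top hK (tsum_dyadic_ne_top hδ hs hp0))
      (ENNReal.rpow_ne_top_of_nonneg hqp0.le hTt)
  -- The scale-optimal cell estimate provides a summable majorant depending only on the energy
  -- bound.
  obtain ⟨S, ε', hε', hS⟩ := exists_finset_tsum_le hgsum hε
  obtain ⟨t, η, hη, H⟩ := hfin S hε'
  refine ⟨t, η, hη, fun φ hφ hφC havg => (massQ_le_tsum hδ (hp0.trans hpq) hφ).trans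
    (hS _ (fun k => ?_) (H φ hφ hφC havg))⟩
  refine ((h _ _ (dyadic_pos hδ k.1) (dyadic_pos hδ k.2) (dyadic_le hδ k.1)).1 φ hφ.contDiff_one
    hφ.2.1).trans ?_
  refine mul_le_mul_right ?_ _
  exact ENNReal.rpow_le_rpow (hT φ hφ hφC) hqp0.le

theorem localize_sub (ρ : ℝ → ℝ) (ε₁ ε₂ : ℝ) (φ ψ : Amb n → ℝ) (x : Amb n) :
    localize ρ ε₁ ε₂ (fun x => φ x - ψ x) x = localize ρ ε₁ ε₂ φ x - localize ρ ε₁ ε₂ ψ x := by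
  simp only [localize]; ring

/-- Compactness of the embedding, for sequences of test functions. -/
theorem exists_subseq_cauchy (hδ : 0 < δ) (hX : Bornology.IsBounded X) (hn : 0 < n) (hp : 1 ≤ p)
    (hpN : p < (n : ℝ) + 2) (hpq : p < q) (hq : q < ((n : ℝ) + 2) * p / ((n : ℝ) + 2 - p))
    (hqp : q < p * (p + 1)) {φ : ℕ → Amb n → ℝ} (hφ : ∀ k, IsTest (corner δ X) (φ k))
    {C : ℝ≥0∞} (hC : C ≠ ⊤) (hφC : ∀ k, gradP p (φ k) ≤ C) :
    ∃ σ : ℕ → ℕ, StrictMono σ ∧ ∀ ε : ℝ≥0∞, 0 < ε → ∃ K, ∀ i ≥ K, ∀ j ≥ K,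
      massQ p q (fun x => φ (σ i) x - φ (σ j) x) ≤ ε := by
  have hp0 : 0 < p := by linarith
  obtain ⟨ρ, B, hρ⟩ := exists_isCutoff
  obtain ⟨D, hD⟩ := TopologicalSpace.exists_dense_seq (Amb n)
  choose ν hν1 hν2 hν3 using fun m : ℕ => Rellich.exists_uniform (volume : Measure (Amb n))
    (1 / ((m : ℝ) + 1)) (by positivity)
  obtain ⟨P, hP, hPoin⟩ := exists_massP_le hn hX δ hp
  have hcont : ∀ k (j : (ℕ × ℕ) × (ℕ × ℕ)),
      Continuous (localize ρ (dyadic δ j.1.1) (dyadic δ j.1.2) (φ k)) := fun k j =>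
    (contDiff_localize hρ _ _ (hφ k).contDiff_one).continuous
  have hInt : ∀ k (j : (ℕ × ℕ) × (ℕ × ℕ)), Integrable
      (fun z => localize ρ (dyadic δ j.1.1) (dyadic δ j.1.2) (φ k) (D j.2.2 + z)) (ν j.2.1) := by
    intro k j
    obtain ⟨b, hb⟩ := (hcont k j).bounded_above_of_compact_support
      (hasCompactSupport_localize ρ _ _ (hφ k).2.1)
    exact Integrable.of_bound ((hcont k j).comp (continuous_const.add
      continuous_id)).aestronglyMeasurable b (Eventually.of_forall fun z => hb _)
  have hbd : ∀ j, ∃ b : ℝ, ∀ k, |cellAverage ρ δ D ν j (φ k)| ≤ b := by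
    intro j
    obtain ⟨c, hc, hcν⟩ := hν3 j.2.1
    set b : ℝ≥0∞ := c * (ENNReal.ofReal (7 * (dyadic δ j.1.1 * dyadic δ j.1.2)) * (P * C)) with hb
    have hbt : b ≠ ⊤ := ENNReal.mul_ne_top hc (ENNReal.mul_ne_top ENNReal.ofReal_ne_top
      (ENNReal.mul_ne_top hP hC))
    refine ⟨(b ^ (1 / p)).toReal, fun k => ?_⟩
    have h1 := Rellich.enorm_average_le (hcont k j) hp hcν (D j.2.2)
    have h2 : ‖cellAverage ρ δ D ν j (φ k)‖ₑ ^ p ≤ b := by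
      refine h1.trans ?_
      rw [hb]
      gcongr
      refine (lintegral_localize_le hρ (dyadic_pos hδ _) (dyadic_pos hδ _) (φ k) hp0).trans ?_
      gcongr
      exact (hPoin _ (hφ k)).trans (by gcongr; exact hφC k)
    have h3 : ‖cellAverage ρ δ D ν j (φ k)‖ₑ ≤ b ^ (1 / p) := by
      rwa [one_div, ENNReal.le_rpow_inv_iff hp0]
    rw [← Real.norm_eq_abs, ← toReal_enorm]
    exact ENNReal.toReal_mono (ENNReal.rpow_ne_top_of_nonneg (by positivity) hbt) h3
  choose b hb using hbd
  -- Compactness of a countable product of intervals takes the place of a diagonal argument: one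
  -- subsequence makes all averages converge.
  have hK : IsCompact (Set.univ.pi fun j => Set.Icc (-b j) (b j)) :=
    isCompact_univ_pi fun j => isCompact_Icc
  obtain ⟨l, -, σ, hσ, hl⟩ := hK.tendsto_subseq
    (x := fun k j => cellAverage ρ δ D ν j (φ k)) (fun k j _ => abs_le.mp (hb j k))
  refine ⟨σ, hσ, fun ε hε => ?_⟩
  obtain ⟨t, η, hη, H⟩ := massQ_le_of_averages hδ hX hn hp hpN hpq hq hqp hρ hD hν2 hν3
    (C := 2 ^ (p - 1) * (C + C)) (ENNReal.mul_ne_top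
      (ENNReal.rpow_ne_top_of_nonneg (by linarith) (by norm_num))
      (ENNReal.add_ne_top.mpr ⟨hC, hC⟩)) hε
  have hev : ∀ᶠ i in atTop, ∀ j ∈ t, |cellAverage ρ δ D ν j (φ (σ i)) - l j| < η / 2 := by
    rw [Filter.eventually_all_finset]
    intro j _
    have h1 := (tendsto_pi_nhds.mp hl j)
    exact (Metric.tendsto_nhds.mp h1 (η / 2) (by positivity))
  obtain ⟨K, hK⟩ := eventually_atTop.mp hev
  refine ⟨K, fun i hi j hj => H _ ((hφ _).sub (hφ _)) ?_ fun a ha => ?_⟩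
  · refine (gradP_sub_le hp (hφ _).contDiff_one (hφ _).contDiff_one).trans ?_
    gcongr
    · exact hφC _
    · exact hφC _
  · have e : cellAverage ρ δ D ν a (fun x => φ (σ i) x - φ (σ j) x) =
        cellAverage ρ δ D ν a (φ (σ i)) - cellAverage ρ δ D ν a (φ (σ j)) := by
      simp only [cellAverage, localize_sub]
      exact integral_sub (hInt _ a) (hInt _ a)
    rw [e]
    have h1 := abs_lt.mp (hK i hi a ha)
    have h2 := abs_lt.mp (hK j hj a ha)
    rw [abs_le]
    constructor <;> linarith

end StretchedCorner

end

/-! ### The measure σ and the weights of the function spaces. -/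

noncomputable section

namespace StretchedCorner

open Filter Topology

open scoped ENNReal NNReal

variable {n : ℕ} {X : Set (EuclideanSpace ℝ (Fin n))} {δ p q : ℝ}

theorem continuous_coord (i : Fin (n + 2)) : Continuous fun x : Amb n => x i :=
  (contDiff_coord (k := 0) i).continuous

theorem isOpen_corner (hX : IsOpen X) (δ : ℝ) : IsOpen (corner δ X) := by
  have hb : Continuous (base : Amb n → _) :=
    (PiLp.continuous_toLp 2 _).comp (continuous_pi fun i => continuous_coord i.succ.succ)
  exact (isOpen_Ioo.preimage (continuous_coord 0)).inter
    ((isOpen_Ioo.preimage (continuous_coord 1)).inter (hX.preimage hb))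

/-- The density of `dσ`. -/
def sigmaDensity (x : Amb n) : ℝ≥0∞ := ENNReal.ofReal (1 / (x 0 * (x 0 * x 1)))

theorem measurable_sigmaDensity : Measurable (sigmaDensity : Amb n → ℝ≥0∞) := by
  have h : ∀ i, Measurable fun x : Amb n => x i := fun i => (continuous_coord i).measurable
  exact ENNReal.measurable_ofReal.comp (measurable_const.div ((h 0).mul ((h 0).mul (h 1))))

theorem sigma_eq (δ : ℝ) (X : Set (EuclideanSpace ℝ (Fin n))) :
    sigma δ X = (volume.restrict (corner δ X)).withDensity sigmaDensity := rfl

theorem sigma_absolutelyContinuous : sigma δ X ≪ volume.restrict (corner δ X) :=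
  withDensity_absolutelyContinuous _ _

theorem absolutelyContinuous_sigma (hX : IsOpen X) :
    volume.restrict (corner δ X) ≪ sigma δ X := by
  refine withDensity_absolutelyContinuous' measurable_sigmaDensity.aemeasurable ?_
  filter_upwards [ae_restrict_mem (isOpen_corner hX δ).measurableSet] with x hx
  obtain ⟨⟨h1, -⟩, ⟨h2, -⟩, -⟩ := hx
  have : 0 < 1 / (x 0 * (x 0 * x 1)) := by positivity
  simpa [sigmaDensity] using this

theorem ae_mem_corner (hX : IsOpen X) : ∀ᵐ x ∂sigma δ X, x ∈ corner δ X :=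
  sigma_absolutelyContinuous.ae_le (ae_restrict_mem (isOpen_corner hX δ).measurableSet)

/-- The density 1/(x₁²x₂) is at least δ⁻³ on the corner; this gives the embedding of L^p(σ) into L¹.
-/
theorem restrict_le_sigma (hX : IsOpen X) :
    volume.restrict (corner δ X) ≤ ENNReal.ofReal (δ * (δ * δ)) • sigma δ X := by
  rw [Measure.le_iff]
  intro s hs
  rw [Measure.smul_apply, sigma_eq, withDensity_apply _ hs, smul_eq_mul,
    ← lintegral_const_mul _ measurable_sigmaDensity, ← setLIntegral_one]
  refine setLIntegral_mono_ae (measurable_sigmaDensity.const_mul _).aemeasurable ?_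
  filter_upwards [ae_restrict_mem (isOpen_corner hX δ).measurableSet] with x hx _
  obtain ⟨⟨h1, h1'⟩, ⟨h2, h2'⟩, -⟩ := hx
  have hδ : 0 < δ := h1.trans h1'
  rw [sigmaDensity, ← ENNReal.ofReal_mul (by positivity), ← ENNReal.ofReal_one]
  refine ENNReal.ofReal_le_ofReal ?_
  rw [mul_one_div, le_div_iff₀ (by positivity), one_mul]
  gcongr

/-- The weight of `L_p` for the exponents of the Dirichlet problem. -/
def pW (p : ℝ) (x : Amb n) : ℝ := weight p (((n : ℝ) + 2 - 1) / p) (((n : ℝ) + 2) / p) x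

/-- For the exponents of the problem the x₂-weight disappears, and the space is L^p with respect to
x₁ dσ. -/
theorem pW_eq (p : ℝ) (x : Amb n) : pW p x = x 0 ^ (1 / p) := by
  have h1 : ((n : ℝ) + 2) / p - ((n : ℝ) + 2 - 1) / p = 1 / p := by ring
  rw [pW, weight, h1, sub_self, Real.rpow_zero, mul_one]

/-- The weight of the space `L^q` on the right-hand side. -/
def qW (p q : ℝ) (x : Amb n) : ℝ := (x 0 * (x 0 * x 1) ^ p) ^ (1 / q)

theorem pW_pos {x : Amb n} (hx : x ∈ corner δ X) : 0 < pW p x := by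
  rw [pW_eq]; exact Real.rpow_pos_of_pos hx.1.1 _

theorem qW_pos {x : Amb n} (hx : x ∈ corner δ X) : 0 < qW p q x :=
  Real.rpow_pos_of_pos (mul_pos hx.1.1 (Real.rpow_pos_of_pos (mul_pos hx.1.1 hx.2.1.1) _)) _

theorem pW_rpow (hp : 0 < p) {x : Amb n} (hx : x ∈ corner δ X) : pW p x ^ p = x 0 := by
  rw [pW_eq, ← Real.rpow_mul hx.1.1.le, one_div_mul_cancel hp.ne', Real.rpow_one]

theorem qW_rpow (hq : 0 < q) {x : Amb n} (hx : x ∈ corner δ X) :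
    qW p q x ^ q = x 0 * (x 0 * x 1) ^ p := by
  have h : 0 ≤ x 0 * (x 0 * x 1) ^ p :=
    (mul_pos hx.1.1 (Real.rpow_pos_of_pos (mul_pos hx.1.1 hx.2.1.1) _)).le
  rw [qW, ← Real.rpow_mul h, one_div_mul_cancel hq.ne', Real.rpow_one]

theorem measurable_pW : Measurable (pW p : Amb n → ℝ) := by
  have : (pW p : Amb n → ℝ) = fun x => x 0 ^ (1 / p) := funext (pW_eq p)
  rw [this]
  exact (continuous_coord 0).measurable.pow_const _

theorem measurable_qW : Measurable (qW p q : Amb n → ℝ) := by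
  have h : ∀ i, Measurable fun x : Amb n => x i := fun i => (continuous_coord i).measurable
  exact ((h 0).mul (((h 0).mul (h 1)).pow_const _)).pow_const _

theorem continuousOn_pW : ContinuousOn (pW p : Amb n → ℝ) (corner δ X) := by
  have : (pW p : Amb n → ℝ) = fun x => x 0 ^ (1 / p) := funext (pW_eq p)
  rw [this]
  exact (continuous_coord 0).continuousOn.rpow_const fun x hx => Or.inl hx.1.1.ne'

theorem lintegral_sigma (f : Amb n → ℝ≥0∞) (hf : Measurable f) :
    ∫⁻ x, f x ∂sigma δ X = ∫⁻ x in corner δ X, f x * sigmaDensity x := by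
  rw [sigma_eq, lintegral_withDensity_eq_lintegral_mul _ measurable_sigmaDensity hf]
  refine lintegral_congr fun x => ?_
  rw [Pi.mul_apply, mul_comm]

theorem setLIntegral_corner_eq (hX : IsOpen X) {f g : Amb n → ℝ≥0∞}
    (h : ∀ x ∈ corner δ X, f x = g x) (hg : ∀ x ∉ corner δ X, g x = 0) :
    ∫⁻ x in corner δ X, f x = ∫⁻ x, g x := by
  have hM := (isOpen_corner hX δ).measurableSet
  rw [setLIntegral_congr_fun hM h, ← lintegral_indicator hM]
  refine lintegral_congr fun x => ?_
  by_cases hx : x ∈ corner δ X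
  · rw [Set.indicator_of_mem hx]
  · rw [Set.indicator_of_notMem hx, hg x hx]

theorem IsTest.gradient_eq_zero {Ω : Set (Amb n)} {φ : Amb n → ℝ} (_h : IsTest Ω φ) {x : Amb n}
    (hx : x ∉ tsupport φ) : gradient φ x = 0 := by
  have : fderiv ℝ φ x = 0 := by
    by_contra h0
    exact hx (support_fderiv_subset ℝ h0)
  simp [gradient, this]

theorem cornerGrad_zero (x : Amb n) : cornerGrad x 0 = 0 := by
  ext i; simp [cornerGrad]

theorem mul_sigmaDensity {r : ℝ} (hr : 0 < r) {F : Type*} [NormedAddCommGroup F] [NormedSpace ℝ F]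
    {x : Amb n} {w c : ℝ} (hw : 0 ≤ w) (hwc : w ^ r = c) (y : F) :
    ‖w • y‖ₑ ^ r * sigmaDensity x = ‖y‖ₑ ^ r * (ENNReal.ofReal c * sigmaDensity x) := by
  have hw' : ‖w‖ₑ ^ r = ENNReal.ofReal c := by
    rw [← ofReal_norm, Real.norm_of_nonneg hw, ENNReal.ofReal_rpow_of_nonneg hw hr.le, hwc]
  rw [enorm_smul, ENNReal.mul_rpow_of_nonneg _ _ hr.le, hw']
  ring

theorem x0_mul_sigmaDensity {x : Amb n} (hx : x ∈ corner δ X) :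
    ENNReal.ofReal (x 0) * sigmaDensity x = wt x := by
  have h1 := hx.1.1
  have h2 := hx.2.1.1
  rw [sigmaDensity, wt, ← ENNReal.ofReal_mul h1.le]
  congr 1
  field_simp

theorem qW_mul_sigmaDensity {x : Amb n} (hx : x ∈ corner δ X) :
    ENNReal.ofReal (x 0 * (x 0 * x 1) ^ p) * sigmaDensity x = qWt p x := by
  have h1 := hx.1.1
  have h2 := hx.2.1.1
  have h3 : 0 < x 0 * x 1 := mul_pos h1 h2
  rw [sigmaDensity, qWt, ← ENNReal.ofReal_mul (by positivity)]
  congr 1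
  rw [Real.rpow_sub_one h3.ne']
  field_simp

theorem lintegral_grad_sigma (hX : IsOpen X) (hp : 0 < p) {φ : Amb n → ℝ}
    (hφ : IsTest (corner δ X) φ) :
    ∫⁻ x, ‖pW p x • cornerGrad x (gradient φ x)‖ₑ ^ p ∂sigma δ X = gradP p φ := by
  have hm : Measurable fun x => ‖pW p x • cornerGrad x (gradient φ x)‖ₑ ^ p :=
    (measurable_pW.smul (continuous_cornerGrad_gradient hφ.contDiff_one).measurable).enorm.pow_const _
  rw [lintegral_sigma _ hm, gradP]
  refine setLIntegral_corner_eq hX (fun x hx => ?_) fun x hx => ?_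
  · rw [mul_sigmaDensity hp (pW_pos hx).le (pW_rpow hp hx), x0_mul_sigmaDensity hx]
  · rw [hφ.gradient_eq_zero (fun h => hx (hφ.2.2 h)), cornerGrad_zero]
    simp [hp]

theorem lintegral_val_sigma (hX : IsOpen X) (hp : 0 < p) {φ : Amb n → ℝ}
    (hφ : IsTest (corner δ X) φ) :
    ∫⁻ x, ‖pW p x • φ x‖ₑ ^ p ∂sigma δ X = massP p φ := by
  have hm : Measurable fun x => ‖pW p x • φ x‖ₑ ^ p :=
    (measurable_pW.smul hφ.contDiff_one.continuous.measurable).enorm.pow_const _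
  rw [lintegral_sigma _ hm, massP]
  refine setLIntegral_corner_eq hX (fun x hx => ?_) fun x hx => ?_
  · rw [mul_sigmaDensity hp (pW_pos hx).le (pW_rpow hp hx), x0_mul_sigmaDensity hx]
  · have : φ x = 0 := by by_contra h; exact hx (hφ.mem_of_ne h)
    simp [this, hp]

theorem lintegral_qval_sigma (hX : IsOpen X) (hq : 0 < q) {φ : Amb n → ℝ}
    (hφ : IsTest (corner δ X) φ) :
    ∫⁻ x, ‖qW p q x • φ x‖ₑ ^ q ∂sigma δ X = massQ p q φ := by
  have hm : Measurable fun x => ‖qW p q x • φ x‖ₑ ^ q :=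
    (measurable_qW.smul hφ.contDiff_one.continuous.measurable).enorm.pow_const _
  rw [lintegral_sigma _ hm, massQ]
  refine setLIntegral_corner_eq hX (fun x hx => ?_) fun x hx => ?_
  · rw [mul_sigmaDensity hq (qW_pos hx).le (qW_rpow hq hx), qW_mul_sigmaDensity hx]
  · have : φ x = 0 := by by_contra h; exact hx (hφ.mem_of_ne h)
    simp [this, hq]

/-- The energy of a test function is finite. -/
theorem gradP_ne_top (hp : 0 < p) {φ : Amb n → ℝ} (hφ : IsTest (corner δ X) φ) :
    gradP p φ ≠ ⊤ := by
  have hK : IsCompact (tsupport φ) := hφ.2.1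
  have hc1 : ContinuousOn (fun x => ‖cornerGrad x (gradient φ x)‖ ^ p * (1 / (x 0 * x 1)))
      (tsupport φ) := by
    refine ContinuousOn.mul ?_ ?_
    · exact ((continuous_cornerGrad_gradient hφ.contDiff_one).norm.rpow_const
        fun _ => Or.inr hp.le).continuousOn
    · refine continuousOn_const.div ((continuous_coord 0).mul (continuous_coord 1)).continuousOn ?_
      intro x hx
      exact (mul_pos (hφ.2.2 hx).1.1 (hφ.2.2 hx).2.1.1).ne'
  obtain ⟨b, hb⟩ := hK.exists_bound_of_continuousOn hc1
  have hle : gradP p φ ≤ ∫⁻ x, (tsupport φ).indicator (fun _ => ENNReal.ofReal b) x := by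
    refine lintegral_mono fun x => ?_
    by_cases hx : x ∈ tsupport φ
    · rw [Set.indicator_of_mem hx, wt, ← ofReal_norm,
        ENNReal.ofReal_rpow_of_nonneg (norm_nonneg _) hp.le, ← ENNReal.ofReal_mul (by positivity)]
      exact ENNReal.ofReal_le_ofReal ((le_abs_self _).trans (hb x hx))
    · rw [hφ.gradient_eq_zero hx, cornerGrad_zero]
      simp [hp]
  refine ne_top_of_le_ne_top ?_ hle
  rw [lintegral_indicator (isClosed_tsupport φ).measurableSet, setLIntegral_const]
  exact ENNReal.mul_ne_top ENNReal.ofReal_ne_top hK.measure_lt_top.ne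

theorem memLp_of_lintegral {F : Type*} [NormedAddCommGroup F] {f : Amb n → F} {r : ℝ} (hr : 0 < r)
    {μ : Measure (Amb n)} (hf : AEStronglyMeasurable f μ) (h : ∫⁻ x, ‖f x‖ₑ ^ r ∂μ ≠ ⊤) :
    MemLp f (ENNReal.ofReal r) μ := by
  refine ⟨hf, ?_⟩
  rw [LpDuality.eLpNorm_ofReal_eq hr]
  exact ENNReal.rpow_lt_top_of_nonneg (by positivity) h

end StretchedCorner

end

/-! ### Test functions as elements of L^p and L^q. -/

noncomputable section

namespace StretchedCorner

open Filter Topology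

open scoped ENNReal NNReal

variable {n : ℕ} {X : Set (EuclideanSpace ℝ (Fin n))} {δ p q : ℝ}

theorem gradient_add_apply {φ ψ : Amb n → ℝ} (hφ : ContDiff ℝ 1 φ) (hψ : ContDiff ℝ 1 ψ)
    (x : Amb n) : gradient (φ + ψ) x = gradient φ x + gradient ψ x := by
  simp only [gradient]
  rw [fderiv_add (hφ.differentiable (by norm_num) x) (hψ.differentiable (by norm_num) x),
    map_add]

theorem gradient_smul_apply (c : ℝ) {φ : Amb n → ℝ} (hφ : ContDiff ℝ 1 φ)
    (x : Amb n) : gradient (c • φ) x = c • gradient φ x := by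
  simp only [gradient]
  rw [fderiv_const_smul (hφ.differentiable (by norm_num) x)]
  simp

theorem cornerGrad_add (x g h : Amb n) : cornerGrad x (g + h) = cornerGrad x g + cornerGrad x h := by
  ext i
  simp [cornerGrad, mul_add]

theorem cornerGrad_smul (x : Amb n) (c : ℝ) (g : Amb n) :
    cornerGrad x (c • g) = c • cornerGrad x g := by
  ext i
  simp only [cornerGrad, PiLp.smul_apply, smul_eq_mul]
  ring

theorem memLp_grad (hX : IsOpen X) (hp : 0 < p) {φ : Amb n → ℝ} (hφ : IsTest (corner δ X) φ) :
    MemLp (fun x => pW p x • cornerGrad x (gradient φ x)) (ENNReal.ofReal p) (sigma δ X) :=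
  memLp_of_lintegral hp (measurable_pW.smul
    (continuous_cornerGrad_gradient hφ.contDiff_one).measurable).aestronglyMeasurable
    (by rw [lintegral_grad_sigma hX hp hφ]; exact gradP_ne_top hp hφ)

/-- `φ ↦ x₁^{1/p} ∇_𝕄 φ`. -/
def gradLp (hX : IsOpen X) (hp : 0 < p) :
    testSpace (corner δ X) →ₗ[ℝ] Lp (Amb n) (ENNReal.ofReal p) (sigma δ X) where
  toFun φ := (memLp_grad hX hp φ.2).toLp _
  map_add' φ ψ := by
    rw [← MemLp.toLp_add]
    refine MemLp.toLp_congr _ _ (ae_of_all _ fun x => ?_)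
    simp only [Submodule.coe_add, Pi.add_apply]
    rw [gradient_add_apply φ.2.contDiff_one ψ.2.contDiff_one, cornerGrad_add, smul_add]
  map_smul' c φ := by
    rw [RingHom.id_apply, ← MemLp.toLp_const_smul]
    refine MemLp.toLp_congr _ _ (ae_of_all _ fun x => ?_)
    simp only [Submodule.coe_smul, Pi.smul_apply]
    rw [gradient_smul_apply c φ.2.contDiff_one, cornerGrad_smul, smul_comm]

theorem coeFn_gradLp (hX : IsOpen X) (hp : 0 < p) (φ : testSpace (corner δ X)) :
    gradLp hX hp φ =ᵐ[sigma δ X] fun x => pW p x • cornerGrad x (gradient φ.1 x) :=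
  (memLp_grad hX hp φ.2).coeFn_toLp

theorem enorm_gradLp (hX : IsOpen X) (hp : 0 < p) (φ : testSpace (corner δ X)) :
    ‖gradLp hX hp φ‖ₑ = gradP p φ.1 ^ (1 / p) := by
  rw [gradLp, LinearMap.coe_mk, AddHom.coe_mk, Lp.enorm_toLp, LpDuality.eLpNorm_ofReal_eq hp,
    lintegral_grad_sigma hX hp φ.2]

/-- Multiplication of test functions by a weight, with values in `L^r`. -/
def mulLp {r : ℝ} (w : Amb n → ℝ)
    (hw : ∀ φ, IsTest (corner δ X) φ → MemLp (fun x => w x • φ x) (ENNReal.ofReal r) (sigma δ X)) :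
    testSpace (corner δ X) →ₗ[ℝ] Lp ℝ (ENNReal.ofReal r) (sigma δ X) where
  toFun φ := (hw φ φ.2).toLp _
  map_add' φ ψ := by
    rw [← MemLp.toLp_add]
    refine MemLp.toLp_congr _ _ (ae_of_all _ fun x => ?_)
    simp [mul_add]
  map_smul' c φ := by
    rw [RingHom.id_apply, ← MemLp.toLp_const_smul]
    refine MemLp.toLp_congr _ _ (ae_of_all _ fun x => ?_)
    simp only [Submodule.coe_smul, Pi.smul_apply, smul_eq_mul]
    ring

theorem coeFn_mulLp {r : ℝ} {w : Amb n → ℝ}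
    (hw : ∀ φ, IsTest (corner δ X) φ → MemLp (fun x => w x • φ x) (ENNReal.ofReal r) (sigma δ X))
    (φ : testSpace (corner δ X)) : mulLp w hw φ =ᵐ[sigma δ X] fun x => w x • φ.1 x :=
  (hw φ φ.2).coeFn_toLp

theorem enorm_mulLp {r : ℝ} (hr : 0 < r) {w : Amb n → ℝ}
    (hw : ∀ φ, IsTest (corner δ X) φ → MemLp (fun x => w x • φ x) (ENNReal.ofReal r) (sigma δ X))
    (φ : testSpace (corner δ X)) :
    ‖mulLp w hw φ‖ₑ = (∫⁻ x, ‖w x • φ.1 x‖ₑ ^ r ∂sigma δ X) ^ (1 / r) := by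
  rw [mulLp, LinearMap.coe_mk, AddHom.coe_mk, Lp.enorm_toLp, LpDuality.eLpNorm_ofReal_eq hr]

theorem mulLp_injective (hX : IsOpen X) {r : ℝ} {w : Amb n → ℝ}
    (hw : ∀ φ, IsTest (corner δ X) φ → MemLp (fun x => w x • φ x) (ENNReal.ofReal r) (sigma δ X))
    (hpos : ∀ x ∈ corner δ X, 0 < w x) : Function.Injective (mulLp w hw) := by
  rw [injective_iff_map_eq_zero]
  intro φ hφ
  have h0 : ∀ᵐ x ∂sigma δ X, φ.1 x = 0 := by
    filter_upwards [coeFn_mulLp hw φ, Lp.coeFn_zero ℝ (ENNReal.ofReal r) (sigma δ X),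
      ae_mem_corner hX] with x h1 h2 hx
    rw [hφ, h2] at h1
    have := h1.symm
    simpa [(hpos x hx).ne'] using this
  have h1 := (absolutelyContinuous_sigma hX).ae_le h0
  have h2 : Set.EqOn φ.1 (fun _ => 0) (corner δ X) :=
    Measure.eqOn_open_of_ae_eq h1 (isOpen_corner hX δ) φ.2.contDiff_one.continuous.continuousOn
      continuousOn_const
  ext x
  by_cases hx : x ∈ corner δ X
  · exact h2 hx
  · by_contra h
    exact hx (φ.2.mem_of_ne h)

/-- Bump functions equal to 1 at one of m chosen points and 0 at the others are independent by
evaluation. -/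
theorem exists_linearIndependent_testSpace {Ω : Set (Amb n)} (hΩ : IsOpen Ω) (hne : Ω.Nonempty)
    (m : ℕ) : ∃ w : Fin m → testSpace Ω, LinearIndependent ℝ w := by
  classical
  obtain ⟨x₀, hx₀⟩ := hne
  have hinf : Ω.Infinite := infinite_of_mem_nhds x₀ (hΩ.mem_nhds hx₀)
  let y : ℕ → Amb n := fun k => (hinf.natEmbedding Ω k : Amb n)
  have hyΩ : ∀ k, y k ∈ Ω := fun k => (hinf.natEmbedding Ω k).2
  have hy : Function.Injective y :=
    Subtype.val_injective.comp (hinf.natEmbedding Ω).injective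
  have hb : ∀ i : Fin m, ∃ φ : testSpace Ω, φ.1 (y i) = 1 ∧ ∀ j : Fin m, j ≠ i → φ.1 (y j) = 0 := by
    intro i
    let F : Set (Amb n) := (fun j : Fin m => y j) '' {j | j ≠ i}
    have hF : IsOpen (Ω \ F) := hΩ.sdiff ((Set.toFinite _).isClosed)
    have hi : y i ∈ Ω \ F := by
      refine ⟨hyΩ _, ?_⟩
      rintro ⟨j, hj, hji⟩
      exact hj (Fin.ext (hy hji))
    obtain ⟨φ, h1, h2, h3, -, h5⟩ :=
      exists_contDiff_tsupport_subset (n := ⊤) (hF.mem_nhds hi)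
    refine ⟨⟨φ, h3, h2, h1.trans Set.sdiff_subset⟩, h5, fun j hj => ?_⟩
    by_contra h0
    exact (h1 (subset_tsupport φ h0)).2 ⟨j, hj, rfl⟩
  choose w hw1 hw2 using hb
  refine ⟨w, Fintype.linearIndependent_iff.mpr fun g hg i => ?_⟩
  have h := congrFun (congrArg Subtype.val hg) (y i)
  simp only [Submodule.coe_sum, Submodule.coe_smul, Finset.sum_apply, Pi.smul_apply,
    smul_eq_mul] at h
  rw [Finset.sum_eq_single i (fun j _ hj => by rw [hw2 j i hj.symm, mul_zero])
    (fun h => absurd (Finset.mem_univ _) h), hw1, mul_one] at h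
  exact h

theorem norm_le_of_enorm_le {A B : Type*} [NormedAddCommGroup A] [NormedAddCommGroup B] {C : ℝ≥0∞}
    (hC : C ≠ ⊤) {a : A} {b : B} (h : ‖a‖ₑ ≤ C * ‖b‖ₑ) : ‖a‖ ≤ C.toReal * ‖b‖ := by
  have := ENNReal.toReal_mono (ENNReal.mul_ne_top hC enorm_ne_top) h
  simpa [ENNReal.toReal_mul] using this

end StretchedCorner

end

/-! ### The energy space and its embeddings. -/

noncomputable section

namespace StretchedCorner

open Filter Topology

open scoped ENNReal NNReal

variable {n : ℕ} {X : Set (EuclideanSpace ℝ (Fin n))} {δ p q : ℝ}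

theorem memLp_val (hX : IsOpen X) (hXbdd : Bornology.IsBounded X) (hn : 0 < n) (hp : 1 ≤ p)
    {φ : Amb n → ℝ} (hφ : IsTest (corner δ X) φ) :
    MemLp (fun x => pW p x • φ x) (ENNReal.ofReal p) (sigma δ X) := by
  have hp0 : 0 < p := by linarith
  obtain ⟨C, hC, h⟩ := exists_massP_le hn hXbdd δ hp
  refine memLp_of_lintegral hp0 (measurable_pW.smul
    hφ.contDiff_one.continuous.measurable).aestronglyMeasurable ?_
  rw [lintegral_val_sigma hX hp0 hφ]
  exact ne_top_of_le_ne_top (ENNReal.mul_ne_top hC (gradP_ne_top hp0 hφ)) (h φ hφ)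

theorem memLp_qval (hX : IsOpen X) (hp : 0 < p) (hq : 0 < q) {C : ℝ≥0∞} (hC : C ≠ ⊤)
    (h : ∀ φ : Amb n → ℝ, IsTest (corner δ X) φ → massQ p q φ ≤ C * gradP p φ ^ (q / p))
    {φ : Amb n → ℝ} (hφ : IsTest (corner δ X) φ) :
    MemLp (fun x => qW p q x • φ x) (ENNReal.ofReal q) (sigma δ X) := by
  refine memLp_of_lintegral hq (measurable_qW.smul
    hφ.contDiff_one.continuous.measurable).aestronglyMeasurable ?_
  rw [lintegral_qval_sigma hX hq hφ]
  exact ne_top_of_le_ne_top (ENNReal.mul_ne_top hC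
    (ENNReal.rpow_ne_top_of_nonneg (by positivity) (gradP_ne_top hp hφ))) (h φ hφ)

section EnergySpace

variable [Fact (1 ≤ ENNReal.ofReal p)] [Fact (1 ≤ ENNReal.ofReal q)]

/-- The closure of the weighted gradients `x₁^{1/p} ∇_𝕄 φ` of test functions. -/
def energySpace (hX : IsOpen X) (hp : 0 < p) (δ : ℝ) :
    Submodule ℝ (Lp (Amb n) (ENNReal.ofReal p) (sigma δ X)) :=
  (LinearMap.range (gradLp hX hp)).topologicalClosure

/-- The embedding of the test functions into the energy space. -/
def energyGrad (hX : IsOpen X) (hp : 0 < p) (δ : ℝ) :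
    testSpace (corner δ X) →ₗ[ℝ] energySpace hX hp δ :=
  (gradLp hX hp).codRestrict _ fun φ => subset_closure (LinearMap.mem_range_self _ φ)

theorem coe_energyGrad (hX : IsOpen X) (hp : 0 < p) (φ : testSpace (corner δ X)) :
    (energyGrad hX hp δ φ : Lp (Amb n) (ENNReal.ofReal p) (sigma δ X)) = gradLp hX hp φ := rfl

theorem denseRange_energyGrad (hX : IsOpen X) (hp : 0 < p) : DenseRange (energyGrad hX hp δ) := by
  intro v
  rw [closure_subtype]
  refine closure_mono ?_ v.2
  rintro _ ⟨φ, rfl⟩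
  exact ⟨energyGrad hX hp δ φ, ⟨φ, rfl⟩, rfl⟩

instance (hX : IsOpen X) (hp : 0 < p) : CompleteSpace (energySpace hX hp δ) :=
  (Submodule.isClosed_topologicalClosure _).completeSpace_coe

theorem uniformConvexSpace_submodule {Z : Type*} [NormedAddCommGroup Z] [NormedSpace ℝ Z]
    [UniformConvexSpace Z] (K : Submodule ℝ Z) : UniformConvexSpace K := by
  refine ⟨fun ε hε => ?_⟩
  obtain ⟨d, hd, h⟩ := UniformConvexSpace.uniform_convex (E := Z) hε
  exact ⟨d, hd, fun x hx y hy hxy => h (x := (x : Z)) hx (y := (y : Z)) hy hxy⟩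

/-- An estimate for test functions extends to an operator on the energy space. -/
theorem exists_extension (hX : IsOpen X) (hp : 0 < p) {r : ℝ} [Fact (1 ≤ ENNReal.ofReal r)]
    (T : testSpace (corner δ X) →ₗ[ℝ] Lp ℝ (ENNReal.ofReal r) (sigma δ X)) {C : ℝ≥0∞} (hC : C ≠ ⊤)
    (h : ∀ φ, ‖T φ‖ₑ ≤ C * ‖gradLp hX hp φ‖ₑ) :
    ∃ S : energySpace hX hp δ →L[ℝ] Lp ℝ (ENNReal.ofReal r) (sigma δ X),
      ∀ φ, S (energyGrad hX hp δ φ) = T φ :=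
  ⟨T.extendOfNorm (energyGrad hX hp δ), LinearMap.extendOfNorm_eq (denseRange_energyGrad hX hp)
    ⟨C.toReal, fun φ => norm_le_of_enorm_le hC (h φ)⟩⟩

/-- Elements of the energy space are limits of gradients; Poincaré's inequality recovers from them
the functions themselves. -/
theorem exists_val_extension (hX : IsOpen X) (hXbdd : Bornology.IsBounded X) (hn : 0 < n)
    (hp : 1 ≤ p) (hp0 : 0 < p) :
    ∃ S : energySpace hX hp0 δ →L[ℝ] Lp ℝ (ENNReal.ofReal p) (sigma δ X),
      ∀ φ, S (energyGrad hX hp0 δ φ) =ᵐ[sigma δ X] fun x => pW p x • φ.1 x := by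
  obtain ⟨C, hC, h⟩ := exists_massP_le hn hXbdd δ hp
  obtain ⟨S, hS⟩ := exists_extension hX hp0
    (mulLp (δ := δ) (pW p) fun φ hφ => memLp_val hX hXbdd hn hp hφ) (C := C ^ (1 / p))
    (ENNReal.rpow_ne_top_of_nonneg (by positivity) hC) fun φ => by
      rw [enorm_mulLp hp0, lintegral_val_sigma hX hp0 φ.2, enorm_gradLp,
        ← ENNReal.mul_rpow_of_nonneg _ _ (by positivity)]
      exact ENNReal.rpow_le_rpow (h φ φ.2) (by positivity)
  exact ⟨S, fun φ => by rw [hS]; exact coeFn_mulLp _ φ⟩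

/-- The compact embedding of the energy space into the weighted `L^q`. -/
theorem exists_qval_extension (hδ : 0 < δ) (hX : IsOpen X) (hXbdd : Bornology.IsBounded X)
    (hne : X.Nonempty) (hn : 0 < n) (hp : 1 ≤ p) (hp0 : 0 < p) (hpN : p < (n : ℝ) + 2)
    (hpq : p < q) (hq : q < ((n : ℝ) + 2) * p / ((n : ℝ) + 2 - p)) (hqp : q < p * (p + 1)) :
    ∃ S : energySpace hX hp0 δ →L[ℝ] Lp ℝ (ENNReal.ofReal q) (sigma δ X),
      (∀ φ, S (energyGrad hX hp0 δ φ) =ᵐ[sigma δ X] fun x => qW p q x • φ.1 x) ∧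
      (∀ v : ℕ → energySpace hX hp0 δ, (∀ k, ‖v k‖ ≤ 1) →
        ∃ y, ∃ σ : ℕ → ℕ, StrictMono σ ∧ Tendsto (fun k => S (v (σ k))) atTop (𝓝 y)) ∧
      ∀ m, ∃ w : Fin (m + 1) → energySpace hX hp0 δ, LinearIndependent ℝ fun i => S (w i) := by
  have hq0 : 0 < q := hp0.trans hpq
  obtain ⟨C, hC, h⟩ := exists_massQ_le hδ hXbdd hn hp hpN hpq hq hqp
  have hmem : ∀ φ, IsTest (corner δ X) φ →
      MemLp (fun x => qW p q x • φ x) (ENNReal.ofReal q) (sigma δ X) :=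
    fun φ hφ => memLp_qval hX hp0 hq0 hC h hφ
  have hnorm : ∀ φ, ‖mulLp (qW p q) hmem φ‖ₑ = massQ p q φ.1 ^ (1 / q) := fun φ => by
    rw [enorm_mulLp hq0, lintegral_qval_sigma hX hq0 φ.2]
  obtain ⟨S, hS⟩ := exists_extension hX hp0 (mulLp (qW p q) hmem) (C := C ^ (1 / q))
    (ENNReal.rpow_ne_top_of_nonneg (by positivity) hC) fun φ => by
      rw [hnorm, enorm_gradLp]
      refine (ENNReal.rpow_le_rpow (h φ φ.2) (by positivity)).trans_eq ?_
      rw [ENNReal.mul_rpow_of_nonneg _ _ (by positivity), ← ENNReal.rpow_mul]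
      congr 2
      field_simp
  refine ⟨S, fun φ => by rw [hS]; exact coeFn_mulLp _ φ, fun v hv => ?_, fun m => ?_⟩
  -- Replacing v_k by test functions at distance below 1/(k+1) reduces compactness to sequences of
  -- test functions, of norm at most 2.
  · have happ : ∀ k : ℕ, ∃ φ, dist (v k) (energyGrad hX hp0 δ φ) < 1 / ((k : ℝ) + 1) := fun k =>
      (denseRange_energyGrad hX hp0).exists_dist_lt (v k) (by positivity)
    choose φ hφ using happ
    have hφ2 : ∀ k, ‖energyGrad hX hp0 δ (φ k)‖ ≤ 2 := fun k => by
      have h1 : 1 / ((k : ℝ) + 1) ≤ 1 := by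
        rw [div_le_one (by positivity)]
        linarith [(Nat.cast_nonneg k : (0 : ℝ) ≤ k)]
      have h2 := hφ k
      rw [dist_eq_norm] at h2
      have h3 := norm_sub_norm_le (energyGrad hX hp0 δ (φ k)) (v k)
      rw [norm_sub_rev] at h3
      linarith [hv k]
    have hgr : ∀ k, gradP p (φ k).1 ≤ ENNReal.ofReal 2 ^ p := fun k => by
      have h1 : ‖gradLp hX hp0 (φ k)‖ₑ ≤ ENNReal.ofReal 2 := by
        rw [← ofReal_norm]
        exact ENNReal.ofReal_le_ofReal (hφ2 k)
      rw [enorm_gradLp] at h1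
      have h2 := ENNReal.rpow_le_rpow h1 hp0.le
      rwa [← ENNReal.rpow_mul, one_div_mul_cancel hp0.ne', ENNReal.rpow_one] at h2
    obtain ⟨σ, hσ, hcau⟩ := exists_subseq_cauchy hδ hXbdd hn hp hpN hpq hq hqp
      (fun k => (φ k).2) (ENNReal.rpow_ne_top_of_nonneg hp0.le ENNReal.ofReal_ne_top) hgr
    have hC2 : CauchySeq fun k => S (energyGrad hX hp0 δ (φ (σ k))) := by
      rw [Metric.cauchySeq_iff]
      intro ε hε
      obtain ⟨K, hK⟩ := hcau (ENNReal.ofReal (ε / 2) ^ q)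
        (ENNReal.rpow_pos (by simpa using hε) ENNReal.ofReal_ne_top)
      refine ⟨K, fun i hi j hj => ?_⟩
      have h1 := ENNReal.rpow_le_rpow (hK i hi j hj) (z := 1 / q) (by positivity)
      rw [← ENNReal.rpow_mul, mul_one_div_cancel hq0.ne', ENNReal.rpow_one] at h1
      have h2 : ‖S (energyGrad hX hp0 δ (φ (σ i))) - S (energyGrad hX hp0 δ (φ (σ j)))‖ₑ ≤
          ENNReal.ofReal (ε / 2) := by
        rw [hS, hS, ← map_sub, hnorm]
        exact h1
      rw [← ofReal_norm, ENNReal.ofReal_le_ofReal_iff (by positivity)] at h2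
      rw [dist_eq_norm]
      linarith
    obtain ⟨y, hy⟩ := cauchySeq_tendsto_of_complete hC2
    refine ⟨y, σ, hσ, ?_⟩
    have hd : Tendsto (fun k => S (v (σ k)) - S (energyGrad hX hp0 δ (φ (σ k)))) atTop (𝓝 0) := by
      have h0 : Tendsto (fun k => v (σ k) - energyGrad hX hp0 δ (φ (σ k))) atTop (𝓝 0) := by
        refine squeeze_zero_norm (fun k => ?_)
          (tendsto_one_div_add_atTop_nhds_zero_nat.comp hσ.tendsto_atTop)
        rw [← dist_eq_norm]
        exact (hφ (σ k)).le
      have h1 := (S.continuous.tendsto 0).comp h0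
      rw [map_zero] at h1
      refine h1.congr fun k => ?_
      rw [Function.comp_apply, map_sub]
    have := hd.add hy
    simpa using this
  · have hcne : (corner δ X).Nonempty := by
      obtain ⟨z, hz⟩ := hne
      refine ⟨WithLp.toLp 2 (Fin.cons (δ / 2) (Fin.cons (δ / 2) fun i => z i)),
        ⟨?_, ?_⟩, ⟨?_, ?_⟩, ?_⟩
      · change 0 < δ / 2
        linarith
      · change δ / 2 < δ
        linarith
      · change 0 < δ / 2
        linarith
      · change δ / 2 < δ
        linarith
      · exact hz
    obtain ⟨w, hw⟩ := exists_linearIndependent_testSpace (isOpen_corner hX δ) hcne (m + 1)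
    refine ⟨fun i => energyGrad hX hp0 δ (w i), ?_⟩
    simp_rw [hS]
    exact hw.map' (mulLp (qW p q) hmem)
      (LinearMap.ker_eq_bot.mpr (mulLp_injective hX hmem fun x hx => qW_pos hx))

end EnergySpace

end StretchedCorner

end

/-! ### Passing to the limit in integrals over the corner. -/

noncomputable section

namespace StretchedCorner

open Filter Topology

open scoped ENNReal NNReal

variable {n : ℕ} {X : Set (EuclideanSpace ℝ (Fin n))} {δ p q : ℝ}

theorem measure_corner_lt_top (hXbdd : Bornology.IsBounded X) : volume (corner δ X) < ⊤ := by
  obtain ⟨R, hR⟩ := exists_norm_le_of_mem_corner hXbdd δ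
  refine Bornology.IsBounded.measure_lt_top ?_
  exact isBounded_iff_forall_norm_le.mpr ⟨R, hR⟩

section

variable [Fact (1 ≤ ENNReal.ofReal p)]

/-- The space `L^p(σ)` embeds into `L^1` with respect to the Lebesgue measure on the corner. -/
theorem exists_lintegral_corner_le (hX : IsOpen X) (hXbdd : Bornology.IsBounded X) :
    ∃ C : ℝ≥0∞, C ≠ ⊤ ∧ ∀ f : Lp ℝ (ENNReal.ofReal p) (sigma δ X),
      ∫⁻ x in corner δ X, ‖f x‖ₑ ≤ C * ‖f‖ₑ := by
  have h1p : 1 ≤ ENNReal.ofReal p := Fact.out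
  have : IsFiniteMeasure (volume.restrict (corner δ X)) :=
    ⟨by rw [Measure.restrict_apply_univ]; exact measure_corner_lt_top hXbdd⟩
  set μ : Measure (Amb n) := volume.restrict (corner δ X) with hμ
  set c : ℝ≥0∞ := ENNReal.ofReal (δ * (δ * δ)) with hc
  refine ⟨c ^ (1 / ENNReal.ofReal p).toReal *
    μ Set.univ ^ (1 / (1 : ℝ≥0∞).toReal - 1 / (ENNReal.ofReal p).toReal), ?_, fun f => ?_⟩
  · refine ENNReal.mul_ne_top (ENNReal.rpow_ne_top_of_nonneg (by positivity)
      ENNReal.ofReal_ne_top) (ENNReal.rpow_ne_top_of_nonneg ?_ (measure_ne_top _ _))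
    have h : (1 : ℝ) ≤ (ENNReal.ofReal p).toReal := by
      have := ENNReal.toReal_mono ENNReal.ofReal_ne_top h1p
      simpa using this
    rw [sub_nonneg, ENNReal.toReal_one]
    exact one_div_le_one_div_of_le one_pos h
  · have hm : AEStronglyMeasurable f μ :=
      (Lp.aestronglyMeasurable f).mono_ac (absolutelyContinuous_sigma hX)
    have h1 := eLpNorm_le_eLpNorm_mul_rpow_measure_univ h1p hm
    have h2 : eLpNorm f (ENNReal.ofReal p) μ ≤
        c ^ (1 / ENNReal.ofReal p).toReal * ‖f‖ₑ := by
      refine (eLpNorm_mono_measure f (restrict_le_sigma hX)).trans ?_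
      rw [eLpNorm_smul_measure_of_ne_top ENNReal.ofReal_ne_top, smul_eq_mul, Lp.enorm_def]
    rw [eLpNorm_one_eq_lintegral_enorm] at h1
    refine h1.trans ((mul_le_mul_left h2 _).trans_eq ?_)
    ring

theorem integrable_corner (hX : IsOpen X) (hXbdd : Bornology.IsBounded X)
    (f : Lp ℝ (ENNReal.ofReal p) (sigma δ X)) : IntegrableOn f (corner δ X) := by
  obtain ⟨C, hC, h⟩ := exists_lintegral_corner_le (p := p) (δ := δ) hX hXbdd
  exact ⟨(Lp.aestronglyMeasurable f).mono_ac (absolutelyContinuous_sigma hX),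
    (h f).trans_lt (ENNReal.mul_lt_top hC.lt_top enorm_lt_top)⟩

/-- Used with b the product of inverse weights and a test function or its derivative, to pass to the
limit in the integration by parts defining the weak gradient. -/
theorem tendsto_integral_corner (hX : IsOpen X) (hXbdd : Bornology.IsBounded X)
    {f : ℕ → Lp ℝ (ENNReal.ofReal p) (sigma δ X)} {g : Lp ℝ (ENNReal.ofReal p) (sigma δ X)}
    (hf : Tendsto f atTop (𝓝 g)) {b : Amb n → ℝ} (hb : Measurable b) {B : ℝ}
    (hB : ∀ x, |b x| ≤ B) :
    Tendsto (fun k => ∫ x in corner δ X, b x * f k x) atTop (𝓝 (∫ x in corner δ X, b x * g x)) := by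
  obtain ⟨C, hC, h⟩ := exists_lintegral_corner_le (p := p) (δ := δ) hX hXbdd
  have hInt : ∀ f : Lp ℝ (ENNReal.ofReal p) (sigma δ X),
      IntegrableOn (fun x => b x * f x) (corner δ X) := fun f =>
    (integrable_corner hX hXbdd f).bdd_mul hb.aestronglyMeasurable (ae_of_all _ hB)
  refine tendsto_integral_of_L1 _ (hInt g).1 (Eventually.of_forall fun k => hInt (f k)) ?_
  have hB' : ENNReal.ofReal B * C ≠ ⊤ := ENNReal.mul_ne_top ENNReal.ofReal_ne_top hC
  have hlim : Tendsto (fun k => ENNReal.ofReal B * C * ‖f k - g‖ₑ) atTop (𝓝 0) := by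
    have h0 : Tendsto (fun k => ‖f k - g‖ₑ) atTop (𝓝 0) := by
      have := (continuous_enorm.tendsto (0 : Lp ℝ (ENNReal.ofReal p) (sigma δ X))).comp
        (tendsto_sub_nhds_zero_iff.mpr hf)
      simpa [Function.comp_def] using this
    have := ENNReal.Tendsto.const_mul h0 (Or.inr hB')
    simpa using this
  refine tendsto_of_tendsto_of_tendsto_of_le_of_le tendsto_const_nhds hlim (fun k => zero_le)
    fun k => ?_
  calc ∫⁻ x in corner δ X, ‖b x * f k x - b x * g x‖ₑ
      ≤ ∫⁻ x in corner δ X, ENNReal.ofReal B * ‖(f k - g : Lp ℝ _ _) x‖ₑ := by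
        refine lintegral_mono_ae ?_
        filter_upwards [(absolutelyContinuous_sigma hX).ae_le (Lp.coeFn_sub (f k) g)] with x hx
        rw [hx, Pi.sub_apply, ← mul_sub, enorm_mul]
        gcongr
        rw [← ofReal_norm]
        exact ENNReal.ofReal_le_ofReal (hB x)
    _ = ENNReal.ofReal B * ∫⁻ x in corner δ X, ‖(f k - g : Lp ℝ _ _) x‖ₑ :=
        lintegral_const_mul' _ _ ENNReal.ofReal_ne_top
    _ ≤ ENNReal.ofReal B * (C * ‖f k - g‖ₑ) := by gcongr; exact h _
    _ = _ := by ring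

end

/-- The inverse weights may blow up at the boundary, but only their values on the compact support of
ψ count. -/
theorem exists_bound_mul {Ω K : Set (Amb n)} (hK : IsCompact K) (hKΩ : K ⊆ Ω) {h ψ : Amb n → ℝ}
    (hh : ContinuousOn h Ω) (hψ : Continuous ψ) (h0 : ∀ x ∉ K, ψ x = 0) :
    ∃ B, ∀ x, |h x * ψ x| ≤ B := by
  obtain ⟨B, hB⟩ := hK.exists_bound_of_continuousOn ((hh.mono hKΩ).mul hψ.continuousOn)
  refine ⟨max B 0, fun x => ?_⟩
  by_cases hx : x ∈ K
  · exact (hB x hx).trans (le_max_left _ _)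
  · rw [h0 x hx, mul_zero, abs_zero]
    exact le_max_right _ _

theorem gradient_apply (φ : Amb n → ℝ) (x : Amb n) (i : Fin (n + 2)) :
    gradient φ x i = fderiv ℝ φ x (EuclideanSpace.single i 1) := by
  rw [← inner_gradient, EuclideanSpace.inner_single_right]
  simp

theorem continuous_gradient_apply {φ : Amb n → ℝ} (hφ : ContDiff ℝ 1 φ) (i : Fin (n + 2)) :
    Continuous fun x => gradient φ x i := by
  simp_rw [gradient_apply]
  exact (hφ.continuous_fderiv one_ne_zero).clm_apply continuous_const

theorem integral_mul_gradient {Ω : Set (Amb n)} {φ ψ : Amb n → ℝ}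
    (hφ : IsTest Ω φ) (hψ : IsTest Ω ψ) (i : Fin (n + 2)) :
    ∫ x in Ω, φ x * gradient ψ x i = -∫ x in Ω, gradient φ x i * ψ x := by
  rw [setIntegral_eq_integral_of_forall_compl_eq_zero fun x hx => ?_,
    setIntegral_eq_integral_of_forall_compl_eq_zero fun x hx => ?_]
  · have hcφ := hφ.contDiff_one.continuous
    have hcψ := hψ.contDiff_one.continuous
    simp_rw [gradient_apply]
    refine integral_mul_fderiv_eq_neg_fderiv_mul_of_integrable ?_ ?_ ?_
      (fun x _ => hφ.contDiff_one.differentiable (by norm_num) x)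
      (fun x _ => hψ.contDiff_one.differentiable (by norm_num) x)
    · refine Continuous.integrable_of_hasCompactSupport ?_ hψ.2.1.mul_left
      have h := continuous_gradient_apply hφ.contDiff_one i
      simp_rw [gradient_apply] at h
      exact h.mul hcψ
    · refine Continuous.integrable_of_hasCompactSupport ?_ hφ.2.1.mul_right
      have h := continuous_gradient_apply hψ.contDiff_one i
      simp_rw [gradient_apply] at h
      exact hcφ.mul h
    · exact (hcφ.mul hcψ).integrable_of_hasCompactSupport hφ.2.1.mul_right
  · rw [show ψ x = 0 from by by_contra h; exact hx (hψ.mem_of_ne h), mul_zero]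
  · rw [show φ x = 0 from by by_contra h; exact hx (hφ.mem_of_ne h), zero_mul]

/-- The coefficients of the corner gradient. -/
def coeff (x : Amb n) (i : Fin (n + 2)) : ℝ :=
  if i = 0 then x 0 else if i = 1 then x 0 * x 1 else 1

theorem cornerGrad_apply (x g : Amb n) (i : Fin (n + 2)) : cornerGrad x g i = coeff x i * g i := rfl

theorem coeff_pos {x : Amb n} (hx : x ∈ corner δ X) (i : Fin (n + 2)) : 0 < coeff x i := by
  have h1 := hx.1.1
  have h2 := hx.2.1.1
  unfold coeff
  split_ifs <;> positivity

theorem continuous_coeff (i : Fin (n + 2)) : Continuous fun x : Amb n => coeff x i := by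
  unfold coeff
  have h := fun i => continuous_coord (n := n) i
  split_ifs
  exacts [h 0, (h 0).mul (h 1), continuous_const]

/-- The inverse of the corner gradient. -/
def cornerGradInv (x g : Amb n) : Amb n := WithLp.toLp 2 fun i => (coeff x i)⁻¹ * g i

theorem cornerGrad_cornerGradInv {x : Amb n} (hx : x ∈ corner δ X) (g : Amb n) :
    cornerGrad x (cornerGradInv x g) = g := by
  ext i
  rw [cornerGrad_apply, cornerGradInv]
  exact mul_inv_cancel_left₀ (coeff_pos hx i).ne' _

end StretchedCorner

end

/-! ### Realizing elements of the energy space as functions in H^1_0. -/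

noncomputable section

namespace StretchedCorner

open Filter Topology

open scoped ENNReal NNReal

variable {n : ℕ} {X : Set (EuclideanSpace ℝ (Fin n))} {δ p q : ℝ}

variable [Fact (1 ≤ ENNReal.ofReal p)] [Fact (1 ≤ ENNReal.ofReal q)]

theorem exists_seq_tendsto (hX : IsOpen X) (hp : 0 < p) (v : energySpace hX hp δ) :
    ∃ φ : ℕ → testSpace (corner δ X), Tendsto (fun k => energyGrad hX hp δ (φ k)) atTop (𝓝 v) := by
  obtain ⟨y, hy, hlim⟩ := mem_closure_iff_seq_limit.mp (denseRange_energyGrad hX hp v)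
  choose φ hφ using hy
  exact ⟨φ, by simpa only [hφ] using hlim⟩

/-- Both extensions of the identity represent the same function. -/
theorem val_extension_compat (hX : IsOpen X) (hp : 0 < p)
    {P : energySpace hX hp δ →L[ℝ] Lp ℝ (ENNReal.ofReal p) (sigma δ X)}
    (hP : ∀ φ, P (energyGrad hX hp δ φ) =ᵐ[sigma δ X] fun x => pW p x • φ.1 x)
    {Q : energySpace hX hp δ →L[ℝ] Lp ℝ (ENNReal.ofReal q) (sigma δ X)}
    (hQ : ∀ φ, Q (energyGrad hX hp δ φ) =ᵐ[sigma δ X] fun x => qW p q x • φ.1 x)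
    (v : energySpace hX hp δ) :
    Q v =ᵐ[sigma δ X] fun x => qW p q x * ((pW p x)⁻¹ * P v x) := by
  obtain ⟨φ, hφ⟩ := exists_seq_tendsto hX hp v
  -- Norm convergence gives a.e. convergence only along subsequences; the second is taken inside the
  -- first so that both limits can be compared pointwise.
  obtain ⟨s, hs, hsP⟩ := (tendstoInMeasure_of_tendsto_Lp
    ((P.continuous.tendsto v).comp hφ)).exists_seq_tendsto_ae
  obtain ⟨t, ht, htQ⟩ := (tendstoInMeasure_of_tendsto_Lp
    (((Q.continuous.tendsto v).comp hφ).comp hs.tendsto_atTop)).exists_seq_tendsto_ae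
  filter_upwards [hsP, htQ, ae_all_iff.mpr fun k => hP (φ k), ae_all_iff.mpr fun k => hQ (φ k),
    ae_mem_corner hX] with x h1 h2 h3 h4 hx
  simp only [Function.comp_apply, h3, h4, smul_eq_mul] at h1 h2
  have h5 := ((h1.comp ht.tendsto_atTop).const_mul (pW p x)⁻¹).const_mul (qW p q x)
  refine tendsto_nhds_unique h2 (h5.congr fun k => ?_)
  simp only [Function.comp_apply]
  rw [inv_mul_cancel_left₀ (pW_pos hx).ne']

/-- The function whose weighted gradient is `v`. -/
def realize (hX : IsOpen X) (hp : 0 < p)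
    (P : energySpace hX hp δ →L[ℝ] Lp ℝ (ENNReal.ofReal p) (sigma δ X)) (v : energySpace hX hp δ)
    (x : Amb n) : ℝ := (pW p x)⁻¹ * P v x

/-- The weak gradient of the function whose weighted gradient is `v`. -/
def realizeGrad (hX : IsOpen X) (hp : 0 < p) (v : energySpace hX hp δ) (x : Amb n) : Amb n :=
  cornerGradInv x ((pW p x)⁻¹ • v.1 x)

theorem cornerGrad_realizeGrad (hX : IsOpen X) (hp : 0 < p) (v : energySpace hX hp δ) {x : Amb n}
    (hx : x ∈ corner δ X) : cornerGrad x (realizeGrad hX hp v x) = (pW p x)⁻¹ • v.1 x :=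
  cornerGrad_cornerGradInv hx _

/-- The components of an element of `L^p` with values in `ℝ^N`. -/
def component (i : Fin (n + 2)) : Lp (Amb n) (ENNReal.ofReal p) (sigma δ X) →L[ℝ]
    Lp ℝ (ENNReal.ofReal p) (sigma δ X) :=
  (EuclideanSpace.proj i : Amb n →L[ℝ] ℝ).compLpL (ENNReal.ofReal p) (sigma δ X)

theorem coeFn_component (i : Fin (n + 2)) (v : Lp (Amb n) (ENNReal.ofReal p) (sigma δ X)) :
    component i v =ᵐ[sigma δ X] fun x => v x i :=
  (EuclideanSpace.proj i : Amb n →L[ℝ] ℝ).coeFn_compLpL v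

/-- The identity is integration by parts for approximating test functions, and both sides are
continuous in the energy norm. The function u is fixed only almost everywhere because the solutions
are counted as classes. -/
theorem hasWeakGradient_realize (hX : IsOpen X) (hXbdd : Bornology.IsBounded X) (hp : 0 < p)
    {P : energySpace hX hp δ →L[ℝ] Lp ℝ (ENNReal.ofReal p) (sigma δ X)}
    (hP : ∀ φ, P (energyGrad hX hp δ φ) =ᵐ[sigma δ X] fun x => pW p x • φ.1 x)
    (v : energySpace hX hp δ) {u : Amb n → ℝ}
    (hu : u =ᵐ[volume.restrict (corner δ X)] realize hX hp P v) :
    HasWeakGradient (corner δ X) u (realizeGrad hX hp v) := by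
  have hM := isOpen_corner hX δ
  have hac := (absolutelyContinuous_sigma (δ := δ) hX).ae_le
  have hinv : ContinuousOn (fun x : Amb n => (pW p x)⁻¹) (corner δ X) :=
    continuousOn_pW.inv₀ fun x hx => (pW_pos hx).ne'
  have hcinv : ∀ i, ContinuousOn (fun x : Amb n => (coeff x i)⁻¹ * (pW p x)⁻¹) (corner δ X) :=
    fun i => ((continuous_coeff i).continuousOn.inv₀ fun x hx => (coeff_pos hx i).ne').mul hinv
  refine ⟨?_, ?_, fun ψ hψ i => ?_⟩
  · exact ((integrable_corner hX hXbdd (P v)).locallyIntegrableOn.continuousOn_mul hinv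
      hM.isLocallyClosed).congr hu.symm
  · rw [locallyIntegrableOn_iff hM.isLocallyClosed]
    intro K hKM hK
    refine Integrable.of_eval_piLp fun i => ?_
    have h1 := ((integrable_corner hX hXbdd (component i v.1)).mono_set hKM).continuousOn_mul
      ((hcinv i).mono hKM) hK
    refine h1.congr ?_
    filter_upwards [ae_mono (Measure.restrict_mono hKM le_rfl) (hac (coeFn_component i v.1))]
      with x hx
    rw [hx]
    change _ = (coeff x i)⁻¹ * ((pW p x)⁻¹ * v.1 x i)
    ring
  · obtain ⟨φ, hφ⟩ := exists_seq_tendsto hX hp v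
    have hK : IsCompact (tsupport ψ) := hψ.2.1
    have hgc := continuous_gradient_apply hψ.contDiff_one i
    obtain ⟨B₁, hB₁⟩ := exists_bound_mul hK hψ.2.2 hinv hgc
      fun x hx => by rw [hψ.gradient_eq_zero hx]; rfl
    obtain ⟨B₂, hB₂⟩ := exists_bound_mul hK hψ.2.2 (hcinv i) hψ.contDiff_one.continuous
      fun x hx => image_eq_zero_of_notMem_tsupport hx
    have hlim₁ := tendsto_integral_corner hX hXbdd ((P.continuous.tendsto v).comp hφ)
      (measurable_pW.inv.mul hgc.measurable) hB₁
    have hlim₂ := tendsto_integral_corner hX hXbdd (((component i).continuous.tendsto v.1).comp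
      ((continuous_subtype_val.tendsto v).comp hφ))
      (((continuous_coeff i).measurable.inv.mul measurable_pW.inv).mul
        hψ.contDiff_one.continuous.measurable) hB₂
    have e₁ : ∀ k, ∫ x in corner δ X, (pW p x)⁻¹ * gradient ψ x i *
        P (energyGrad hX hp δ (φ k)) x = ∫ x in corner δ X, (φ k).1 x * gradient ψ x i := by
      intro k
      refine integral_congr_ae ?_
      filter_upwards [hac (hP (φ k)), ae_restrict_mem hM.measurableSet] with x hx hxM
      rw [hx, smul_eq_mul]
      field_simp [(pW_pos hxM : 0 < pW p x).ne']
    have e₂ : ∀ k, ∫ x in corner δ X, (coeff x i)⁻¹ * (pW p x)⁻¹ * ψ x *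
        component i (energyGrad hX hp δ (φ k)).1 x =
        ∫ x in corner δ X, gradient (φ k).1 x i * ψ x := by
      intro k
      refine integral_congr_ae ?_
      filter_upwards [hac (coeFn_component i (energyGrad hX hp δ (φ k)).1),
        hac (coeFn_gradLp hX hp (φ k)), ae_restrict_mem hM.measurableSet] with x hx hx' hxM
      rw [hx, coe_energyGrad, hx', PiLp.smul_apply, cornerGrad_apply, smul_eq_mul]
      field_simp [(pW_pos hxM : 0 < pW p x).ne', (coeff_pos hxM i).ne']
    have h := tendsto_nhds_unique (hlim₁.congr e₁)
      ((hlim₂.congr e₂).neg.congr fun k => (integral_mul_gradient (φ k).2 hψ i).symm)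
    calc ∫ x in corner δ X, u x * gradient ψ x i
        = ∫ x in corner δ X, (pW p x)⁻¹ * gradient ψ x i * P v x := by
          refine integral_congr_ae ?_
          filter_upwards [hu] with x hx
          rw [hx, realize]
          ring
      _ = _ := h
      _ = -∫ x in corner δ X, realizeGrad hX hp v x i * ψ x := by
          congr 1
          refine integral_congr_ae ?_
          filter_upwards [hac (coeFn_component i v.1)] with x hx
          rw [hx]
          change (coeff x i)⁻¹ * (pW p x)⁻¹ * ψ x * v.1 x i =
            (coeff x i)⁻¹ * ((pW p x)⁻¹ * v.1 x i) * ψ x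
          ring

/-- Approximation in the energy norm is approximation in the full Sobolev norm, by continuity of P.
-/
theorem memH10_realize (hX : IsOpen X) (hXbdd : Bornology.IsBounded X) (hp : 0 < p)
    {P : energySpace hX hp δ →L[ℝ] Lp ℝ (ENNReal.ofReal p) (sigma δ X)}
    (hP : ∀ φ, P (energyGrad hX hp δ φ) =ᵐ[sigma δ X] fun x => pW p x • φ.1 x)
    (v : energySpace hX hp δ) {u : Amb n → ℝ}
    (hu : u =ᵐ[volume.restrict (corner δ X)] realize hX hp P v) :
    MemH10 δ X p (((n : ℝ) + 2 - 1) / p) (((n : ℝ) + 2) / p) u (realizeGrad hX hp v) := by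
  have hval : (fun x => pW p x • u x) =ᵐ[sigma δ X] P v := by
    filter_upwards [sigma_absolutelyContinuous.ae_le hu, ae_mem_corner hX] with x hx hxM
    rw [hx, realize, smul_eq_mul, mul_inv_cancel_left₀ (pW_pos hxM).ne']
  have hgrad : (fun x => pW p x • cornerGrad x (realizeGrad hX hp v x)) =ᵐ[sigma δ X] v.1 := by
    filter_upwards [ae_mem_corner hX] with x hxM
    rw [cornerGrad_realizeGrad hX hp v hxM, smul_inv_smul₀ (pW_pos hxM).ne']
  refine ⟨⟨hasWeakGradient_realize hX hXbdd hp hP v hu, (Lp.memLp (P v)).ae_eq hval.symm,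
    (Lp.memLp v.1).ae_eq hgrad.symm⟩, fun ε hε => ?_⟩
  obtain ⟨φ, hφ⟩ := exists_seq_tendsto hX hp v
  have h1 : Tendsto (fun k => ‖P v - P (energyGrad hX hp δ (φ k))‖ₑ +
      ‖v - energyGrad hX hp δ (φ k)‖ₑ) atTop (𝓝 0) := by
    have hc : Continuous fun w => ‖P v - P w‖ₑ + ‖v - w‖ₑ := by fun_prop
    have h0 : ‖P v - P v‖ₑ + ‖v - v‖ₑ = 0 := by
      rw [sub_self, sub_self, ← ofReal_norm, ← ofReal_norm, norm_zero, norm_zero]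
      simp
    have := (hc.tendsto v).comp hφ
    rwa [h0] at this
  obtain ⟨k, hk⟩ := (h1.eventually (gt_mem_nhds hε)).exists
  refine ⟨(φ k).1, (φ k).2, lt_of_eq_of_lt ?_ hk⟩
  have e1 : cornerNorm δ X p (((n : ℝ) + 2 - 1) / p) (((n : ℝ) + 2) / p)
      (fun x => u x - (φ k).1 x) = ‖P v - P (energyGrad hX hp δ (φ k))‖ₑ := by
    rw [Lp.enorm_def]
    refine eLpNorm_congr_ae ?_
    filter_upwards [hval, hP (φ k), Lp.coeFn_sub (P v) (P (energyGrad hX hp δ (φ k)))]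
      with x h2 h3 h4
    change pW p x • (u x - (φ k).1 x) = _
    rw [h4, Pi.sub_apply, h3, ← h2, smul_sub]
  have e2 : cornerNorm δ X p (((n : ℝ) + 2 - 1) / p) (((n : ℝ) + 2) / p)
      (fun x => cornerGrad x (realizeGrad hX hp v x - gradient (φ k).1 x)) =
      ‖v - energyGrad hX hp δ (φ k)‖ₑ := by
    change _ = ‖v.1 - gradLp hX hp (φ k)‖ₑ
    rw [Lp.enorm_def]
    refine eLpNorm_congr_ae ?_
    filter_upwards [hgrad, coeFn_gradLp hX hp (φ k), Lp.coeFn_sub v.1 (gradLp hX hp (φ k))]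
      with x h2 h3 h4
    change pW p x • cornerGrad x (realizeGrad hX hp v x - gradient (φ k).1 x) = _
    rw [h4, Pi.sub_apply, h3, ← h2, cornerGrad_sub, smul_sub]
  rw [e1, e2]

end StretchedCorner

end

/-! ### The Euler–Lagrange equation, rescaling, and the conclusion. -/

noncomputable section

namespace LpDuality

open Filter Topology

variable {α : Type*} [MeasurableSpace α] {μ : Measure α}
  {H : Type*} [NormedAddCommGroup H] [InnerProductSpace ℝ H] {r : ℝ}

/-- Homogeneity of degree r turns the weights inside the L^p and L^q pairings into the factors x₁
and x₁(x₁x₂)^p of the weak formulation. -/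
theorem inner_rpow_smul_smul {w : ℝ} (hw : 0 < w) (a b : H) :
    inner ℝ (‖w • a‖ ^ (r - 2) • (w • a)) (w • b) = w ^ r * (‖a‖ ^ (r - 2) * inner ℝ a b) := by
  have h : w ^ r = w ^ (r - 2) * w * w := by
    rw [← Real.rpow_add_one hw.ne', ← Real.rpow_add_one hw.ne']
    congr 1
    ring
  rw [norm_smul, Real.norm_of_nonneg hw.le, Real.mul_rpow hw.le (norm_nonneg _),
    real_inner_smul_left, real_inner_smul_left, real_inner_smul_right, h]
  ring

theorem pairing_smul_left [Fact (1 ≤ ENNReal.ofReal r)] {t : ℝ} (ht : 0 < t)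
    (f g : Lp H (ENNReal.ofReal r) μ) :
    pairing r (t • f : Lp H (ENNReal.ofReal r) μ) g μ = t ^ (r - 1) * pairing r f g μ := by
  have h : t ^ (r - 1) = t ^ (r - 2) * t := by
    rw [← Real.rpow_add_one ht.ne']
    congr 1
    ring
  rw [pairing, pairing, ← integral_const_mul]
  refine integral_congr_ae ?_
  filter_upwards [Lp.coeFn_smul t f] with x hx
  rw [hx, Pi.smul_apply, norm_smul, Real.norm_of_nonneg ht.le,
    Real.mul_rpow ht.le (norm_nonneg _), real_inner_smul_left, real_inner_smul_left,
    real_inner_smul_left, h]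
  ring

/-- The Euler–Lagrange equation at a critical point. -/
theorem pairing_eq_of_critical {β : Type*} [MeasurableSpace β] {ν : Measure β} {H' : Type*}
    [NormedAddCommGroup H'] [InnerProductSpace ℝ H'] {s : ℝ} [Fact (1 ≤ ENNReal.ofReal r)]
    [Fact (1 ≤ ENNReal.ofReal s)] (hr : 2 < r) (hs : 2 < s)
    {K : Submodule ℝ (Lp H (ENNReal.ofReal r) μ)} (Q : K →L[ℝ] Lp H' (ENNReal.ofReal s) ν) {ρ : ℝ}
    (hρ : 0 < ρ) {v : K} (hv : ‖v‖ = 1) (hQv : ‖Q v‖ = ρ)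
    (hcrit : ∀ w, dualityMap hs (Q v) (Q w) ≤ ρ * ‖w‖) (w : K) :
    pairing r v.1 w.1 μ = ρ ^ (-s) * pairing s (Q v) (Q w) ν := by
  have hv0 : v ≠ 0 := by
    rintro rfl
    simp at hv
  -- The functional D(Qv)∘Q attains its norm ρ at v, hence is ρ times the norming functional of v in
  -- L^r.
  have h := PowerMethod.eq_of_norming (isDualityMap (μ := μ) (H := H) hr)
    (ℓ := ((dualityMap hs (Q v)).comp Q).toLinearMap) hρ.le hv0
    (by
      change dualityMap hs (Q v) (Q v) = _
      rw [(isDualityMap hs).apply_self, hQv, hv, mul_one]) hcrit w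
  change dualityMap hs (Q v) (Q w) = ρ * dualityMap hr v.1 w.1 at h
  have hv1 : ‖v.1‖ = 1 := hv
  rw [dualityMap, dualityMap, smul_apply, smul_apply, pairingCLM_apply, pairingCLM_apply, hQv, hv1,
    Real.one_rpow, one_smul, smul_eq_mul] at h
  have h2 : ρ ^ (1 - s) = ρ * ρ ^ (-s) := by
    rw [sub_eq_add_neg, Real.rpow_add hρ, Real.rpow_one]
  rw [h2, mul_assoc] at h
  exact (mul_left_cancel₀ hρ.ne' h).symm

end LpDuality

namespace StretchedCorner

open Filter Topology LpDuality

open scoped ENNReal NNReal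

variable {n : ℕ} {X : Set (EuclideanSpace ℝ (Fin n))} {δ p q : ℝ}

/-- The factor which turns a critical point into a solution. -/
def solutionScale (p q lam ρ : ℝ) : ℝ := (ρ ^ (-q) / lam) ^ (1 / (q - p))

theorem solutionScale_pos {lam ρ : ℝ} (hlam : 0 < lam) (hρ : 0 < ρ) :
    0 < solutionScale p q lam ρ := by
  unfold solutionScale
  positivity

theorem solutionScale_rpow (hpq : p < q) {lam ρ : ℝ} (hlam : 0 < lam) (hρ : 0 < ρ) :
    solutionScale p q lam ρ ^ (q - p) = ρ ^ (-q) / lam := by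
  rw [solutionScale, ← Real.rpow_mul (by positivity), one_div_mul_cancel (by linarith),
    Real.rpow_one]

/-- Raising tρ to the power q - p gives ρ^{-p}/lam, which is injective in ρ; so distinct critical
values yield distinct L^q norms of the rescaled solutions. -/
theorem solutionScale_injOn (hp : 0 < p) (hpq : p < q) {lam : ℝ} (hlam : 0 < lam) :
    Set.InjOn (fun ρ => solutionScale p q lam ρ * ρ) (Set.Ioi 0) := by
  have key : ∀ ρ : ℝ, 0 < ρ → (solutionScale p q lam ρ * ρ) ^ (q - p) = ρ ^ (-p) / lam := by
    intro ρ hρ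
    rw [Real.mul_rpow (solutionScale_pos hlam hρ).le hρ.le, solutionScale_rpow hpq hlam hρ,
      div_mul_eq_mul_div, ← Real.rpow_add hρ]
    congr 2
    ring
  intro ρ hρ ρ' hρ' h
  have h1 : ρ ^ (-p) / lam = ρ' ^ (-p) / lam := by
    rw [← key ρ hρ, ← key ρ' hρ']
    exact congrArg (· ^ (q - p)) h
  have h2 : ρ ^ (-p) = ρ' ^ (-p) := by
    rwa [div_left_inj' hlam.ne'] at h1
  exact Real.rpow_left_injOn (neg_ne_zero.mpr hp.ne') (Set.mem_Ioi.mp hρ).le (Set.mem_Ioi.mp hρ').le h2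

variable [Fact (1 ≤ ENNReal.ofReal p)] [Fact (1 ≤ ENNReal.ofReal q)]

theorem eLpNorm_qW_mul (hX : IsOpen X) (hp : 0 < p)
    {P : energySpace hX hp δ →L[ℝ] Lp ℝ (ENNReal.ofReal p) (sigma δ X)}
    (hP : ∀ φ, P (energyGrad hX hp δ φ) =ᵐ[sigma δ X] fun x => pW p x • φ.1 x)
    {Q : energySpace hX hp δ →L[ℝ] Lp ℝ (ENNReal.ofReal q) (sigma δ X)}
    (hQ : ∀ φ, Q (energyGrad hX hp δ φ) =ᵐ[sigma δ X] fun x => qW p q x • φ.1 x)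
    (v : energySpace hX hp δ) {u : Amb n → ℝ}
    (hu : u =ᵐ[volume.restrict (corner δ X)] realize hX hp P v) :
    eLpNorm (fun x => qW p q x * u x) (ENNReal.ofReal q) (sigma δ X) = ‖Q v‖ₑ := by
  rw [Lp.enorm_def]
  refine eLpNorm_congr_ae ?_
  filter_upwards [val_extension_compat hX hp hP hQ v, sigma_absolutelyContinuous.ae_le hu]
    with x h1 h2
  rw [h1, h2, realize]

theorem isWeakSolution_realize (hX : IsOpen X) (hXbdd : Bornology.IsBounded X) (hp : 0 < p)
    (hp2 : 2 < p) (hq2 : 2 < q)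
    {P : energySpace hX hp δ →L[ℝ] Lp ℝ (ENNReal.ofReal p) (sigma δ X)}
    (hP : ∀ φ, P (energyGrad hX hp δ φ) =ᵐ[sigma δ X] fun x => pW p x • φ.1 x)
    {Q : energySpace hX hp δ →L[ℝ] Lp ℝ (ENNReal.ofReal q) (sigma δ X)}
    (hQ : ∀ φ, Q (energyGrad hX hp δ φ) =ᵐ[sigma δ X] fun x => qW p q x • φ.1 x)
    {lam : ℝ} {v : energySpace hX hp δ}
    (hv : ∀ w : energySpace hX hp δ,
      pairing p v.1 w.1 (sigma δ X) = lam * pairing q (Q v) (Q w) (sigma δ X))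
    {u : Amb n → ℝ} (hu : u =ᵐ[volume.restrict (corner δ X)] realize hX hp P v) :
    IsWeakSolution δ X p q lam u := by
  refine ⟨realizeGrad hX hp v, memH10_realize hX hXbdd hp hP v hu, fun φ hφ => ?_⟩
  set w : energySpace hX hp δ := energyGrad hX hp δ ⟨φ, hφ⟩ with hw
  have e1 : (fun x => inner ℝ (‖v.1 x‖ ^ (p - 2) • v.1 x) (w.1 x)) =ᵐ[sigma δ X]
      fun x => x 0 * (‖cornerGrad x (realizeGrad hX hp v x)‖ ^ (p - 2) *
        inner ℝ (cornerGrad x (realizeGrad hX hp v x)) (cornerGrad x (gradient φ x))) := by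
    filter_upwards [coeFn_gradLp hX hp ⟨φ, hφ⟩, ae_mem_corner hX] with x h1 hx
    have hc : v.1 x = pW p x • cornerGrad x (realizeGrad hX hp v x) := by
      rw [cornerGrad_realizeGrad hX hp v hx, smul_inv_smul₀ (pW_pos hx).ne']
    have h2 : w.1 x = pW p x • cornerGrad x (gradient φ x) := h1
    rw [h2]
    conv_lhs => rw [hc]
    rw [inner_rpow_smul_smul (pW_pos hx), pW_rpow hp hx]
  have e2 : (fun x => inner ℝ (‖Q v x‖ ^ (q - 2) • Q v x) (Q w x)) =ᵐ[sigma δ X]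
      fun x => x 0 * (x 0 * x 1) ^ p * (|u x| ^ (q - 2) * u x * φ x) := by
    filter_upwards [hQ ⟨φ, hφ⟩, val_extension_compat hX hp hP hQ v,
      sigma_absolutelyContinuous.ae_le hu, ae_mem_corner hX] with x h1 h2 h3 hx
    have h4 : Q v x = qW p q x • u x := by rw [h2, h3, realize, smul_eq_mul]
    rw [h4, h1, inner_rpow_smul_smul (qW_pos hx), qW_rpow (by linarith) hx]
    simp only [Real.norm_eq_abs, RCLike.inner_apply, conj_trivial]
    ring
  refine ⟨(integrable_inner hp2 (Lp.memLp v.1) (Lp.memLp w.1)).congr e1,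
    (integrable_inner hq2 (Lp.memLp (Q v)) (Lp.memLp (Q w))).congr e2, ?_⟩
  rw [← integral_congr_ae e1, ← integral_congr_ae e2]
  exact hv w

/-- The two sides have degrees p - 1 and q - 1 in t, so the multiplier ρ^{-q} becomes lam when lam ·
t^{q-p} = ρ^{-q}. -/
theorem pairing_solutionScale_smul (hX : IsOpen X) (hp : 0 < p) (hpq : p < q)
    {Q : energySpace hX hp δ →L[ℝ] Lp ℝ (ENNReal.ofReal q) (sigma δ X)} {lam ρ : ℝ}
    (hlam : 0 < lam) (hρ : 0 < ρ) {v w : energySpace hX hp δ}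
    (h : pairing p v.1 w.1 (sigma δ X) = ρ ^ (-q) * pairing q (Q v) (Q w) (sigma δ X)) :
    pairing p (solutionScale p q lam ρ • v).1 w.1 (sigma δ X) =
      lam * pairing q (Q (solutionScale p q lam ρ • v)) (Q w) (sigma δ X) := by
  set t := solutionScale p q lam ρ with ht
  have ht0 : 0 < t := solutionScale_pos hlam hρ
  have h1 : t ^ (q - 1) = t ^ (p - 1) * t ^ (q - p) := by
    rw [← Real.rpow_add ht0]
    congr 1
    ring
  have h2 : lam * t ^ (q - p) = ρ ^ (-q) := by
    rw [ht, solutionScale_rpow hpq hlam hρ]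
    field_simp
  have h3 : (t • v).1 = t • v.1 := rfl
  rw [map_smul, h3, pairing_smul_left ht0, pairing_smul_left ht0, h, h1, ← h2]
  ring

/-- The Dirichlet problem has infinitely many weak solutions. -/
theorem infinite_setOf_isWeakSolution (n : ℕ) (X : Set (EuclideanSpace ℝ (Fin n)))
    (hXopen : IsOpen X) (hXbdd : Bornology.IsBounded X) (hXne : X.Nonempty)
    (δ : ℝ) (hδ : 0 < δ) (p q lam : ℝ)
    (hp2 : 2 < p) (hpN : p < (n : ℝ) + 2)
    (hpq : p < q) (hqstar : q < ((n : ℝ) + 2) * p / ((n : ℝ) + 2 - p))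
    (hqp : q < p * (p + 1)) (hlam : 0 < lam) :
    {u : Amb n →ₘ[volume.restrict (corner δ X)] ℝ |
      u ≠ 0 ∧ IsWeakSolution δ X p q lam u}.Infinite := by
  have hp : 0 < p := by linarith
  have hp1 : 1 ≤ p := by linarith
  have hq2 : 2 < q := by linarith
  -- Poincaré's inequality needs an x'-direction; n = 0 is excluded by 2 < p < n + 2.
  have hn : 0 < n := by
    rcases Nat.eq_zero_or_pos n with rfl | h
    · norm_num at hpN
      linarith
    · exact h
  have : Fact (1 ≤ ENNReal.ofReal p) := ⟨ENNReal.one_le_ofReal.mpr hp1⟩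
  have : Fact (1 ≤ ENNReal.ofReal q) := ⟨ENNReal.one_le_ofReal.mpr (by linarith)⟩
  obtain ⟨P, hP⟩ := exists_val_extension (δ := δ) hXopen hXbdd hn hp1 hp
  obtain ⟨Q, hQ, hQc, hQi⟩ := exists_qval_extension hδ hXopen hXbdd hXne hn hp1 hp hpN hpq hqstar hqp
  have : UniformConvexSpace (Lp (Amb n) (ENNReal.ofReal p) (sigma δ X)) :=
    LpDuality.uniformConvexSpace hp2.le
  have : UniformConvexSpace (energySpace hXopen hp δ) := uniformConvexSpace_submodule _
  have hcrit := PowerMethod.infinite_criticalValues (LpDuality.isDualityMap hq2) hQc hQi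
  have hex : ∀ ρ ∈ PowerMethod.criticalValues (LpDuality.dualityMap hq2) Q,
      ∃ v : energySpace hXopen hp δ, ‖Q v‖ = solutionScale p q lam ρ * ρ ∧
        ∀ w : energySpace hXopen hp δ, LpDuality.pairing p v.1 w.1 (sigma δ X) =
          lam * LpDuality.pairing q (Q v) (Q w) (sigma δ X) := by
    rintro ρ ⟨hρ, v, hv, hQv, hc⟩
    refine ⟨solutionScale p q lam ρ • v, ?_, fun w => ?_⟩
    · rw [map_smul, norm_smul, Real.norm_of_nonneg (solutionScale_pos hlam hρ).le, hQv]
    · exact pairing_solutionScale_smul hXopen hp hpq hlam hρ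
        (LpDuality.pairing_eq_of_critical hp2 hq2 Q hρ hv hQv hc w)
  choose! v hQv hv using hex
  have hm : ∀ w, AEStronglyMeasurable (realize hXopen hp P w) (volume.restrict (corner δ X)) :=
    fun w => (measurable_pW.inv.aestronglyMeasurable).mul
      ((Lp.aestronglyMeasurable (P w)).mono_ac (absolutelyContinuous_sigma hXopen))
  have hF : ∀ w, eLpNorm (fun x => qW p q x * AEEqFun.mk _ (hm w) x) (ENNReal.ofReal q)
      (sigma δ X) = ‖Q w‖ₑ := fun w =>
    eLpNorm_qW_mul hXopen hp hP hQ w (AEEqFun.coeFn_mk _ (hm w))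
  -- The weighted L^q norm of a class equals ‖Qv‖ = tρ, which both separates the solutions and shows
  -- that they are non-zero.
  refine Set.infinite_of_injOn_mapsTo (f := fun ρ => AEEqFun.mk _ (hm (v ρ)))
    (fun ρ hρ ρ' hρ' h => ?_) (fun ρ hρ => ⟨fun h => ?_, ?_⟩) hcrit
  · refine solutionScale_injOn hp hpq hlam hρ.1 hρ'.1 ?_
    have h1 := hF (v ρ)
    rw [show AEEqFun.mk _ (hm (v ρ)) = AEEqFun.mk _ (hm (v ρ')) from h, hF (v ρ')] at h1
    have h2 := congrArg ENNReal.toReal h1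
    rw [toReal_enorm, toReal_enorm, hQv ρ hρ, hQv ρ' hρ'] at h2
    exact h2.symm
  · have h1 := hF (v ρ)
    have h0 : (fun x => qW p q x * AEEqFun.mk _ (hm (v ρ)) x) =ᵐ[sigma δ X] 0 := by
      filter_upwards [sigma_absolutelyContinuous.ae_le (AEEqFun.coeFn_zero
        (μ := volume.restrict (corner δ X)) (β := ℝ) (α := Amb n))] with x hx
      rw [show AEEqFun.mk _ (hm (v ρ)) = 0 from h, hx]
      simp
    rw [eLpNorm_congr_ae h0, eLpNorm_zero] at h1
    have h2 := congrArg ENNReal.toReal h1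
    rw [toReal_enorm, hQv ρ hρ, ENNReal.toReal_zero] at h2
    exact (mul_pos (solutionScale_pos hlam hρ.1) hρ.1).ne h2
  · exact isWeakSolution_realize hXopen hXbdd hp hp2 hq2 hP hQ (hv ρ hρ)
      (AEEqFun.coeFn_mk _ (hm (v ρ)))

end StretchedCorner

end

theorem theorem1p1 (n : ℕ) (X : Set (EuclideanSpace ℝ (Fin n)))
    (hXopen : IsOpen X) (hXbdd : Bornology.IsBounded X) (hXne : X.Nonempty)
    (δ : ℝ) (hδ : 0 < δ) (p q lam : ℝ)
    (hp2 : 2 < p) (hpN : p < (n : ℝ) + 2)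
    (hpq : p < q) (hqstar : q < ((n : ℝ) + 2) * p / ((n : ℝ) + 2 - p))
    (hqp : q < p * (p + 1)) (hlam : 0 < lam) :
    {u : StretchedCorner.Amb n →ₘ[volume.restrict (StretchedCorner.corner δ X)] ℝ |
      u ≠ 0 ∧ StretchedCorner.IsWeakSolution δ X p q lam u}.Infinite :=
  StretchedCorner.infinite_setOf_isWeakSolution n X hXopen hXbdd hXne δ hδ p q lam hp2 hpN hpq hqstar
    hqp hlam
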